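/- Let $\mathbb{T}=\mathbb{R}/\mathbb{Z}$, write $\int$ for integration over $\mathbb{T}$, and for $s\in\mathbb{R}$ let $H^s(\mathbb{T})$ be the Sobolev space with norm $\|f\|_{H^s}^2=\sum_{k\in\mathbb{Z}}(1+k^2)^s|\widehat f(k)|^2$. For $N\in\mathbb{Z}$ consider, for real-valued $\zeta(t,x)$, the renormalized limit angle system $$\partial_t\zeta-8\pi^2N^2\Big(\zeta-\int\zeta\Big)-\partial_x^2\zeta=4\pi N\Big(\zeta-\int\zeta\Big)\partial_x\zeta-2\pi N v-v\,\partial_x\zeta,\qquad \partial_x v=-(\partial_x\zeta)^2+\int(\partial_x\zeta)^2,\quad v(t,0)=0 .$$ For $0<T<\infty$, a solution on $[0,T)$ with initial datum $\zeta_0$ is a function $\zeta\in L^4([0,T);H^1(\mathbb{T}))$ satisfying the equation in the weak sense, that is, tested against all functions in $C_c^\infty([0,T)\times\mathbb{T})$, the initial datum appearing as a boundary term at $t=0$. Functions of $(t,x)$ are identified when they agree almost everywhere. Theorem. Let $N\in\mathbb{Z}$ and let $\zeta_0\in H^{1/2}(\mathbb{T})$ be real-valued. 1. There is $T>0$, depending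 on the data, such that the system has a solution $\zeta\in L^4([0,T);H^1(\mathbb{T}))$ with initial datum $\zeta_0$. For every $T\in(0,\infty)$ there is at most one solution in $L^4([0,T);H^1(\mathbb{T}))$ with initial datum $\zeta_0$, and any such solution lies in $C^{0,1/4}([0,T);H^{-1}(\mathbb{T}))$ and takes the value $\zeta_0$ at $t=0$. 2. For every $T\in(0,\infty)$, any solution $\zeta\in L^4([0,T);H^1(\mathbb{T}))$ with initial datum $\zeta_0$ is smooth: $\zeta\in C^\infty((0,T)\times\mathbb{T})$. 3. There is an absolute constant $\eta_0>0$ such that if $N=0$ and $\|\zeta_0\|_{H^{1/2}}\le\eta_0$, then the solution is global: there is a function $\zeta$ on $[0,\infty)\times\mathbb{T}$ whose restriction to $[0,T)$ is, for every $T\in(0,\infty)$, the solution in $L^4([0,T);H^1(\mathbb{T}))$ with initial datum $\zeta_0$. -/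

import Mathlib

open MeasureTheory Set
open scoped ENNReal NNReal ContDiff

noncomputable section

namespace LimitSystem

/-- The torus `ℝ/ℤ`. -/
local notation "𝕋" => UnitAddCircle

/-- The Lebesgue measure on `ℝ/ℤ`, of total mass one. -/
local notation "μ𝕋" => (AddCircle.haarAddCircle : Measure UnitAddCircle)

/-- The Fourier coefficients `∫ f(x) exp(-2πikx) dx` of a real function on the torus. -/
def coeff (f : 𝕋 → ℝ) : ℤ → ℂ :=
  fourierCoeff (fun x => (f x : ℂ))

/-- The `H^s` norm `(∑ₖ (1 + k²)^s |aₖ|²)^{1/2}` of the periodic distribution whose Fourier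
coefficients are `a`, with values in `[0, ∞]`. -/
def hsNorm (s : ℝ) (a : ℤ → ℂ) : ℝ≥0∞ :=
  (∑' k : ℤ, ENNReal.ofReal ((1 + (k : ℝ) ^ 2) ^ s) * ‖a k‖ₑ ^ 2) ^ (1 / 2 : ℝ)

/-- Membership of a real function in `H^s(𝕋)`, for `s ≥ 0` (so that `H^s ⊆ L²`). -/
def MemHs (s : ℝ) (f : 𝕋 → ℝ) : Prop :=
  MemLp f 2 μ𝕋 ∧ hsNorm s (coeff f) < ⊤

/-- Lebesgue measure on `(0, T) × 𝕋`. -/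
def spaceTime (T : ℝ) : Measure (ℝ × 𝕋) :=
  (volume.restrict (Ioo 0 T)).prod μ𝕋

/-- `ζ ∈ L⁴([0, T); H¹(𝕋))`. -/
structure MemL4H1 (T : ℝ) (ζ : ℝ → 𝕋 → ℝ) : Prop where
  meas : AEStronglyMeasurable (fun q : ℝ × 𝕋 => ζ q.1 q.2) (spaceTime T)
  slice : ∀ᵐ t ∂volume.restrict (Ioo 0 T), MemHs 1 (ζ t)
  lintegral_lt : ∫⁻ t in Ioo 0 T, hsNorm 1 (coeff (ζ t)) ^ 4 < ⊤

/-- The integrable function `g` is the distributional derivative on the torus of the integrable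
function `f`, the identity `∂ₓ f = g` being tested against the exponentials. -/
structure HasWeakDeriv (f g : 𝕋 → ℝ) : Prop where
  integrable_left : Integrable f μ𝕋
  integrable_right : Integrable g μ𝕋
  coeff_eq : ∀ k : ℤ, coeff g k = 2 * Real.pi * Complex.I * k * coeff f k

/-- `v` is the velocity associated with the derivative `p = ∂ₓ ζ`:
`∂ₓ v = -p² + ∫ p²` and `v(0) = 0`. -/
structure IsVelocity (p v : 𝕋 → ℝ) : Prop where
  cont : Continuous v
  zero : v 0 = 0
  deriv : HasWeakDeriv v (fun x => -(p x) ^ 2 + ∫ y, (p y) ^ 2 ∂μ𝕋)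

/-- Test functions: smooth on `ℝ × 𝕋` and vanishing near and after time `T`. Restricted to
nonnegative times these are the elements of `C_c^∞([0, T) × 𝕋)`. -/
structure IsTest (T : ℝ) (φ : ℝ → 𝕋 → ℝ) : Prop where
  smooth : ContDiff ℝ ∞ (fun q : ℝ × ℝ => φ q.1 (q.2 : 𝕋))
  support : ∃ T' < T, ∀ t > T', ∀ x, φ t x = 0

/-- The time derivative of a function on `ℝ × 𝕋`. -/
def dt (φ : ℝ → 𝕋 → ℝ) (t : ℝ) (x : 𝕋) : ℝ :=
  deriv (fun s => φ s x) t

/-- The second space derivative of a function on `ℝ × 𝕋`. -/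
def dxx (φ : ℝ → 𝕋 → ℝ) (t : ℝ) (x : 𝕋) : ℝ :=
  iteratedDeriv 2 (fun y : ℝ => φ t (x + (y : 𝕋))) 0

/-- The zeroth-order and nonlinear terms of the equation, as a function of `z = ζ(t)`,
`p = ∂ₓ ζ(t)` and `v = v(t)`:
`8π²N² (z - ∫ z) + 4πN (z - ∫ z) p - 2πN v - v p`. -/
def source (N : ℤ) (z p v : 𝕋 → ℝ) (x : 𝕋) : ℝ :=
  8 * Real.pi ^ 2 * (N : ℝ) ^ 2 * (z x - ∫ y, z y ∂μ𝕋)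
    + 4 * Real.pi * N * (z x - ∫ y, z y ∂μ𝕋) * p x
    - 2 * Real.pi * N * v x - v x * p x

/-- `ζ ∈ L⁴([0, T); H¹)` is a weak solution, with initial datum `ζ₀`, of
`∂ₜ ζ - 8π²N² (ζ - ∫ ζ) - ∂ₓ² ζ = 4πN (ζ - ∫ ζ) ∂ₓ ζ - 2πN v - v ∂ₓ ζ`,
where `∂ₓ v = -(∂ₓ ζ)² + ∫ (∂ₓ ζ)²` and `v(t, 0) = 0`. -/
def IsSolution (N : ℤ) (ζ₀ : 𝕋 → ℝ) (T : ℝ) (ζ : ℝ → 𝕋 → ℝ) : Prop :=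
  MemL4H1 T ζ ∧
  ∃ p v : ℝ → 𝕋 → ℝ,
    AEStronglyMeasurable (fun q : ℝ × 𝕋 => p q.1 q.2) (spaceTime T) ∧
    (∀ᵐ t ∂volume.restrict (Ioo 0 T), HasWeakDeriv (ζ t) (p t) ∧ IsVelocity (p t) (v t)) ∧
    ∀ φ : ℝ → 𝕋 → ℝ, IsTest T φ →
      (∫ t in Ioo 0 T, ∫ x, (ζ t x * (dt φ t x + dxx φ t x)
          + source N (ζ t) (p t) (v t) x * φ t x) ∂μ𝕋)
        + ∫ x, ζ₀ x * φ 0 x ∂μ𝕋 = 0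

/-- `ζ ∈ C^{0,1/4}([0, T); H⁻¹(𝕋))` with value `ζ₀` at time `0`: as an element of
`L¹((0, T); H⁻¹)`, `ζ` is represented by a curve of periodic distributions `a t` (given by their
Fourier coefficients) which is Hölder continuous in the `H⁻¹` norm and starts from `ζ₀`. -/
def HolderHNegOne (ζ₀ : 𝕋 → ℝ) (T : ℝ) (ζ : ℝ → 𝕋 → ℝ) : Prop :=
  ∃ a : ℝ → ℤ → ℂ,
    (∀ t ∈ Ico 0 T, hsNorm (-1) (a t) < ⊤) ∧
    (∃ C : ℝ≥0, ∀ s ∈ Ico 0 T, ∀ t ∈ Ico 0 T,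
      hsNorm (-1) (a t - a s) ≤ C * ENNReal.ofReal (|t - s| ^ (1 / 4 : ℝ))) ∧
    (∀ᵐ t ∂volume.restrict (Ioo 0 T), a t = coeff (ζ t)) ∧
    a 0 = coeff ζ₀

/-- `ζ ∈ C^∞((0, T) × 𝕋)`, up to modification on a null set. -/
def IsSmooth (T : ℝ) (ζ : ℝ → 𝕋 → ℝ) : Prop :=
  ∃ Z : ℝ → 𝕋 → ℝ,
    ContDiffOn ℝ ∞ (fun q : ℝ × ℝ => Z q.1 (q.2 : 𝕋)) (Ioo 0 T ×ˢ univ) ∧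
    ∀ᵐ q ∂spaceTime T, ζ q.1 q.2 = Z q.1 q.2

end LimitSystem

end

/-! The system is a semilinear heat equation `∂ₜ ζ = ∂ₓ² ζ + F(∂ₓ ζ)`: both `ζ - ∫ ζ` and `v` are
periodic primitives, of `∂ₓ ζ` and of `-(∂ₓ ζ)²`, so that the right-hand side is a sum of a linear, a
bilinear and a trilinear expression in `p = ∂ₓ ζ ∈ L²(𝕋)`, with values in `L²(𝕋)` and, when `N = 0`,
with only the trilinear one present. Everything is read off from the Fourier coefficients, where the
equation is Duhamel's formula in each mode, and `p` is a fixed point of `p ↦ ∂ₓ (e^{t∂ₓ²} ζ₀ + ∫ …)`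
(`CoeffSolution`).

*Existence and uniqueness.* Pairing the equation with `|∂ₓ| ζ` gives an energy inequality for
`E = ‖ζ‖²_{Ḣ^{1/2}}` with dissipation `D = ‖ζ‖²_{Ḣ^{3/2}}`. Since `‖∂ₓ ζ‖⁴ ≤ E D`, the linear flow maps
`H^{1/2}` data and `L^{4/3}(L²)` sources to `∂ₓ ζ ∈ L⁴(L²)`, with constants independent of the time
interval (`eLpNorm_flow_le`). The cubic nonlinearity maps `L⁴` to `L^{4/3}` by Hölder's inequality. A
contraction argument in `L⁴` gives local solutions, since the linear evolution of the data is small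
in `L⁴` on short intervals, and global ones for small data and `N = 0`
(`exists_coeffSolution_local`, `exists_coeffSolution_global`). The same estimates on short windows
give uniqueness (`CoeffSolution.unique`).

*Smoothness.* On a short window the linear equation with frozen coefficients, solved by iteration
with a weighted energy estimate, shows that `∂ₓ ζ` is bounded in `L²` at positive times
(`CoeffSolution.exists_window_bound`). Hence the Fourier coefficients of `F(∂ₓ ζ)` are bounded. Each
use of Duhamel's formula for `∂ₓ ζ` gains one power of `1 / |k|`, and the sequences summable against
`(1 + |k|)^r` form an algebra, so that all powers are reached (`CoeffSolution.exists_majorant`). The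
coefficients are then smooth in time, by the equation, and the Fourier series may be differentiated
term by term (`CoeffSolution.contDiffOn`).

*Weak solutions.* Testing with `ψ(t) cos(2πkx)` and `ψ(t) sin(2πkx)` shows that the coefficients of a
weak solution satisfy Duhamel's formula (`IsSolution.coeffSolution`). Hence uniqueness and smoothness
apply to it, and the time derivative lies in `L^{4/3}(H⁻¹)`, which gives the Hölder continuity.
Conversely, Parseval's identity at each time turns Duhamel's formula into the weak formulation
(`CoeffSolution.isSolution`); the function obtained is real because the equation commutes with complex
conjugation and has unique solutions (`CoeffSolution.refl_heat`). -/

noncomputable section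

namespace LimitSystem

local notation "𝕋" => UnitAddCircle
local notation "μ𝕋" => (AddCircle.haarAddCircle : Measure UnitAddCircle)

/-! ### Primitives of integrable functions and the scalar Duhamel formula -/

theorem intervalIntegrable_of_locallyIntegrable {E : Type*} [NormedAddCommGroup E] {f : ℝ → E}
    (hf : LocallyIntegrable f volume) (a b : ℝ) : IntervalIntegrable f volume a b :=
  (hf.integrableOn_isCompact isCompact_uIcc).intervalIntegrable

/-- Integration by parts for two primitives of integrable functions. -/
theorem integral_primitive_mul {𝕜 : Type*} [RCLike 𝕜] {f g : ℝ → 𝕜} {a b : ℝ} (hab : a ≤ b)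
    (F₀ G₀ : 𝕜)
    (hf : IntervalIntegrable f volume a b) (hg : IntervalIntegrable g volume a b) :
    ∫ t in a..b, (f t * (G₀ + ∫ s in a..t, g s) + (F₀ + ∫ s in a..t, f s) * g t) =
      (F₀ + ∫ s in a..b, f s) * (G₀ + ∫ s in a..b, g s) - F₀ * G₀ := by
  have hf' : IntegrableOn f (Ioc a b) := (intervalIntegrable_iff_integrableOn_Ioc_of_le hab).1 hf
  have hg' : IntegrableOn g (Ioc a b) := (intervalIntegrable_iff_integrableOn_Ioc_of_le hab).1 hg
  have hcf : ContinuousOn (fun t => ∫ s in a..t, f s) (uIcc a b) :=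
    intervalIntegral.continuousOn_primitive_interval (by simpa [uIcc_of_le hab, integrableOn_Icc_iff_integrableOn_Ioc] using hf')
  have hcg : ContinuousOn (fun t => ∫ s in a..t, g s) (uIcc a b) :=
    intervalIntegral.continuousOn_primitive_interval (by simpa [uIcc_of_le hab, integrableOn_Icc_iff_integrableOn_Ioc] using hg')
  have i1 : IntervalIntegrable (fun t => f t * ∫ s in a..t, g s) volume a b :=
    hf.mul_continuousOn hcg
  have i2 : IntervalIntegrable (fun t => (∫ s in a..t, f s) * g t) volume a b :=
    hg.continuousOn_mul hcf
  -- the two halves of the square, exchanged by Fubini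
  have key : (∫ t in a..b, f t * ∫ s in a..t, g s) + ∫ t in a..b, (∫ s in a..t, f s) * g t =
      (∫ s in a..b, f s) * ∫ s in a..b, g s := by
    set μ : Measure ℝ := volume.restrict (Ioc a b) with hμ
    have hfg : Integrable (fun z : ℝ × ℝ => f z.1 * g z.2) (μ.prod μ) := hf'.mul_prod hg'
    have hm : MeasurableSet {z : ℝ × ℝ | z.2 ≤ z.1} := measurableSet_le measurable_snd measurable_fst
    have e1 : ∫ t in a..b, f t * ∫ s in a..t, g s =
        ∫ z, ({z : ℝ × ℝ | z.2 ≤ z.1}.indicator (fun z => f z.1 * g z.2)) z ∂(μ.prod μ) := by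
      rw [integral_prod _ (hfg.indicator hm), intervalIntegral.integral_of_le hab]
      refine setIntegral_congr_fun measurableSet_Ioc fun t ht => ?_
      rw [intervalIntegral.integral_of_le ht.1.le, ← integral_const_mul, ← integral_indicator measurableSet_Ioc, hμ,
        ← integral_indicator measurableSet_Ioc]
      congr 1
      ext s
      simp only [indicator_apply, mem_Ioc, mem_ofPred_eq]
      have := ht.1; have := ht.2
      by_cases h1 : a < s <;> by_cases h2 : s ≤ t <;> by_cases h3 : s ≤ b <;> simp [h1, h2, h3]
      all_goals (exfalso; simp at *; linarith)
    have e2 : ∫ t in a..b, (∫ s in a..t, f s) * g t =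
        ∫ z, ({z : ℝ × ℝ | z.2 ≤ z.1}ᶜ.indicator (fun z => f z.1 * g z.2)) z ∂(μ.prod μ) := by
      rw [integral_prod_symm _ (hfg.indicator hm.compl), intervalIntegral.integral_of_le hab]
      refine setIntegral_congr_fun measurableSet_Ioc fun t ht => ?_
      rw [intervalIntegral.integral_of_le ht.1.le, ← integral_mul_const, integral_Ioc_eq_integral_Ioo,
        ← integral_indicator measurableSet_Ioo, hμ,
        ← integral_indicator measurableSet_Ioc]
      congr 1
      ext s
      simp only [indicator_apply, mem_Ioc, mem_Ioo, mem_compl_iff, mem_ofPred_eq, not_le]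
      have := ht.1; have := ht.2
      by_cases h1 : a < s <;> by_cases h2 : s < t <;> by_cases h3 : s ≤ b <;> simp [h1, h2, h3]
      all_goals (exfalso; simp at *; linarith)
    rw [e1, e2, ← integral_add (hfg.indicator hm) (hfg.indicator hm.compl)]
    simp only [indicator_self_add_compl_apply]
    rw [integral_prod_mul, intervalIntegral.integral_of_le hab, intervalIntegral.integral_of_le hab]
  have e : ∀ t, f t * (G₀ + ∫ s in a..t, g s) + (F₀ + ∫ s in a..t, f s) * g t =
      (f t * ∫ s in a..t, g s) + (∫ s in a..t, f s) * g t + (f t * G₀ + F₀ * g t) := fun t => by ring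
  simp_rw [e]
  rw [intervalIntegral.integral_add (i1.add i2) ((hf.mul_const _).add (hg.const_mul _)),
    intervalIntegral.integral_add i1 i2, key, intervalIntegral.integral_add (hf.mul_const _) (hg.const_mul _),
    intervalIntegral.integral_mul_const, intervalIntegral.integral_const_mul]
  ring

/-- The solution `e^{-lt} (c + ∫₀ᵗ e^{ls} f(s) ds)` of the scalar equation `u' = - l u + f`,
`u(0) = c`. -/
def duhamel (l : ℝ) (c : ℂ) (f : ℝ → ℂ) (t : ℝ) : ℂ :=
  (Real.exp (-(l * t)) : ℂ) * (c + ∫ s in (0 : ℝ)..t, (Real.exp (l * s) : ℂ) * f s)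

section duhamel

variable {l : ℝ} {c : ℂ} {f : ℝ → ℂ}

theorem intervalIntegrable_exp_mul (hf : LocallyIntegrable f volume) (l a b : ℝ) :
    IntervalIntegrable (fun s => (Real.exp (l * s) : ℂ) * f s) volume a b :=
  (intervalIntegrable_of_locallyIntegrable hf _ _).continuousOn_mul (by fun_prop)

@[simp] theorem duhamel_zero : duhamel l c f 0 = c := by simp [duhamel]

theorem continuous_duhamel (hf : LocallyIntegrable f volume) : Continuous (duhamel l c f) := by
  unfold duhamel
  have := intervalIntegral.continuous_primitive (intervalIntegrable_exp_mul hf l) 0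
  fun_prop

theorem duhamel_congr {g : ℝ → ℂ} {t : ℝ} (ht : 0 ≤ t)
    (h : ∀ᵐ s, s ∈ Ioc 0 t → f s = g s) : duhamel l c f t = duhamel l c g t := by
  unfold duhamel
  congr 2
  refine intervalIntegral.integral_congr_ae ?_
  filter_upwards [h] with s hs h's
  rw [hs (by rwa [uIoc_of_le ht] at h's)]

theorem duhamel_sub {c' : ℂ} {g : ℝ → ℂ} (hf : LocallyIntegrable f volume)
    (hg : LocallyIntegrable g volume) (t : ℝ) :
    duhamel l (c - c') (fun s => f s - g s) t = duhamel l c f t - duhamel l c' g t := by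
  unfold duhamel
  simp_rw [mul_sub (_ : ℂ) (f _)]
  rw [intervalIntegral.integral_sub (intervalIntegrable_exp_mul hf l 0 t)
    (intervalIntegrable_exp_mul hg l 0 t)]
  ring

/-- The Duhamel formula may be started at any intermediate time. -/
theorem duhamel_restart (hf : LocallyIntegrable f volume) (t₀ t : ℝ) :
    duhamel l c f t = (Real.exp (-(l * (t - t₀))) : ℂ) * duhamel l c f t₀ +
      ∫ s in t₀..t, (Real.exp (-(l * (t - s))) : ℂ) * f s := by
  have e1 : ∀ s, (Real.exp (-(l * (t - s))) : ℂ) * f s =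
      (Real.exp (-(l * t)) : ℂ) * ((Real.exp (l * s) : ℂ) * f s) := fun s => by
    rw [← mul_assoc, ← Complex.ofReal_mul, ← Real.exp_add]
    congr 3
    ring
  have e2 : (Real.exp (-(l * (t - t₀))) : ℂ) * (Real.exp (-(l * t₀)) : ℂ) =
      (Real.exp (-(l * t)) : ℂ) := by
    rw [← Complex.ofReal_mul, ← Real.exp_add]
    congr 2
    ring
  simp_rw [e1]
  rw [intervalIntegral.integral_const_mul]
  unfold duhamel
  rw [← mul_assoc, e2, ← mul_add, add_assoc, intervalIntegral.integral_add_adjacent_intervals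
    (intervalIntegrable_exp_mul hf l 0 t₀) (intervalIntegrable_exp_mul hf l t₀ t)]

/-- The Duhamel formula solves the integrated equation. -/
theorem duhamel_sub_eq_integral (hf : LocallyIntegrable f volume) {t₀ t : ℝ} (h : t₀ ≤ t) :
    duhamel l c f t - duhamel l c f t₀ = ∫ s in t₀..t, (-(l : ℂ) * duhamel l c f s + f s) := by
  -- the product of the primitives `e^{-l(t - t₀)}` and `u(t₀) + ∫ e^{l(s - t₀)} f(s) ds`
  have hexp : ∀ t, (1 : ℂ) + ∫ s in t₀..t, (-(l : ℂ) * (Real.exp (-(l * (s - t₀))) : ℂ)) =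
      (Real.exp (-(l * (t - t₀))) : ℂ) := fun t => by
    have : ∀ s ∈ uIcc t₀ t, HasDerivAt (fun s : ℝ => (Real.exp (-(l * (s - t₀))) : ℂ))
        (-(l : ℂ) * (Real.exp (-(l * (s - t₀))) : ℂ)) s := fun s _ => by
      have h1 : HasDerivAt (fun s : ℝ => Real.exp (-(l * (s - t₀))))
          (Real.exp (-(l * (s - t₀))) * (-(l * 1))) s :=
        ((((hasDerivAt_id s).sub_const t₀).const_mul l).neg).exp
      convert! h1.ofReal_comp using 1
      push_cast
      ring
    rw [intervalIntegral.integral_eq_sub_of_hasDerivAt this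
      (Continuous.intervalIntegrable (by fun_prop) _ _)]
    simp
  have hg : IntervalIntegrable (fun s => (Real.exp (l * (s - t₀)) : ℂ) * f s) volume t₀ t :=
    (intervalIntegrable_of_locallyIntegrable hf _ _).continuousOn_mul (by fun_prop)
  have hS : ∀ s, (Real.exp (-(l * (s - t₀))) : ℂ) *
      (duhamel l c f t₀ + ∫ r in t₀..s, (Real.exp (l * (r - t₀)) : ℂ) * f r) = duhamel l c f s := by
    intro s
    rw [duhamel_restart hf t₀ s, mul_add, ← intervalIntegral.integral_const_mul]
    congr 2
    ext r
    rw [← mul_assoc, ← Complex.ofReal_mul, ← Real.exp_add]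
    congr 3
    ring
  have key := integral_primitive_mul h 1 (duhamel l c f t₀)
    (f := fun s => -(l : ℂ) * (Real.exp (-(l * (s - t₀))) : ℂ))
    (g := fun s => (Real.exp (l * (s - t₀)) : ℂ) * f s)
    (Continuous.intervalIntegrable (by fun_prop) _ _) hg
  simp_rw [hexp] at key
  rw [hS, one_mul] at key
  rw [← key]
  refine intervalIntegral.integral_congr fun s _ => ?_
  rw [mul_assoc, hS, ← mul_assoc, ← Complex.ofReal_mul, ← Real.exp_add]
  simp

theorem intervalIntegrable_duhamel_rhs (hf : LocallyIntegrable f volume) (a b : ℝ) :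
    IntervalIntegrable (fun s => -(l : ℂ) * duhamel l c f s + f s) volume a b :=
  ((continuous_duhamel hf).intervalIntegrable _ _ |>.const_mul _).add
    (intervalIntegrable_of_locallyIntegrable hf _ _)

/-- The product of a Duhamel solution with a `C¹` function. -/
theorem duhamel_mul_sub (hf : LocallyIntegrable f volume) {g g' : ℝ → ℂ} {t₀ t : ℝ} (h : t₀ ≤ t)
    (hg : ∀ s, HasDerivAt g (g' s) s) (hg' : Continuous g') :
    duhamel l c f t * g t - duhamel l c f t₀ * g t₀ =
      ∫ s in t₀..t, ((-(l : ℂ) * duhamel l c f s + f s) * g s + duhamel l c f s * g' s) := by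
  have e1 : ∀ s, g t₀ + ∫ r in t₀..s, g' r = g s := fun s => by
    rw [intervalIntegral.integral_eq_sub_of_hasDerivAt (fun r _ => hg r)
      (hg'.intervalIntegrable _ _)]
    ring
  have e2 : ∀ s, t₀ ≤ s → duhamel l c f t₀ + ∫ r in t₀..s, (-(l : ℂ) * duhamel l c f r + f r) =
      duhamel l c f s := fun s hs => by
    rw [← duhamel_sub_eq_integral hf hs]
    ring
  have key := integral_primitive_mul h (duhamel l c f t₀) (g t₀)
    (intervalIntegrable_duhamel_rhs (l := l) (c := c) hf t₀ t) (hg'.intervalIntegrable t₀ t)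
  rw [e1, e2 t h] at key
  rw [← key]
  refine intervalIntegral.integral_congr fun s hs => ?_
  rw [uIcc_of_le h] at hs
  rw [e1, e2 s hs.1]

/-- The energy identity for the scalar equation. -/
theorem duhamel_energy (hf : LocallyIntegrable f volume) {t₀ t : ℝ} (h : t₀ ≤ t) :
    ‖duhamel l c f t‖ ^ 2 + 2 * l * ∫ s in t₀..t, ‖duhamel l c f s‖ ^ 2 =
      ‖duhamel l c f t₀‖ ^ 2 +
        2 * ∫ s in t₀..t, (f s * (starRingEnd ℂ) (duhamel l c f s)).re := by
  set u := duhamel l c f with hu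
  have hcu : Continuous u := continuous_duhamel hf
  have i1 := intervalIntegrable_duhamel_rhs (l := l) (c := c) hf t₀ t
  rw [← hu] at i1
  have i2 : IntervalIntegrable (fun s => (starRingEnd ℂ) (-(l : ℂ) * u s + f s)) volume t₀ t := by
    rw [intervalIntegrable_iff] at i1 ⊢
    exact (Complex.conjCLE.toContinuousLinearMap).integrable_comp i1
  have e2 : ∀ s, t₀ ≤ s → u t₀ + ∫ r in t₀..s, (-(l : ℂ) * u r + f r) = u s := fun s hs => by
    rw [hu, ← duhamel_sub_eq_integral hf hs]
    ring
  have e3 : ∀ s, t₀ ≤ s → (starRingEnd ℂ) (u t₀) +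
      ∫ r in t₀..s, (starRingEnd ℂ) (-(l : ℂ) * u r + f r) = (starRingEnd ℂ) (u s) :=
    fun s hs => by
      rw [← e2 s hs, map_add]
      congr 1
      simp only [intervalIntegral, integral_conj, map_sub]
  have key := integral_primitive_mul h (u t₀) ((starRingEnd ℂ) (u t₀)) i1 i2
  rw [e2 t h, e3 t h] at key
  have i3 : IntervalIntegrable (fun s => (f s * (starRingEnd ℂ) (u s))) volume t₀ t :=
    (intervalIntegrable_of_locallyIntegrable hf _ _).mul_continuousOn (Complex.continuous_conj.comp hcu).continuousOn
  have i4 : IntervalIntegrable (fun s => (f s * (starRingEnd ℂ) (u s)).re) volume t₀ t := by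
    rw [intervalIntegrable_iff] at i3 ⊢
    exact i3.re
  have key2 : (∫ t in t₀..t, ((-(2 * l) * ‖u t‖ ^ 2 +
      2 * (f t * (starRingEnd ℂ) (u t)).re : ℝ) : ℂ)) =
      u t * (starRingEnd ℂ) (u t) - u t₀ * (starRingEnd ℂ) (u t₀) := by
    rw [← key]
    refine intervalIntegral.integral_congr fun s hs => ?_
    rw [uIcc_of_le h] at hs
    rw [e2 s hs.1, e3 s hs.1]
    have h1 := Complex.mul_conj (u s)
    have h2 := Complex.add_conj (f s * (starRingEnd ℂ) (u s))
    simp only [map_mul, Complex.conj_conj] at h2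
    rw [Complex.normSq_eq_norm_sq] at h1
    push_cast at h1 h2 ⊢
    simp only [map_add, map_mul, map_neg, Complex.conj_ofReal]
    linear_combination (-2 * (l : ℂ)) * (-h1) - h2
  rw [intervalIntegral.integral_ofReal, Complex.mul_conj, Complex.mul_conj, ← Complex.ofReal_sub,
    Complex.ofReal_inj, Complex.normSq_eq_norm_sq, Complex.normSq_eq_norm_sq,
    intervalIntegral.integral_add ((Continuous.intervalIntegrable (by fun_prop) _ _))
      (i4.const_mul 2),
    intervalIntegral.integral_const_mul, intervalIntegral.integral_const_mul] at key2
  linarith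

end duhamel

/-! ### Square summable sequences -/

/-- The space `ℓ²(ℤ; ℂ)` of the Fourier coefficients of square integrable functions. -/
abbrev Ell2 : Type := lp (fun _ : ℤ => ℂ) 2

/-- The sequence `a` as an element of `ℓ²`, and `0` when `a` is not square summable. -/
def toEll (a : ℤ → ℂ) : Ell2 :=
  open Classical in if h : Memℓp a 2 then ⟨a, h⟩ else 0

theorem toEll_apply {a : ℤ → ℂ} (h : Memℓp a 2) (k : ℤ) : toEll a k = a k := by
  simp [toEll, h]

theorem coe_toEll {a : ℤ → ℂ} (h : Memℓp a 2) : ⇑(toEll a) = a := by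
  simp [toEll, h]

@[simp] theorem toEll_coe (a : Ell2) : toEll a = a := by
  ext k
  rw [toEll_apply (lp.memℓp a)]

theorem hasSum_norm_sq (a : Ell2) : HasSum (fun k => ‖a k‖ ^ 2) (‖a‖ ^ 2) := by
  have := lp.hasSum_norm (p := 2) (by simp) a
  simpa using this

theorem sum_norm_sq_le (a : Ell2) (s : Finset ℤ) : ∑ k ∈ s, ‖a k‖ ^ 2 ≤ ‖a‖ ^ 2 :=
  sum_le_hasSum s (fun _ _ => by positivity) (hasSum_norm_sq a)

theorem tsum_enorm_sq (a : Ell2) : ∑' k, ‖a k‖ₑ ^ 2 = ‖a‖ₑ ^ 2 := by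
  have := hasSum_norm_sq a
  have h := ENNReal.ofReal_tsum_of_nonneg (fun k => by positivity) this.summable
  rw [this.tsum_eq] at h
  simpa [ENNReal.ofReal_pow, ofReal_norm] using h.symm

theorem memℓp_two_iff {a : ℤ → ℂ} : Memℓp a 2 ↔ ∑' k, ‖a k‖ₑ ^ 2 < ⊤ := by
  rw [memℓp_gen_iff (by simp)]
  have : ∀ k, ‖a k‖ₑ ^ 2 = ((‖a k‖₊ ^ 2 : ℝ≥0) : ℝ≥0∞) := fun k => by
    rw [ENNReal.coe_pow]; rfl
  simp_rw [this, lt_top_iff_ne_top, ENNReal.tsum_coe_ne_top_iff_summable]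
  rw [← NNReal.summable_coe]
  simp

theorem enorm_toEll_sq_le (a : ℤ → ℂ) : ‖toEll a‖ₑ ^ 2 ≤ ∑' k, ‖a k‖ₑ ^ 2 := by
  by_cases h : Memℓp a 2
  · rw [← tsum_enorm_sq, coe_toEll h]
  · simp [toEll, h]

theorem aestronglyMeasurable_ell2 {α : Type*} [MeasurableSpace α] {μ : Measure α} {u : α → Ell2}
    (h : ∀ k, AEStronglyMeasurable (fun t => u t k) μ) : AEStronglyMeasurable u μ := by
  have hlim : ∀ t, Filter.Tendsto (fun n : ℕ => ∑ k ∈ Finset.Icc (-(n : ℤ)) n,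
      lp.single 2 k (u t k)) Filter.atTop (nhds (u t)) := fun t =>
    (lp.hasSum_single (by simp) (u t)).comp Finset.tendsto_Icc_neg
  refine aestronglyMeasurable_of_tendsto_ae (u := Filter.atTop) (fun n => ?_) (ae_of_all _ hlim)
  refine Finset.aestronglyMeasurable_fun_sum _ fun k _ => ?_
  exact (lp.isometry_single (E := fun _ : ℤ => ℂ) (p := 2) k).continuous.comp_aestronglyMeasurable (h k)

theorem aestronglyMeasurable_toEll {α : Type*} [MeasurableSpace α] {μ : Measure α} {a : α → ℤ → ℂ}
    (h : ∀ k, AEStronglyMeasurable (fun t => a t k) μ) (ha : ∀ᵐ t ∂μ, Memℓp (a t) 2) :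
    AEStronglyMeasurable (fun t => toEll (a t)) μ := by
  refine aestronglyMeasurable_ell2 fun k => (h k).congr ?_
  filter_upwards [ha] with t ht
  rw [toEll_apply ht]

theorem aestronglyMeasurable_coord {α : Type*} [MeasurableSpace α] {μ : Measure α} {f : α → Ell2}
    (hf : AEStronglyMeasurable f μ) (k : ℤ) : AEStronglyMeasurable (fun t => f t k) μ :=
  (lp.evalCLM ℂ (fun _ : ℤ => ℂ) 2 k).continuous.comp_aestronglyMeasurable hf

theorem norm_coord_le (a : Ell2) (k : ℤ) : ‖a k‖ ≤ ‖a‖ := lp.norm_apply_le_norm (by simp) a k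

theorem locallyIntegrable_coord {f : ℝ → Ell2} (hf : LocallyIntegrable f volume) (k : ℤ) :
    LocallyIntegrable (fun t => f t k) volume :=
  hf.mono (aestronglyMeasurable_coord hf.aestronglyMeasurable k)
    (ae_of_all _ fun t => norm_coord_le (f t) k)

/-! ### The heat flow with a source, mode by mode -/

/-- The frequency `2π|k|`. -/
def freq (k : ℤ) : ℝ := 2 * Real.pi * |(k : ℝ)|

theorem freq_nonneg (k : ℤ) : 0 ≤ freq k := by unfold freq; positivity

/-- The Fourier coefficients of `∂ₓ u`, where `a` are those of `u`. -/
def grad (a : ℤ → ℂ) (k : ℤ) : ℂ := 2 * Real.pi * Complex.I * k * a k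

theorem norm_grad (a : ℤ → ℂ) (k : ℤ) : ‖grad a k‖ = freq k * ‖a k‖ := by
  simp [grad, freq, abs_of_pos Real.pi_pos]

/-- The Fourier coefficients at time `t` of the solution of `∂ₜ u = ∂ₓ² u + f` with initial
coefficients `c`; the Fourier coefficients of `f(s)` are `f s`. -/
def heat (c : ℤ → ℂ) (f : ℝ → Ell2) (t : ℝ) (k : ℤ) : ℂ :=
  duhamel (freq k ^ 2) (c k) (fun s => f s k) t

/-- The space derivative of `heat c f t` as an element of `ℓ²`. -/
def flow (c : ℤ → ℂ) (f : ℝ → Ell2) (t : ℝ) : Ell2 := toEll (grad (heat c f t))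

theorem continuous_heat {c : ℤ → ℂ} {f : ℝ → Ell2} (hf : LocallyIntegrable f volume) (k : ℤ) :
    Continuous (fun t => heat c f t k) :=
  continuous_duhamel (locallyIntegrable_coord hf k)

theorem heat_congr {c : ℤ → ℂ} {f g : ℝ → Ell2} {t : ℝ} (ht : 0 ≤ t)
    (h : ∀ᵐ s, s ∈ Ioc 0 t → f s = g s) : heat c f t = heat c g t := by
  funext k
  refine duhamel_congr ht ?_
  filter_upwards [h] with s hs h's
  rw [hs h's]

theorem heat_sub {c c' : ℤ → ℂ} {f g : ℝ → Ell2} (hf : LocallyIntegrable f volume)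
    (hg : LocallyIntegrable g volume) (t : ℝ) :
    heat (c - c') (f - g) t = heat c f t - heat c' g t := by
  funext k
  exact duhamel_sub (locallyIntegrable_coord hf k) (locallyIntegrable_coord hg k) t

theorem grad_sub (a b : ℤ → ℂ) : grad (a - b) = grad a - grad b := by
  funext k
  simp [grad, mul_sub]

theorem flow_sub {c c' : ℤ → ℂ} {f g : ℝ → Ell2} (hf : LocallyIntegrable f volume)
    (hg : LocallyIntegrable g volume) {t : ℝ} (h : Memℓp (grad (heat c f t)) 2)
    (h' : Memℓp (grad (heat c' g t)) 2) :
    flow (c - c') (f - g) t = flow c f t - flow c' g t := by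
  unfold flow
  rw [heat_sub hf hg, grad_sub]
  ext k
  rw [toEll_apply (h.sub h')]
  simp [toEll_apply h, toEll_apply h']

/-- The Cauchy-Schwarz inequality for finitely many modes. -/
theorem abs_sum_mul_conj_le (s : Finset ℤ) (w : ℤ → ℝ) (a : Ell2) (b : ℤ → ℂ) :
    |∑ k ∈ s, w k * (a k * (starRingEnd ℂ) (b k)).re| ≤
      ‖a‖ * √(∑ k ∈ s, w k ^ 2 * ‖b k‖ ^ 2) := by
  calc |∑ k ∈ s, w k * (a k * (starRingEnd ℂ) (b k)).re|
      ≤ ∑ k ∈ s, ‖a k‖ * (|w k| * ‖b k‖) := by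
        refine (Finset.abs_sum_le_sum_abs _ _).trans (Finset.sum_le_sum fun k _ => ?_)
        rw [abs_mul]
        have := Complex.abs_re_le_norm (a k * (starRingEnd ℂ) (b k))
        rw [norm_mul, RCLike.norm_conj] at this
        nlinarith [abs_nonneg (w k)]
    _ ≤ √(∑ k ∈ s, ‖a k‖ ^ 2) * √(∑ k ∈ s, (|w k| * ‖b k‖) ^ 2) :=
        Real.sum_mul_le_sqrt_mul_sqrt _ _ _
    _ ≤ ‖a‖ * √(∑ k ∈ s, w k ^ 2 * ‖b k‖ ^ 2) := by
        simp_rw [mul_pow, sq_abs]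
        gcongr
        exact Real.sqrt_le_iff.2 ⟨norm_nonneg _, sum_norm_sq_le a s⟩

/-! ### Energy estimates for the heat flow -/

theorem one_le_four_thirds : (1 : ℝ≥0∞) ≤ 4 / 3 := by
  rw [ENNReal.le_div_iff_mul_le (by simp) (by simp)]; norm_num

section energy

variable {c : ℤ → ℂ} {f : ℝ → Ell2}

/-- Hölder's inequality in time with the exponents `4/3` and `4`. -/
theorem integral_norm_mul_le {m : ℝ → ℝ} (hm : Continuous m) (hm0 : ∀ s, 0 ≤ m s)
    (hf : MemLp f (4 / 3) volume) {t : ℝ} (ht : 0 ≤ t) :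
    ∫ s in (0 : ℝ)..t, ‖f s‖ * m s ≤
      (eLpNorm f (4 / 3) volume).toReal * (∫ s in (0 : ℝ)..t, m s ^ 4) ^ (1 / 4 : ℝ) := by
  have h43 : ENNReal.ofReal (4 / 3) = 4 / 3 := by
    rw [ENNReal.ofReal_div_of_pos (by norm_num)]; simp
  have h4 : ENNReal.ofReal 4 = 4 := by simp
  have hpq : (4 / 3 : ℝ).HolderConjugate 4 := by
    rw [Real.holderConjugate_iff]; norm_num
  set μ : Measure ℝ := volume.restrict (Ioc 0 t) with hμ
  have hmL : MemLp m (ENNReal.ofReal 4) μ := by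
    have hb : ∃ C, ∀ s ∈ Ioc 0 t, ‖m s‖ ≤ C := by
      obtain ⟨C, hC⟩ := isCompact_Icc.exists_bound_of_continuousOn (f := m) hm.continuousOn (s := Icc 0 t)
      exact ⟨C, fun s hs => hC s (Ioc_subset_Icc_self hs)⟩
    obtain ⟨C, hC⟩ := hb
    exact MemLp.of_bound hm.aestronglyMeasurable C
      ((ae_restrict_iff' measurableSet_Ioc).2 (ae_of_all _ hC))
  have h1 := integral_mul_norm_le_Lp_mul_Lq hpq (μ := μ) (f := fun s => ‖f s‖) (g := m)
    (by rw [h43]; exact (hf.mono_measure Measure.restrict_le_self).norm) hmL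
  have h2 : (∫ s, ‖‖f s‖‖ ^ (4 / 3 : ℝ) ∂μ) ^ (1 / (4 / 3) : ℝ) ≤
      (eLpNorm f (4 / 3) volume).toReal := by
    have h3 := (hf.mono_measure (Measure.restrict_le_self (s := Ioc 0 t))).eLpNorm_eq_integral_rpow_norm
      (by simp) (by simp [ENNReal.div_eq_top])
    have h4 : (4 / 3 : ℝ≥0∞).toReal = 4 / 3 := by simp
    have h5 : (eLpNorm f (4 / 3) μ).toReal ≤ (eLpNorm f (4 / 3) volume).toReal :=
      ENNReal.toReal_mono hf.2.ne (eLpNorm_mono_measure f Measure.restrict_le_self)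
    rw [hμ, h3, h4, ENNReal.toReal_ofReal (by positivity)] at h5
    simpa [hμ] using h5
  rw [intervalIntegral.integral_of_le ht, intervalIntegral.integral_of_le ht]
  have h6 : ∀ s, ‖m s‖ = m s := fun s => Real.norm_of_nonneg (hm0 s)
  have h7 : ∀ s, m s ^ (4 : ℝ) = m s ^ 4 := fun s => by
    rw [← Real.rpow_natCast]; norm_num
  simp only [h6, h7, norm_norm] at h1 h2
  refine h1.trans (mul_le_mul_of_nonneg_right h2 (by positivity))

theorem continuous_sum_heat (hf : LocallyIntegrable f volume) (s : Finset ℤ) (w : ℤ → ℝ) :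
    Continuous fun t => ∑ k ∈ s, w k * ‖heat c f t k‖ ^ 2 :=
  continuous_finsetSum _ fun k _ => continuous_const.mul ((continuous_heat hf k).norm.pow 2)

/-- The `H^{1/2}` energy inequality for finitely many modes. -/
theorem heat_energy_le (hf : LocallyIntegrable f volume) (s : Finset ℤ) {t : ℝ} (ht : 0 ≤ t) :
    (∑ k ∈ s, freq k * ‖heat c f t k‖ ^ 2) +
        2 * ∫ τ in (0 : ℝ)..t, ∑ k ∈ s, freq k ^ 3 * ‖heat c f τ k‖ ^ 2 ≤
      (∑ k ∈ s, freq k * ‖c k‖ ^ 2) +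
        2 * ∫ τ in (0 : ℝ)..t, ‖f τ‖ * √(∑ k ∈ s, freq k ^ 2 * ‖heat c f τ k‖ ^ 2) := by
  have hfi := fun k => (locallyIntegrable_coord hf k)
  have i0 : ∀ k, IntervalIntegrable
      (fun τ => freq k * (f τ k * (starRingEnd ℂ) (heat c f τ k)).re) volume 0 t := fun k => by
    have : IntervalIntegrable (fun τ => f τ k * (starRingEnd ℂ) (heat c f τ k)) volume 0 t :=
      (intervalIntegrable_of_locallyIntegrable (hfi k) _ _).mul_continuousOn
        (Complex.continuous_conj.comp (continuous_heat hf k)).continuousOn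
    refine IntervalIntegrable.const_mul ?_ _
    rw [intervalIntegrable_iff] at this ⊢
    exact this.re
  have i1 : ∀ k, IntervalIntegrable
      (fun τ => freq k ^ 3 * ‖heat c f τ k‖ ^ 2) volume 0 t := fun k =>
    (continuous_const.mul ((continuous_heat hf k).norm.pow 2)).intervalIntegrable _ _
  have h1 : ∀ k ∈ s, freq k * ‖heat c f t k‖ ^ 2 +
      2 * ∫ τ in (0 : ℝ)..t, freq k ^ 3 * ‖heat c f τ k‖ ^ 2 = freq k * ‖c k‖ ^ 2 +
        2 * ∫ τ in (0 : ℝ)..t, freq k * (f τ k * (starRingEnd ℂ) (heat c f τ k)).re := by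
    intro k _
    have := duhamel_energy (l := freq k ^ 2) (c := c k) (hfi k) ht
    rw [duhamel_zero] at this
    rw [intervalIntegral.integral_const_mul, intervalIntegral.integral_const_mul]
    simp only [heat]
    linear_combination freq k * this
  have h2 := Finset.sum_congr rfl h1
  rw [Finset.sum_add_distrib, Finset.sum_add_distrib, ← Finset.mul_sum, ← Finset.mul_sum,
    ← intervalIntegral.integral_finsetSum fun k _ => i1 k,
    ← intervalIntegral.integral_finsetSum fun k _ => i0 k] at h2
  rw [h2]
  have h3 : IntervalIntegrable
      (fun τ => ‖f τ‖ * √(∑ k ∈ s, freq k ^ 2 * ‖heat c f τ k‖ ^ 2)) volume 0 t :=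
    (intervalIntegrable_of_locallyIntegrable hf _ _).norm.mul_continuousOn
      (continuous_sum_heat hf s _).sqrt.continuousOn
  have h4 := intervalIntegral.integral_mono_on ht
    (IntervalIntegrable.sum s (fun k _ => i0 k)) h3 (fun τ _ => by
      rw [Finset.sum_apply]
      exact (le_abs_self _).trans (abs_sum_mul_conj_le s freq (f τ) (heat c f τ)))
  simp only [Finset.sum_apply] at h4
  linarith

theorem le_of_pow_four_le {x e r : ℝ} (hx : 0 ≤ x) (he : 0 ≤ e) (hr : 0 ≤ r)
    (h : x ^ 4 ≤ (e + 2 * r * x) ^ 2) : x ≤ √e + 2 * r := by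
  have h1 : x ^ 2 ≤ e + 2 * r * x := by
    have : (x ^ 2) ^ 2 ≤ (e + 2 * r * x) ^ 2 := by rwa [← pow_mul]
    exact (pow_le_pow_iff_left₀ (by positivity) (by positivity) two_ne_zero).1 this
  have h2 := Real.sq_sqrt he
  have h3 := Real.sqrt_nonneg e
  by_contra! h4
  nlinarith

/-- The `L⁴` estimate for the gradient of the heat flow, for finitely many modes: with
`E = ∑ |k| |u|²` and `D = ∑ |k|³ |u|²` one has `(∑ |k|² |u|²)² ≤ E D`. -/
theorem integral_heat_pow_four_le (hf : MemLp f (4 / 3) volume) {e : ℝ} (s : Finset ℤ)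
    (he : ∑ k ∈ s, freq k * ‖c k‖ ^ 2 ≤ e) {t : ℝ} (ht : 0 ≤ t) :
    ∫ τ in (0 : ℝ)..t, (∑ k ∈ s, freq k ^ 2 * ‖heat c f τ k‖ ^ 2) ^ 2 ≤
      (√e + 2 * (eLpNorm f (4 / 3) volume).toReal) ^ 4 := by
  have hl : LocallyIntegrable f volume := hf.locallyIntegrable one_le_four_thirds
  set Φ := (eLpNorm f (4 / 3) volume).toReal with hΦ
  have hΦ0 : 0 ≤ Φ := ENNReal.toReal_nonneg
  have he0 : 0 ≤ e := le_trans (Finset.sum_nonneg fun k _ =>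
    mul_nonneg (freq_nonneg k) (by positivity)) he
  set M : ℝ → ℝ := fun τ => ∑ k ∈ s, freq k ^ 2 * ‖heat c f τ k‖ ^ 2 with hM
  set E : ℝ → ℝ := fun τ => ∑ k ∈ s, freq k * ‖heat c f τ k‖ ^ 2 with hE
  set D : ℝ → ℝ := fun τ => ∑ k ∈ s, freq k ^ 3 * ‖heat c f τ k‖ ^ 2 with hD
  have cM : Continuous M := continuous_sum_heat hl s _
  have cD : Continuous D := continuous_sum_heat hl s _
  have hM0 : ∀ τ, 0 ≤ M τ := fun τ => Finset.sum_nonneg fun k _ => by positivity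
  have hE0 : ∀ τ, 0 ≤ E τ := fun τ => Finset.sum_nonneg fun k _ =>
    mul_nonneg (freq_nonneg k) (by positivity)
  have hD0 : ∀ τ, 0 ≤ D τ := fun τ => Finset.sum_nonneg fun k _ =>
    mul_nonneg (pow_nonneg (freq_nonneg k) 3) (by positivity)
  set x : ℝ := (∫ τ in (0 : ℝ)..t, M τ ^ 2) ^ (1 / 4 : ℝ) with hx
  have hI0 : 0 ≤ ∫ τ in (0 : ℝ)..t, M τ ^ 2 :=
    intervalIntegral.integral_nonneg ht fun τ _ => by positivity
  have hx0 : 0 ≤ x := by positivity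
  have hx4 : x ^ 4 = ∫ τ in (0 : ℝ)..t, M τ ^ 2 := by
    rw [hx, ← Real.rpow_natCast, ← Real.rpow_mul hI0]
    norm_num
  -- the energy inequality and Hölder's inequality bound `E` and `∫ D` in terms of the norm `x`
  -- that is to be estimated
  have hH : ∀ τ ∈ Icc 0 t, E τ + 2 * ∫ r in (0 : ℝ)..τ, D r ≤ e + 2 * Φ * x := by
    intro τ hτ
    have h1 := heat_energy_le (c := c) hl s hτ.1
    have h2 := integral_norm_mul_le (f := f) (m := fun τ => √(M τ)) cM.sqrt
      (fun _ => Real.sqrt_nonneg _) hf ht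
    have h3 : ∀ r, √(M r) ^ 4 = M r ^ 2 := fun r => by
      rw [show (4 : ℕ) = 2 * 2 from rfl, pow_mul, Real.sq_sqrt (hM0 r)]
    simp only [h3] at h2
    have h4 : ∫ r in (0 : ℝ)..τ, ‖f r‖ * √(M r) ≤ ∫ r in (0 : ℝ)..t, ‖f r‖ * √(M r) :=
      intervalIntegral.integral_mono_interval le_rfl hτ.1 hτ.2
        (ae_of_all _ fun r => by positivity)
        ((intervalIntegrable_of_locallyIntegrable hl _ _).norm.mul_continuousOn
        cM.sqrt.continuousOn)
    have : E τ + 2 * ∫ r in (0 : ℝ)..τ, D r ≤ (∑ k ∈ s, freq k * ‖c k‖ ^ 2) +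
        2 * ∫ r in (0 : ℝ)..τ, ‖f r‖ * √(M r) := h1
    have h5 : ∫ r in (0 : ℝ)..t, ‖f r‖ * √(M r) ≤ Φ * x := h2
    linarith
  have hMED : ∀ τ, M τ ^ 2 ≤ E τ * D τ := fun τ => by
    have := Finset.sum_sq_le_sum_mul_sum_of_sq_le_mul s
      (r := fun k => freq k ^ 2 * ‖heat c f τ k‖ ^ 2)
      (f := fun k => freq k * ‖heat c f τ k‖ ^ 2)
      (g := fun k => freq k ^ 3 * ‖heat c f τ k‖ ^ 2)
      (fun k _ => mul_nonneg (freq_nonneg k) (by positivity))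
      (fun k _ => mul_nonneg (pow_nonneg (freq_nonneg k) 3) (by positivity))
      (fun k _ => le_of_eq (by ring))
    exact this
  have hint : ∫ τ in (0 : ℝ)..t, M τ ^ 2 ≤ (e + 2 * Φ * x) * ∫ τ in (0 : ℝ)..t, D τ := by
    rw [← intervalIntegral.integral_const_mul]
    refine intervalIntegral.integral_mono_on ht ((cM.pow 2).intervalIntegrable _ _)
      ((continuous_const.mul cD).intervalIntegrable _ _) fun τ hτ => (hMED τ).trans ?_
    refine mul_le_mul_of_nonneg_right ?_ (hD0 τ)
    have : 0 ≤ ∫ r in (0 : ℝ)..τ, D r := intervalIntegral.integral_nonneg hτ.1 fun r _ => hD0 r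
    linarith [hH τ hτ]
  have hDt : ∫ τ in (0 : ℝ)..t, D τ ≤ e + 2 * Φ * x := by
    have h0 : 0 ≤ ∫ r in (0 : ℝ)..t, D r := intervalIntegral.integral_nonneg ht fun r _ => hD0 r
    linarith [hH t ⟨ht, le_rfl⟩, hE0 t]
  -- `x² ≤ e + 2 Φ x`, which bounds `x`
  have hfin : x ^ 4 ≤ (e + 2 * Φ * x) ^ 2 := by
    rw [hx4, sq]
    exact hint.trans (mul_le_mul_of_nonneg_left hDt (by positivity))
  rw [← hx4]
  exact pow_le_pow_left₀ hx0 (le_of_pow_four_le hx0 he0 hΦ0 hfin) 4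

/-- The `L⁴` estimate for the gradient of the heat flow, from the estimate for finitely many modes and
Fatou's lemma. The bound does not depend on the length of the time interval. -/
theorem lintegral_heat_pow_four_le (hf : MemLp f (4 / 3) volume)
    (hc : Summable fun k => freq k * ‖c k‖ ^ 2) :
    ∫⁻ τ in Ioi 0, (∑' k, ‖grad (heat c f τ) k‖ₑ ^ 2) ^ 2 ≤
      ENNReal.ofReal ((√(∑' k, freq k * ‖c k‖ ^ 2) +
        2 * (eLpNorm f (4 / 3) volume).toReal) ^ 4) := by
  have hl : LocallyIntegrable f volume := hf.locallyIntegrable one_le_four_thirds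
  -- exhaust the time axis by `(0, n]` and the modes by `|k| ≤ n`
  set S : ℕ → Finset ℤ := fun n => Finset.Icc (-(n : ℤ)) n with hS
  set G : ℕ → ℝ → ℝ≥0∞ := fun n => (Ioc (0 : ℝ) n).indicator fun τ =>
    (∑ k ∈ S n, ‖grad (heat c f τ) k‖ₑ ^ 2) ^ 2 with hG
  have hmode : ∀ k, Measurable fun τ => ‖grad (heat c f τ) k‖ₑ ^ 2 := fun k =>
    ((continuous_const.mul (continuous_heat hl k)).enorm.measurable.pow_const 2)
  have hlim : ∀ τ ∈ Ioi (0 : ℝ), Filter.Tendsto (fun n => G n τ) Filter.atTop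
      (nhds ((∑' k, ‖grad (heat c f τ) k‖ₑ ^ 2) ^ 2)) := by
    intro τ hτ
    have h1 : Filter.Tendsto (fun n => (∑ k ∈ S n, ‖grad (heat c f τ) k‖ₑ ^ 2) ^ 2) Filter.atTop
        (nhds ((∑' k, ‖grad (heat c f τ) k‖ₑ ^ 2) ^ 2)) :=
      ((ENNReal.continuous_pow 2).tendsto _).comp
        (ENNReal.summable.hasSum.comp Finset.tendsto_Icc_neg)
    refine h1.congr' ?_
    filter_upwards [Filter.eventually_ge_atTop ⌈τ⌉₊] with n hn
    simp only [hG]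
    rw [indicator_of_mem]
    exact ⟨hτ, (Nat.le_ceil τ).trans (by exact_mod_cast hn)⟩
  calc ∫⁻ τ in Ioi 0, (∑' k, ‖grad (heat c f τ) k‖ₑ ^ 2) ^ 2
      = ∫⁻ τ in Ioi 0, Filter.liminf (fun n => G n τ) Filter.atTop := by
        refine setLIntegral_congr_fun measurableSet_Ioi fun τ hτ => ?_
        exact (hlim τ hτ).liminf_eq.symm
    _ ≤ Filter.liminf (fun n => ∫⁻ τ in Ioi 0, G n τ) Filter.atTop := by
        refine lintegral_liminf_le fun n => ?_
        refine Measurable.indicator ?_ measurableSet_Ioc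
        exact (Finset.measurable_fun_sum _ fun k _ => hmode k).pow_const 2
    _ ≤ _ := by
        refine Filter.liminf_le_of_le (by isBoundedDefault) fun b hb => ?_
        obtain ⟨n, hn⟩ := hb.exists
        refine hn.trans ?_
        have h1 := integral_heat_pow_four_le hf (S n) (c := c)
          (hc.sum_le_tsum (S n) fun k _ => mul_nonneg (freq_nonneg k) (by positivity))
          (Nat.cast_nonneg n)
        calc ∫⁻ τ in Ioi 0, G n τ ≤ ∫⁻ τ, G n τ := setLIntegral_le_lintegral _ _
          _ = ∫⁻ τ in Ioc (0 : ℝ) n, (∑ k ∈ S n, ‖grad (heat c f τ) k‖ₑ ^ 2) ^ 2 :=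
            lintegral_indicator measurableSet_Ioc _
          _ = ∫⁻ τ in Ioc (0 : ℝ) n, ENNReal.ofReal
              ((∑ k ∈ S n, freq k ^ 2 * ‖heat c f τ k‖ ^ 2) ^ 2) := by
            refine lintegral_congr fun τ => ?_
            rw [ENNReal.ofReal_pow (Finset.sum_nonneg fun k _ => by positivity),
              ENNReal.ofReal_sum_of_nonneg fun k _ => by positivity]
            congr 1
            refine Finset.sum_congr rfl fun k _ => ?_
            rw [← mul_pow, ← norm_grad, ENNReal.ofReal_pow (norm_nonneg _), ofReal_norm]
          _ = ENNReal.ofReal (∫ τ in Ioc (0 : ℝ) n,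
              (∑ k ∈ S n, freq k ^ 2 * ‖heat c f τ k‖ ^ 2) ^ 2) := by
            rw [ofReal_integral_eq_lintegral_ofReal]
            · exact (((continuous_sum_heat hl (S n) _).pow 2).integrableOn_Icc).mono_set
                Ioc_subset_Icc_self
            · exact ae_of_all _ fun τ => by positivity
          _ ≤ _ := by
            rw [← intervalIntegral.integral_of_le (Nat.cast_nonneg n)]
            exact ENNReal.ofReal_le_ofReal h1

/-- For almost all times the heat flow lies in `H¹`. -/
theorem ae_memℓp_grad_heat (hf : MemLp f (4 / 3) volume)
    (hc : Summable fun k => freq k * ‖c k‖ ^ 2) :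
    ∀ᵐ t, 0 < t → Memℓp (grad (heat c f t)) 2 := by
  have hl : LocallyIntegrable f volume := hf.locallyIntegrable one_le_four_thirds
  have h1 := (lintegral_heat_pow_four_le hf hc).trans_lt ENNReal.ofReal_lt_top
  have hm : Measurable fun τ => (∑' k, ‖grad (heat c f τ) k‖ₑ ^ 2) ^ 2 :=
    (Measurable.tsum fun k =>
      (continuous_const.mul (continuous_heat hl k)).enorm.measurable.pow_const 2).pow_const 2
  have h2 := ae_lt_top hm h1.ne
  rw [ae_restrict_iff' measurableSet_Ioi] at h2
  filter_upwards [h2] with t ht h0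
  rw [memℓp_two_iff]
  have := ht h0
  contrapose! this
  rw [top_le_iff.1 this]
  simp

theorem aestronglyMeasurable_flow (hf : MemLp f (4 / 3) volume)
    (hc : Summable fun k => freq k * ‖c k‖ ^ 2) :
    AEStronglyMeasurable (flow c f) (volume.restrict (Ioi 0)) := by
  have hl : LocallyIntegrable f volume := hf.locallyIntegrable one_le_four_thirds
  refine aestronglyMeasurable_toEll (fun k =>
    (continuous_const.mul (continuous_heat hl k)).aestronglyMeasurable) ?_
  rw [ae_restrict_iff' measurableSet_Ioi]
  exact ae_memℓp_grad_heat hf hc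

/-- The heat flow maps `L^{4/3}(L²)` sources and `H^{1/2}` data to `L⁴(H¹)`. -/
theorem eLpNorm_flow_le (hf : MemLp f (4 / 3) volume)
    (hc : Summable fun k => freq k * ‖c k‖ ^ 2) :
    eLpNorm (flow c f) 4 (volume.restrict (Ioi 0)) ≤
      ENNReal.ofReal √(∑' k, freq k * ‖c k‖ ^ 2) + 2 * eLpNorm f (4 / 3) volume := by
  have h1 := lintegral_heat_pow_four_le hf hc
  rw [eLpNorm_eq_lintegral_rpow_enorm_toReal (by simp) (by simp)]
  have h2 : ∫⁻ τ in Ioi 0, ‖flow c f τ‖ₑ ^ (4 : ℝ≥0∞).toReal ≤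
      ENNReal.ofReal ((√(∑' k, freq k * ‖c k‖ ^ 2) +
        2 * (eLpNorm f (4 / 3) volume).toReal) ^ 4) := by
    refine le_trans (lintegral_mono fun τ => ?_) h1
    rw [show (4 : ℝ≥0∞).toReal = ((4 : ℕ) : ℝ) by simp, ENNReal.rpow_natCast,
      show (4 : ℕ) = 2 * 2 from rfl, pow_mul]
    exact pow_le_pow_left' (enorm_toEll_sq_le _) 2
  refine (ENNReal.rpow_le_rpow h2 (by positivity)).trans_eq ?_
  rw [ENNReal.ofReal_pow (by positivity), ← ENNReal.rpow_natCast, ← ENNReal.rpow_mul]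
  norm_num
  rw [ENNReal.ofReal_add (by positivity) (by positivity), ENNReal.ofReal_mul (by norm_num),
    ENNReal.ofReal_toReal hf.2.ne]
  simp

end energy

/-! ### A weighted supremum estimate -/

/-- The weighted energy estimate for the scalar equation: the energy identity for
`(t - t₀) l |u|²`, where the dissipation absorbs the source. -/
theorem duhamel_weighted_le {l : ℝ} (hl : 0 ≤ l) {c : ℂ} {f : ℝ → ℂ} (hf : LocallyIntegrable f volume)
    {t₀ t : ℝ} (h : t₀ ≤ t)
    (hfi : IntervalIntegrable (fun τ => (τ - t₀) * ‖f τ‖ ^ 2) volume t₀ t) :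
    (t - t₀) * (l * ‖duhamel l c f t‖ ^ 2) ≤
      (∫ τ in t₀..t, l * ‖duhamel l c f τ‖ ^ 2) +
        1 / 2 * ∫ τ in t₀..t, (τ - t₀) * ‖f τ‖ ^ 2 := by
  set u := duhamel l c f with hu
  have hcu : Continuous u := continuous_duhamel hf
  have i3 : ∀ s, IntervalIntegrable (fun s => (f s * (starRingEnd ℂ) (u s)).re) volume t₀ s := by
    intro s
    have : IntervalIntegrable (fun s => (f s * (starRingEnd ℂ) (u s))) volume t₀ s :=
      (intervalIntegrable_of_locallyIntegrable hf _ _).mul_continuousOn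
        (Complex.continuous_conj.comp hcu).continuousOn
    rw [intervalIntegrable_iff] at this ⊢
    exact this.re
  have i4 : ∀ s, IntervalIntegrable (fun s => ‖u s‖ ^ 2) volume t₀ s := fun s =>
    (hcu.norm.pow 2).intervalIntegrable _ _
  set y' : ℝ → ℝ := fun s => -(2 * l) * ‖u s‖ ^ 2 + 2 * (f s * (starRingEnd ℂ) (u s)).re with hy'
  have iy : ∀ s, IntervalIntegrable y' volume t₀ s := fun s =>
    ((i4 s).const_mul _).add ((i3 s).const_mul _)
  have e1 : ∀ s, t₀ ≤ s → ‖u t₀‖ ^ 2 + ∫ r in t₀..s, y' r = ‖u s‖ ^ 2 := fun s hs => by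
    have := duhamel_energy (l := l) (c := c) hf hs
    rw [hy', intervalIntegral.integral_add ((i4 s).const_mul _) ((i3 s).const_mul _),
      intervalIntegral.integral_const_mul, intervalIntegral.integral_const_mul]
    linarith
  have key := integral_primitive_mul (𝕜 := ℝ) h (‖u t₀‖ ^ 2) 0 (iy t) (g := fun _ => 1)
    intervalIntegrable_const
  rw [e1 t h] at key
  simp only [intervalIntegral.integral_const, smul_eq_mul, mul_one, zero_add, mul_zero, sub_zero] at key
  have e2 : ∫ s in t₀..t, (y' s * (s - t₀) + (‖u t₀‖ ^ 2 + ∫ r in t₀..s, y' r)) =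
      ∫ s in t₀..t, (y' s * (s - t₀) + ‖u s‖ ^ 2) := by
    refine intervalIntegral.integral_congr fun s hs => ?_
    rw [uIcc_of_le h] at hs
    rw [e1 s hs.1]
  rw [e2] at key
  have i5 : IntervalIntegrable (fun s => y' s * (s - t₀) + ‖u s‖ ^ 2) volume t₀ t :=
    ((iy t).mul_continuousOn (by fun_prop)).add (i4 t)
  rw [← intervalIntegral.integral_const_mul, ← intervalIntegral.integral_add ((i4 t).const_mul l)
    (hfi.const_mul _)]
  calc (t - t₀) * (l * ‖u t‖ ^ 2) = ∫ s in t₀..t, l * (y' s * (s - t₀) + ‖u s‖ ^ 2) := by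
        rw [intervalIntegral.integral_const_mul, key]; ring
    _ ≤ _ := by
        refine intervalIntegral.integral_mono_on h (i5.const_mul l)
          (((i4 t).const_mul l).add (hfi.const_mul _)) fun s hs => ?_
        have h1 : 0 ≤ s - t₀ := sub_nonneg.2 hs.1
        have h2 : (f s * (starRingEnd ℂ) (u s)).re ≤ ‖f s‖ * ‖u s‖ := by
          refine (Complex.re_le_norm _).trans_eq ?_
          rw [norm_mul, RCLike.norm_conj]
        -- completing the square in `-2 (l |u|)² + 2 l |u| |f|`
        have h3 : l * y' s ≤ 1 / 2 * ‖f s‖ ^ 2 := by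
          have h4 := mul_le_mul_of_nonneg_left h2 hl
          have h5 : l * y' s = -2 * (l * ‖u s‖) ^ 2 + 2 * (l * (f s * (starRingEnd ℂ) (u s)).re) := by
            simp only [hy']; ring
          nlinarith [sq_nonneg (2 * (l * ‖u s‖) - ‖f s‖)]
        nlinarith [mul_le_mul_of_nonneg_right h3 h1]

/-- The weighted supremum estimate for the gradient of the heat flow, for finitely many modes. No norm
of the gradient at time `t₀` enters, so that the estimate gains regularity. -/
theorem heat_weighted_le {c : ℤ → ℂ} {f : ℝ → Ell2} (hf : LocallyIntegrable f volume)
    {t₀ t : ℝ} (h : t₀ ≤ t)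
    (hfi : IntervalIntegrable (fun τ => (τ - t₀) * ‖f τ‖ ^ 2) volume t₀ t) (s : Finset ℤ) :
    (t - t₀) * (∑ k ∈ s, ‖grad (heat c f t) k‖ ^ 2) ≤
      (∫ τ in t₀..t, ∑ k ∈ s, ‖grad (heat c f τ) k‖ ^ 2) +
        1 / 2 * ∫ τ in t₀..t, (τ - t₀) * ‖f τ‖ ^ 2 := by
  have hfk : ∀ k, IntervalIntegrable (fun τ => (τ - t₀) * ‖f τ k‖ ^ 2) volume t₀ t := by
    intro k
    refine hfi.mono_fun ?_ ?_
    · have := (locallyIntegrable_coord hf k).aestronglyMeasurable.restrict (s := uIoc t₀ t)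
      exact (Continuous.aestronglyMeasurable (by fun_prop)).mul (this.norm.pow 2)
    · refine ae_of_all _ fun τ => ?_
      simp only [norm_mul, norm_pow, norm_norm]
      gcongr
      exact norm_coord_le (f τ) k
  have i1 : ∀ k, IntervalIntegrable (fun τ => ‖grad (heat c f τ) k‖ ^ 2) volume t₀ t := fun k => by
    simp_rw [norm_grad]
    exact ((continuous_const.mul (continuous_heat hf k).norm).pow 2).intervalIntegrable _ _
  have h1 : ∀ k ∈ s, (t - t₀) * ‖grad (heat c f t) k‖ ^ 2 ≤
      (∫ τ in t₀..t, ‖grad (heat c f τ) k‖ ^ 2) +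
        1 / 2 * ∫ τ in t₀..t, (τ - t₀) * ‖f τ k‖ ^ 2 := by
    intro k _
    have := duhamel_weighted_le (sq_nonneg (freq k)) (c := c k) (locallyIntegrable_coord hf k) h
      (hfk k)
    simp only [norm_grad, mul_pow]
    exact this
  have h2 := Finset.sum_le_sum h1
  rw [← Finset.mul_sum, Finset.sum_add_distrib, ← Finset.mul_sum,
    ← intervalIntegral.integral_finsetSum fun k _ => i1 k,
    ← intervalIntegral.integral_finsetSum fun k _ => hfk k] at h2
  refine h2.trans ?_
  gcongr
  have i2 : IntervalIntegrable (fun τ => ∑ k ∈ s, (τ - t₀) * ‖f τ k‖ ^ 2) volume t₀ t := by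
    have := IntervalIntegrable.sum s (fun k _ => hfk k)
    simpa only [Finset.sum_fn] using! this
  refine intervalIntegral.integral_mono_on h i2 hfi fun τ hτ => ?_
  rw [← Finset.mul_sum]
  exact mul_le_mul_of_nonneg_left (sum_norm_sq_le _ _) (sub_nonneg.2 hτ.1)

/-! ### Cubic nonlinearities -/

/-- A nonlinear map `p ↦ lin p p` of `ℓ²` with the size and the Lipschitz bound of a polynomial of
degree three without constant term. The quadratic terms are split by `x ≤ 1 + x²` between `α` and
`Γ`; hence `α` vanishes when only cubic terms are present. -/
structure Nonlinearity where
  /-- The nonlinearity, as a linear map with coefficients depending on the solution. -/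
  lin : Ell2 → Ell2 →L[ℂ] Ell2
  /-- The constant bounding the terms of degree one and two at small arguments. -/
  α : ℝ≥0
  /-- The constant bounding the terms of degree two and three at large arguments. -/
  Γ : ℝ≥0
  continuous_lin : Continuous lin
  norm_lin_le : ∀ p, ‖lin p‖ ≤ α + Γ * ‖p‖ ^ 2
  norm_sub_le : ∀ p q, ‖lin p p - lin q q‖ ≤ (α + Γ * (‖p‖ ^ 2 + ‖q‖ ^ 2)) * ‖p - q‖

namespace Nonlinearity

variable (F : Nonlinearity)

/-- The value `lin p p` of the nonlinearity. -/
def app (p : Ell2) : Ell2 := F.lin p p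

@[simp] theorem app_zero : F.app 0 = 0 := by simp [app]

theorem continuous_app : Continuous F.app := F.continuous_lin.clm_apply continuous_id

/-- The Lipschitz constant of the nonlinearity as a map from `L⁴` to `L^{4/3}`, at `p` and `q`. The
power `1/2` of the length of the time interval comes from Hölder's inequality. -/
def factor (μ : Measure ℝ) (p q : ℝ → Ell2) : ℝ≥0∞ :=
  F.α * μ univ ^ (1 / 2 : ℝ) + F.Γ * (eLpNorm p 4 μ ^ 2 + eLpNorm q 4 μ ^ 2)

theorem eLpNorm_sq_norm (p : ℝ → Ell2) (μ : Measure ℝ) :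
    eLpNorm (fun t => ‖p t‖ ^ 2) 2 μ = eLpNorm p 4 μ ^ 2 := by
  have h := eLpNorm_norm_rpow (μ := μ) (p := 2) p (q := 2) (by norm_num)
  rw [show (2 : ℝ≥0∞) * ENNReal.ofReal 2 = 4 by simp; norm_num] at h
  simpa using h

instance holderTriple_two_four : ENNReal.HolderTriple 2 4 (4 / 3) := by
  constructor
  have h2 : (2 : ℝ≥0∞)⁻¹ = 2 * 4⁻¹ := by
    rw [show (4 : ℝ≥0∞) = 2 * 2 by norm_num, ENNReal.mul_inv (by simp) (by simp), ← mul_assoc,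
      ENNReal.mul_inv_cancel (by simp) (by simp), one_mul]
  rw [h2, ENNReal.inv_div (by simp) (by simp), div_eq_mul_inv, ← add_one_mul]
  norm_num

theorem eLpNorm_nnreal_mul (γ : ℝ≥0) (g : ℝ → ℝ) (μ : Measure ℝ) :
    eLpNorm (fun t => (γ : ℝ) * g t) 2 μ = γ * eLpNorm g 2 μ := by
  have := eLpNorm_const_smul (γ : ℝ) g 2 μ
  rw [Real.enorm_of_nonneg γ.coe_nonneg, ENNReal.ofReal_coe_nnreal] at this
  exact this

theorem eLpNorm_coefficient_le {μ : Measure ℝ} {p q : ℝ → Ell2}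
    (hp : AEStronglyMeasurable p μ) (hq : AEStronglyMeasurable q μ) :
    eLpNorm (fun t => (F.α : ℝ) + F.Γ * (‖p t‖ ^ 2 + ‖q t‖ ^ 2)) 2 μ ≤ F.factor μ p q := by
  have m1 : AEStronglyMeasurable (fun t => ‖p t‖ ^ 2) μ := hp.norm.pow 2
  have m2 : AEStronglyMeasurable (fun t => ‖q t‖ ^ 2) μ := hq.norm.pow 2
  have m3 : AEStronglyMeasurable (fun t => ‖p t‖ ^ 2 + ‖q t‖ ^ 2) μ := m1.add m2
  have e1 : eLpNorm (fun _ : ℝ => (F.α : ℝ)) 2 μ = F.α * μ univ ^ (1 / 2 : ℝ) := by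
    rw [eLpNorm_const' _ (by simp) (by simp)]
    simp
  have e2 : eLpNorm (fun t => (F.Γ : ℝ) * (‖p t‖ ^ 2 + ‖q t‖ ^ 2)) 2 μ ≤
      F.Γ * (eLpNorm p 4 μ ^ 2 + eLpNorm q 4 μ ^ 2) := by
    rw [eLpNorm_nnreal_mul, ← eLpNorm_sq_norm, ← eLpNorm_sq_norm]
    gcongr
    exact eLpNorm_add_le m1 m2 (by norm_num)
  have e5 := eLpNorm_add_le (μ := μ) (f := fun _ : ℝ => (F.α : ℝ)) aestronglyMeasurable_const
    (m3.const_mul (F.Γ : ℝ)) (p := 2) (by norm_num)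
  rw [e1] at e5
  exact e5.trans (add_le_add le_rfl e2)

/-- The nonlinear estimate, by Hölder's inequality `‖a d‖_{4/3} ≤ ‖a‖₂ ‖d‖₄`. -/
theorem eLpNorm_le_factor_mul {μ : Measure ℝ} {u d p q : ℝ → Ell2}
    (hd : AEStronglyMeasurable d μ) (hp : AEStronglyMeasurable p μ) (hq : AEStronglyMeasurable q μ)
    (h : ∀ᵐ t ∂μ, ‖u t‖ ≤ (F.α + F.Γ * (‖p t‖ ^ 2 + ‖q t‖ ^ 2)) * ‖d t‖) :
    eLpNorm u (4 / 3) μ ≤ F.factor μ p q * eLpNorm d 4 μ := by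
  set a : ℝ → ℝ := fun t => F.α + F.Γ * (‖p t‖ ^ 2 + ‖q t‖ ^ 2) with ha
  have ham : AEStronglyMeasurable a μ :=
    aestronglyMeasurable_const.add (((hp.norm.pow 2).add (hq.norm.pow 2)).const_mul _)
  have h1 : eLpNorm u (4 / 3) μ ≤ eLpNorm (a • fun t => ‖d t‖) (4 / 3) μ := by
    refine eLpNorm_mono_ae ?_
    filter_upwards [h] with t ht
    rw [Pi.smul_apply', smul_eq_mul, norm_mul, norm_norm, Real.norm_of_nonneg (by positivity)]
    exact ht
  refine h1.trans ((eLpNorm_smul_le_mul_eLpNorm hd.norm ham (p := 2) (q := 4)).trans ?_)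
  rw [eLpNorm_norm]
  exact mul_le_mul_left (F.eLpNorm_coefficient_le hp hq) _

theorem eLpNorm_app_sub_le {μ : Measure ℝ} {p q : ℝ → Ell2}
    (hp : AEStronglyMeasurable p μ) (hq : AEStronglyMeasurable q μ) :
    eLpNorm (fun t => F.app (p t) - F.app (q t)) (4 / 3) μ ≤
      F.factor μ p q * eLpNorm (p - q) 4 μ :=
  F.eLpNorm_le_factor_mul (hp.sub hq) hp hq (ae_of_all _ fun _ => F.norm_sub_le _ _)

theorem factor_lt_top {μ : Measure ℝ} {p q : ℝ → Ell2} (hμ : F.α * μ univ ^ (1 / 2 : ℝ) < ⊤)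
    (hp : MemLp p 4 μ) (hq : MemLp q 4 μ) : F.factor μ p q < ⊤ := by
  refine ENNReal.add_lt_top.2 ⟨hμ, ENNReal.mul_lt_top (by simp) ?_⟩
  exact ENNReal.add_lt_top.2 ⟨ENNReal.pow_lt_top hp.2, ENNReal.pow_lt_top hq.2⟩

theorem memLp_app {μ : Measure ℝ} {p : ℝ → Ell2} (hμ : F.α * μ univ ^ (1 / 2 : ℝ) < ⊤)
    (hp : MemLp p 4 μ) : MemLp (F.app ∘ p) (4 / 3) μ := by
  refine ⟨F.continuous_app.comp_aestronglyMeasurable hp.1, ?_⟩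
  have := F.eLpNorm_app_sub_le hp.1 (q := 0) aestronglyMeasurable_zero
  simp only [Pi.zero_apply, app_zero, sub_zero] at this
  refine lt_of_le_of_lt this (ENNReal.mul_lt_top ?_ hp.2)
  exact F.factor_lt_top hμ hp MemLp.zero

end Nonlinearity

/-! ### Existence and uniqueness for the equation in Fourier space -/

/-- The linear estimate for two solutions with the same initial data. -/
theorem eLpNorm_flow_sub_le {c : ℤ → ℂ} {f g : ℝ → Ell2} (hf : MemLp f (4 / 3) volume)
    (hg : MemLp g (4 / 3) volume) (hc : Summable fun k => freq k * ‖c k‖ ^ 2) :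
    eLpNorm (flow c f - flow c g) 4 (volume.restrict (Ioi 0)) ≤
      2 * eLpNorm (f - g) (4 / 3) volume := by
  have h0 : Summable fun k => freq k * ‖(c - c) k‖ ^ 2 := by simp
  have h1 := eLpNorm_flow_le (hf.sub hg) h0
  simp only [sub_self, Pi.zero_apply, norm_zero, ne_eq, OfNat.ofNat_ne_zero, not_false_eq_true,
    zero_pow, mul_zero, tsum_zero, Real.sqrt_zero, ENNReal.ofReal_zero, zero_add] at h1
  refine le_trans (le_of_eq (eLpNorm_congr_ae ?_)) h1
  rw [Filter.EventuallyEq, ae_restrict_iff' measurableSet_Ioi]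
  filter_upwards [ae_memℓp_grad_heat hf hc, ae_memℓp_grad_heat hg hc] with t h2 h3 ht
  have := flow_sub (hf.locallyIntegrable one_le_four_thirds)
    (hg.locallyIntegrable one_le_four_thirds) (h2 ht) (h3 ht)
  rw [sub_self] at this
  exact this.symm

/-- The function `p`, with values in `ℓ²`, is the sequence of Fourier coefficients of `∂ₓ ζ` on the
time set `I`, where `ζ` has the initial coefficients `c` and solves `∂ₜ ζ = ∂ₓ² ζ + F(∂ₓ ζ)` in the
sense of Duhamel's formula. -/
structure CoeffSolution (F : Nonlinearity) (c : ℤ → ℂ) (I : Set ℝ) (p : ℝ → Ell2) : Prop where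
  memLp : MemLp p 4 (volume.restrict I)
  eq : p =ᵐ[volume.restrict I] flow c (I.indicator (F.app ∘ p))

section

variable {F : Nonlinearity} {c : ℤ → ℂ} {I : Set ℝ} {p q : ℝ → Ell2}

theorem memLp_source (hI : MeasurableSet I) (hα : F.α * volume I ^ (1 / 2 : ℝ) < ⊤)
    (hp : MemLp p 4 (volume.restrict I)) :
    MemLp (I.indicator (F.app ∘ p)) (4 / 3) volume := by
  rw [memLp_indicator_iff_restrict hI]
  exact F.memLp_app (by simpa using hα) hp

theorem eLpNorm_source_sub (hI : MeasurableSet I) (g h : ℝ → Ell2) :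
    eLpNorm (I.indicator g - I.indicator h) (4 / 3) volume =
      eLpNorm (fun t => g t - h t) (4 / 3) (volume.restrict I) := by
  have e : I.indicator g - I.indicator h = I.indicator (fun t => g t - h t) :=
    (indicator_sub I g h).symm
  rw [e, eLpNorm_indicator_eq_eLpNorm_restrict hI]

/-- The nonlinear flow is Lipschitz on bounded sets of `L⁴(I; ℓ²)`. -/
theorem eLpNorm_flow_source_sub_le (hI : MeasurableSet I) (hI0 : I ⊆ Ioi 0)
    (hα : F.α * volume I ^ (1 / 2 : ℝ) < ⊤) (hc : Summable fun k => freq k * ‖c k‖ ^ 2)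
    (hp : MemLp p 4 (volume.restrict I)) (hq : MemLp q 4 (volume.restrict I)) :
    eLpNorm (flow c (I.indicator (F.app ∘ p)) - flow c (I.indicator (F.app ∘ q))) 4
      (volume.restrict I) ≤
      2 * (F.factor (volume.restrict I) p q * eLpNorm (p - q) 4 (volume.restrict I)) := by
  have h1 := eLpNorm_flow_sub_le (memLp_source hI hα hp) (memLp_source hI hα hq) hc
  rw [eLpNorm_source_sub hI] at h1
  refine (eLpNorm_mono_measure _ (Measure.restrict_mono hI0 le_rfl)).trans (h1.trans ?_)
  gcongr
  exact F.eLpNorm_app_sub_le hp.1 hq.1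

theorem memLp_flow_source (hI : MeasurableSet I) (hI0 : I ⊆ Ioi 0)
    (hα : F.α * volume I ^ (1 / 2 : ℝ) < ⊤) (hc : Summable fun k => freq k * ‖c k‖ ^ 2)
    (hp : MemLp p 4 (volume.restrict I)) :
    MemLp (flow c (I.indicator (F.app ∘ p))) 4 (volume.restrict I) := by
  have hf := memLp_source hI hα hp
  refine MemLp.mono_measure (Measure.restrict_mono hI0 le_rfl)
    ⟨aestronglyMeasurable_flow hf hc, (eLpNorm_flow_le hf hc).trans_lt ?_⟩
  exact ENNReal.add_lt_top.2 ⟨ENNReal.ofReal_lt_top, ENNReal.mul_lt_top (by simp) hf.2⟩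

/-- Existence by the contraction principle, when the linear evolution of the data is small in
`L⁴(I; ℓ²)` and the linear terms of the nonlinearity are small on `I`. -/
theorem exists_coeffSolution (F : Nonlinearity) (hI : MeasurableSet I) (hI0 : I ⊆ Ioi 0)
    (hα : F.α * volume I ^ (1 / 2 : ℝ) ≤ 1 / 8) (hc : Summable fun k => freq k * ‖c k‖ ^ 2)
    {ε : ℝ≥0} (hε : F.Γ * ((2 * ε) ^ 2 + (2 * ε) ^ 2) ≤ 1 / 8)
    (hlin : eLpNorm (flow c 0) 4 (volume.restrict I) ≤ ε) :
    ∃ p, CoeffSolution F c I p := by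
  have hα' : F.α * volume I ^ (1 / 2 : ℝ) < ⊤ := hα.trans_lt (by simp)
  have : Fact ((1 : ℝ≥0∞) ≤ 4) := ⟨by norm_num⟩
  set μ := volume.restrict I with hμ
  let Ψ : Lp Ell2 4 μ → Lp Ell2 4 μ := fun p =>
    (memLp_flow_source hI hI0 hα' hc (Lp.memLp p)).toLp _
  set R : ℝ≥0 := 2 * ε with hR
  let s : Set (Lp Ell2 4 μ) := Metric.closedEBall 0 R
  have hs : ∀ p ∈ s, eLpNorm p 4 μ ≤ R := fun p hp => by
    have : edist p 0 ≤ R := hp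
    rwa [edist_zero_right, Lp.enorm_def] at this
  -- the linear and the cubic terms contribute `1 / 8` each to the factor, and the flow doubles it
  have hlip : ∀ p ∈ s, ∀ q ∈ s, edist (Ψ p) (Ψ q) ≤ (1 / 2 : ℝ≥0) * edist p q := by
    intro p hp q hq
    rw [Lp.edist_toLp_toLp, Lp.edist_def]
    refine (eLpNorm_flow_source_sub_le hI hI0 hα' hc (Lp.memLp p) (Lp.memLp q)).trans ?_
    rw [← mul_assoc]
    gcongr
    have h1 : F.factor μ p q ≤ 1 / 8 + 1 / 8 := by
      unfold Nonlinearity.factor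
      refine add_le_add (by simpa [hμ] using hα) ?_
      calc (F.Γ : ℝ≥0∞) * (eLpNorm p 4 μ ^ 2 + eLpNorm q 4 μ ^ 2)
          ≤ F.Γ * ((R : ℝ≥0∞) ^ 2 + (R : ℝ≥0∞) ^ 2) := by
            gcongr
            · exact hs p hp
            · exact hs q hq
        _ ≤ ((1 / 8 : ℝ≥0) : ℝ≥0∞) := by exact_mod_cast hε
        _ = 1 / 8 := by simp
    calc 2 * F.factor μ p q ≤ 2 * (1 / 8 + 1 / 8) := by gcongr
      _ = ((2 * (1 / 8 + 1 / 8) : ℝ≥0) : ℝ≥0∞) := by push_cast; simp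
      _ = ((1 / 2 : ℝ≥0) : ℝ≥0∞) := by congr 1; norm_num
  have h0 : (0 : Lp Ell2 4 μ) ∈ s := by simp [s]
  have hΨ0 : edist (Ψ 0) 0 ≤ ε := by
    rw [edist_zero_right, Lp.enorm_toLp]
    refine le_trans (le_of_eq (eLpNorm_congr_ae ?_)) hlin
    rw [hμ, Filter.EventuallyEq, ae_restrict_iff' hI]
    refine ae_of_all _ fun t ht => ?_
    have h2 := Lp.coeFn_zero Ell2 4 μ
    rw [hμ, Filter.EventuallyEq, ae_restrict_iff' hI] at h2
    unfold flow
    rw [heat_congr (le_of_lt (hI0 ht))]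
    filter_upwards [h2] with r hr _
    by_cases hrI : r ∈ I
    · rw [indicator_of_mem hrI, Function.comp_apply, hr hrI]
      simp
    · rw [indicator_of_notMem hrI]; rfl
  have hmaps : MapsTo Ψ s s := by
    intro p hp
    have h1 := hlip p hp 0 h0
    calc edist (Ψ p) 0 ≤ edist (Ψ p) (Ψ 0) + edist (Ψ 0) 0 := edist_triangle _ _ _
      _ ≤ (1 / 2 : ℝ≥0) * R + ε := by
        gcongr
        exact h1.trans (by gcongr; exact hp)
      _ = R := by
        rw [← ENNReal.coe_mul, ← ENNReal.coe_add, hR]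
        congr 1
        rw [← mul_assoc]; norm_num; ring
  have hcontr : ContractingWith (1 / 2) (hmaps.restrict Ψ s s) := by
    refine ⟨?_, fun p q => hlip p p.2 q q.2⟩
    rw [← NNReal.coe_lt_coe]; norm_num
  obtain ⟨p, -, hp, -⟩ := hcontr.exists_fixedPoint' (Metric.isClosed_closedEBall.isComplete) hmaps
    h0 (by rw [edist_comm]; exact (hΨ0.trans_lt ENNReal.coe_lt_top).ne)
  refine ⟨p, Lp.memLp p, ?_⟩
  have h3 : Ψ p =ᵐ[μ] _ := MemLp.coeFn_toLp (memLp_flow_source hI hI0 hα' hc (Lp.memLp p))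
  rwa [show Ψ p = p from hp] at h3

/-- Restriction of a solution to a shorter time interval. -/
theorem CoeffSolution.restrict (h : CoeffSolution F c I p) {t₁ : ℝ}
    (ht : Ioo 0 t₁ ⊆ I) :
    CoeffSolution F c (Ioo 0 t₁) p := by
  refine ⟨h.memLp.mono_measure (Measure.restrict_mono ht le_rfl), ?_⟩
  have h1 := ae_restrict_of_ae_restrict_of_subset ht h.eq
  rw [Filter.EventuallyEq, ae_restrict_iff' measurableSet_Ioo]
  rw [ae_restrict_iff' measurableSet_Ioo] at h1
  filter_upwards [h1] with t h2 h3
  rw [h2 h3]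
  unfold flow
  rw [heat_congr h3.1.le (ae_of_all _ fun s hs => ?_)]
  have : s ∈ Ioo 0 t₁ := ⟨hs.1, hs.2.trans_lt h3.2⟩
  rw [indicator_of_mem this, indicator_of_mem (ht this)]

theorem exists_pos_le_eighth {g : ℝ → ℝ} (hg : Continuous g) (h0 : g 0 = 0) :
    ∃ ε : ℝ, 0 < ε ∧ g ε ≤ 1 / 8 := by
  have : Filter.Tendsto g (nhdsWithin 0 (Ioi 0)) (nhds 0) := by
    have h1 := (hg.tendsto 0).mono_left (nhdsWithin_le_nhds (s := Ioi 0))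
    rwa [h0] at h1
  have h1 := this.eventually (ge_mem_nhds (show (0 : ℝ) < 1 / 8 by norm_num))
  obtain ⟨ε, h2, h3⟩ := (h1.and self_mem_nhdsWithin).exists
  exact ⟨ε, h3, h2⟩

theorem exists_radius (F : Nonlinearity) :
    ∃ ε : ℝ≥0, 0 < ε ∧ F.Γ * ((2 * ε) ^ 2 + (2 * ε) ^ 2) ≤ 1 / 8 := by
  obtain ⟨ε, hε, hε'⟩ := exists_pos_le_eighth
    (g := fun ε => F.Γ * ((2 * ε) ^ 2 + (2 * ε) ^ 2)) (by fun_prop) (by simp)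
  refine ⟨⟨ε, hε.le⟩, hε, ?_⟩
  rw [← NNReal.coe_le_coe]
  push_cast
  exact hε'

/-- The factor is uniformly small on short time windows. -/
theorem exists_window (F : Nonlinearity) {T : ℝ} (hp : MemLp p 4 (volume.restrict (Ioo 0 T)))
    (hq : MemLp q 4 (volume.restrict (Ioo 0 T))) :
    ∃ δ > 0, ∀ s t, t - s ≤ δ → F.factor (volume.restrict (Ioo 0 T ∩ Ioo s t)) p q ≤ 1 / 4 := by
  obtain ⟨ε, hε, hε'⟩ := exists_pos_le_eighth (g := fun ε => F.Γ * (ε ^ 2 + ε ^ 2))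
    (by fun_prop) (by simp)
  obtain ⟨δ₁, hδ₁, h₁⟩ := hp.eLpNorm_indicator_le (by norm_num) (by simp) hε
  obtain ⟨δ₂, hδ₂, h₂⟩ := hq.eLpNorm_indicator_le (by norm_num) (by simp) hε
  obtain ⟨δ₃, hδ₃, h₃⟩ := exists_pos_le_eighth (g := fun δ => F.α * δ ^ (1 / 2 : ℝ))
    (continuous_const.mul (Real.continuous_rpow_const (by norm_num))) (by simp)
  refine ⟨min δ₁ (min δ₂ δ₃), by positivity, fun s t hst => ?_⟩
  have hvol : volume (Ioo s t) = ENNReal.ofReal (t - s) := Real.volume_Ioo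
  have key : ∀ (u : ℝ → Ell2) (δ : ℝ), (∀ J, MeasurableSet J →
      volume.restrict (Ioo 0 T) J ≤ ENNReal.ofReal δ →
      eLpNorm (J.indicator u) 4 (volume.restrict (Ioo 0 T)) ≤ ENNReal.ofReal ε) → t - s ≤ δ →
      eLpNorm u 4 (volume.restrict (Ioo 0 T ∩ Ioo s t)) ≤ ENNReal.ofReal ε := by
    intro u δ h hδ
    have h4 := h (Ioo s t) measurableSet_Ioo ((Measure.restrict_apply_le _ _).trans
      (hvol.le.trans (ENNReal.ofReal_le_ofReal hδ)))
    rwa [eLpNorm_indicator_eq_eLpNorm_restrict measurableSet_Ioo,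
      Measure.restrict_restrict measurableSet_Ioo, inter_comm] at h4
  have k1 := key p δ₁ h₁ (hst.trans (min_le_left _ _))
  have k2 := key q δ₂ h₂ (hst.trans ((min_le_right _ _).trans (min_le_left _ _)))
  have k3 : F.α * volume (Ioo 0 T ∩ Ioo s t) ^ (1 / 2 : ℝ) ≤ ENNReal.ofReal (1 / 8) := by
    calc F.α * volume (Ioo 0 T ∩ Ioo s t) ^ (1 / 2 : ℝ)
        ≤ F.α * ENNReal.ofReal δ₃ ^ (1 / 2 : ℝ) := by
          gcongr
          refine (measure_mono inter_subset_right).trans (hvol.le.trans ?_)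
          exact ENNReal.ofReal_le_ofReal (hst.trans ((min_le_right _ _).trans (min_le_right _ _)))
      _ = ENNReal.ofReal (F.α * δ₃ ^ (1 / 2 : ℝ)) := by
          rw [ENNReal.ofReal_mul (by positivity), ENNReal.ofReal_rpow_of_pos hδ₃]
          simp
      _ ≤ _ := ENNReal.ofReal_le_ofReal h₃
  have k4 : F.Γ * (eLpNorm p 4 (volume.restrict (Ioo 0 T ∩ Ioo s t)) ^ 2 +
      eLpNorm q 4 (volume.restrict (Ioo 0 T ∩ Ioo s t)) ^ 2) ≤ ENNReal.ofReal (1 / 8) := by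
    calc _ ≤ F.Γ * (ENNReal.ofReal ε ^ 2 + ENNReal.ofReal ε ^ 2) := by gcongr
      _ = ENNReal.ofReal (F.Γ * (ε ^ 2 + ε ^ 2)) := by
          rw [ENNReal.ofReal_mul (by positivity), ENNReal.ofReal_add (by positivity) (by positivity),
            ENNReal.ofReal_pow hε.le]
          simp
      _ ≤ _ := ENNReal.ofReal_le_ofReal hε'
  unfold Nonlinearity.factor
  rw [Measure.restrict_apply_univ]
  refine (add_le_add k3 k4).trans_eq ?_
  rw [← ENNReal.ofReal_add (by norm_num) (by norm_num)]
  norm_num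
  rw [ENNReal.ofReal_div_of_pos (by norm_num)]
  simp

/-- Two solutions with the same data agree: on a short window after the last time of agreement, the
difference is controlled by half of itself. -/
theorem CoeffSolution.unique {T : ℝ} (hc : Summable fun k => freq k * ‖c k‖ ^ 2)
    (hp : CoeffSolution F c (Ioo 0 T) p) (hq : CoeffSolution F c (Ioo 0 T) q) :
    p =ᵐ[volume.restrict (Ioo 0 T)] q := by
  obtain ⟨δ, hδ, hwin⟩ := exists_window F hp.memLp hq.memLp
  -- agreement up to the time `n δ`, by induction on `n`
  have hstep : ∀ n : ℕ, ∀ᵐ t, t ∈ Ioo 0 T → t < n * δ → p t = q t := by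
    intro n
    induction n with
    | zero => exact ae_of_all _ fun t ht h => absurd ht.1 (by simpa using h.le)
    | succ n ih =>
      set t₁ := min T ((n + 1 : ℕ) * δ) with ht₁
      have hsub : Ioo 0 t₁ ⊆ Ioo 0 T := Ioo_subset_Ioo_right (min_le_left _ _)
      have hp1 := hp.restrict hsub
      have hq1 := hq.restrict hsub
      set J : Set ℝ := Ioo 0 T ∩ Ioo (n * δ) t₁ with hJ
      have hJm : MeasurableSet J := measurableSet_Ioo.inter measurableSet_Ioo
      have hJ1 : J ⊆ Ioo 0 t₁ := fun t ht => ⟨ht.1.1, ht.2.2⟩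
      have hJT : J ⊆ Ioo 0 T := inter_subset_left
      have hα : ∀ t : ℝ, F.α * volume (Ioo 0 t) ^ (1 / 2 : ℝ) < ⊤ := fun t =>
        ENNReal.mul_lt_top (by simp) (ENNReal.rpow_lt_top_of_nonneg (by norm_num) (by simp))
      have h1 := eLpNorm_flow_sub_le (memLp_source measurableSet_Ioo (hα _) hp1.memLp)
        (memLp_source measurableSet_Ioo (hα _) hq1.memLp) hc
      have h2 : eLpNorm (p - q) 4 (volume.restrict J) ≤
          2 * eLpNorm (fun t => F.app (p t) - F.app (q t)) (4 / 3) (volume.restrict J) := by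
        calc eLpNorm (p - q) 4 (volume.restrict J)
            = eLpNorm (flow c ((Ioo 0 t₁).indicator (F.app ∘ p)) -
                flow c ((Ioo 0 t₁).indicator (F.app ∘ q))) 4 (volume.restrict J) := by
              refine eLpNorm_congr_ae ?_
              filter_upwards [ae_restrict_of_ae_restrict_of_subset hJ1 hp1.eq,
                ae_restrict_of_ae_restrict_of_subset hJ1 hq1.eq] with t h5 h6
              rw [Pi.sub_apply, Pi.sub_apply, h5, h6]
          _ ≤ _ := eLpNorm_mono_measure _
              (Measure.restrict_mono (fun t ht => (hJ1 ht).1) le_rfl)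
          _ ≤ _ := h1
          _ = _ := by
              rw [eLpNorm_source_sub measurableSet_Ioo,
                ← eLpNorm_indicator_eq_eLpNorm_restrict measurableSet_Ioo,
                ← eLpNorm_indicator_eq_eLpNorm_restrict hJm]
              congr 1
              refine eLpNorm_congr_ae ?_
              have hne : ∀ᵐ t : ℝ, t ≠ n * δ := by simp [ae_iff]
              filter_upwards [ih, hne] with t ht hne
              by_cases h3 : t ∈ Ioo 0 t₁
              · rw [indicator_of_mem h3]
                by_cases h4 : n * δ < t
                · have h5 : t ∈ J := ⟨hsub h3, h4, h3.2⟩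
                  rw [indicator_of_mem h5]
                  rfl
                · rw [indicator_of_notMem (fun h => h4 h.2.1)]
                  simp only [Function.comp_apply]
                  rw [ht (hsub h3) (lt_of_le_of_ne (not_lt.1 h4) hne), sub_self]
              · rw [indicator_of_notMem h3, indicator_of_notMem (fun h => h3 (hJ1 h))]
      have hpJ := hp.memLp.mono_measure (Measure.restrict_mono hJT le_rfl)
      have hqJ := hq.memLp.mono_measure (Measure.restrict_mono hJT le_rfl)
      have h3 := F.eLpNorm_app_sub_le hpJ.1 hqJ.1
      have h4 : F.factor (volume.restrict J) p q ≤ 1 / 4 := by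
        refine hwin _ _ ?_
        have : t₁ ≤ (n + 1 : ℕ) * δ := min_le_right _ _
        push_cast at this
        linarith
      have h5 : eLpNorm (p - q) 4 (volume.restrict J) ≤
          (1 / 2) * eLpNorm (p - q) 4 (volume.restrict J) := by
        calc _ ≤ 2 * (1 / 4 * eLpNorm (p - q) 4 (volume.restrict J)) :=
              h2.trans (by gcongr; exact h3.trans (by gcongr))
          _ = _ := by
              rw [← mul_assoc]
              congr 1
              rw [show (4 : ℝ≥0∞) = 2 * 2 by norm_num, one_div, one_div,
                ENNReal.mul_inv (by simp) (by simp), ← mul_assoc,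
                ENNReal.mul_inv_cancel (by simp) (by simp), one_mul]
      have h6 : eLpNorm (p - q) 4 (volume.restrict J) = 0 := by
        by_contra h7
        have h8 := ENNReal.half_lt_self h7 (hpJ.sub hqJ).2.ne
        rw [ENNReal.div_eq_inv_mul, ← one_div] at h8
        exact absurd h5 (not_le.2 h8)
      rw [eLpNorm_eq_zero_iff (hpJ.sub hqJ).1 (by simp), Filter.EventuallyEq,
        ae_restrict_iff' hJm] at h6
      have hne : ∀ᵐ t : ℝ, t ≠ n * δ := by simp [ae_iff]
      filter_upwards [ih, h6, hne] with t h7 h8 h9 h10 h11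
      by_cases h12 : n * δ < t
      · have := h8 ⟨h10, h12, lt_min h10.2 h11⟩
        exact sub_eq_zero.1 this
      · exact h7 h10 (lt_of_le_of_ne (not_lt.1 h12) h9)
  rw [Filter.EventuallyEq, ae_restrict_iff' measurableSet_Ioo]
  obtain ⟨n, hn⟩ := exists_nat_gt (T / δ)
  filter_upwards [hstep n] with t h1 h2
  refine h1 h2 (h2.2.trans ?_)
  rwa [div_lt_iff₀ hδ] at hn

/-- Local existence: the linear evolution of the data lies in `L⁴`, hence is small in `L⁴` on a short
interval. -/
theorem exists_coeffSolution_local (F : Nonlinearity) (hc : Summable fun k => freq k * ‖c k‖ ^ 2) :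
    ∃ T > 0, ∃ p, CoeffSolution F c (Ioo 0 T) p := by
  obtain ⟨ε, hε, hε'⟩ := exists_radius F
  have h0 : MemLp (0 : ℝ → Ell2) (4 / 3) volume := MemLp.zero
  have hfl : MemLp (flow c 0) 4 (volume.restrict (Ioi 0)) :=
    ⟨aestronglyMeasurable_flow h0 hc, (eLpNorm_flow_le h0 hc).trans_lt (by simp)⟩
  obtain ⟨δ, hδ, h1⟩ := hfl.eLpNorm_indicator_le (by norm_num) (by simp) (NNReal.coe_pos.2 hε)
  obtain ⟨δ₃, hδ₃, h₃⟩ := exists_pos_le_eighth (g := fun δ => F.α * δ ^ (1 / 2 : ℝ))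
    (continuous_const.mul (Real.continuous_rpow_const (by norm_num))) (by simp)
  have hmin : 0 < min δ δ₃ := lt_min hδ hδ₃
  refine ⟨min δ δ₃, hmin, exists_coeffSolution F measurableSet_Ioo (fun t ht => ht.1) ?_ hc hε' ?_⟩
  · rw [Real.volume_Ioo, sub_zero]
    calc F.α * ENNReal.ofReal (min δ δ₃) ^ (1 / 2 : ℝ)
        ≤ F.α * ENNReal.ofReal δ₃ ^ (1 / 2 : ℝ) := by gcongr; exact min_le_right _ _
      _ = ENNReal.ofReal (F.α * δ₃ ^ (1 / 2 : ℝ)) := by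
          rw [ENNReal.ofReal_mul (by positivity), ENNReal.ofReal_rpow_of_pos hδ₃]
          simp
      _ ≤ ENNReal.ofReal (1 / 8) := ENNReal.ofReal_le_ofReal h₃
      _ = 1 / 8 := by rw [ENNReal.ofReal_div_of_pos (by norm_num)]; simp
  · have h2 := h1 (Ioo 0 (min δ δ₃)) measurableSet_Ioo ((Measure.restrict_apply_le _ _).trans (by
      rw [Real.volume_Ioo, sub_zero]
      exact ENNReal.ofReal_le_ofReal (min_le_left _ _)))
    rw [eLpNorm_indicator_eq_eLpNorm_restrict measurableSet_Ioo,
      Measure.restrict_restrict measurableSet_Ioo,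
      inter_eq_left.2 Ioo_subset_Ioi_self] at h2
    simpa using h2

/-- Global existence for small data when only cubic terms are present: the contraction argument then
applies on the whole half-line. -/
theorem exists_coeffSolution_global (F : Nonlinearity) (hα : F.α = 0) :
    ∃ η : ℝ, 0 < η ∧ ∀ c : ℤ → ℂ, Summable (fun k => freq k * ‖c k‖ ^ 2) →
      ∑' k, freq k * ‖c k‖ ^ 2 ≤ η ^ 2 → ∃ p, CoeffSolution F c (Ioi 0) p := by
  obtain ⟨ε, hε, hε'⟩ := exists_radius F
  refine ⟨ε, NNReal.coe_pos.2 hε, fun c hc hle => ?_⟩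
  refine exists_coeffSolution F measurableSet_Ioi subset_rfl (by simp [hα]) hc hε' ?_
  refine (eLpNorm_flow_le MemLp.zero hc).trans ?_
  rw [eLpNorm_zero, mul_zero, add_zero, ← ENNReal.ofReal_coe_nnreal]
  exact ENNReal.ofReal_le_ofReal (Real.sqrt_le_iff.2 ⟨ε.coe_nonneg, hle⟩)

end

/-! ### Boundedness of the gradient at positive times -/

theorem integral_norm_sq_le {E : Type*} [NormedAddCommGroup E] {μ : Measure ℝ} {u : ℝ → E}
    (hu : MemLp u 2 μ) {b : ℝ} (hb : 0 ≤ b) (h : eLpNorm u 2 μ ≤ ENNReal.ofReal b) :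
    ∫ t, ‖u t‖ ^ 2 ∂μ ≤ b ^ 2 := by
  have h0 : 0 ≤ ∫ t, ‖u t‖ ^ 2 ∂μ := integral_nonneg fun t => by positivity
  have h1 := hu.eLpNorm_eq_integral_rpow_norm (by simp) (by simp)
  simp only [ENNReal.toReal_ofNat, Real.rpow_ofNat] at h1
  rw [h1, ENNReal.ofReal_le_ofReal_iff hb] at h
  have h2 := pow_le_pow_left₀ (by positivity) h 2
  rwa [← Real.rpow_natCast, ← Real.rpow_mul h0, show ((2 : ℝ)⁻¹ * (2 : ℕ)) = 1 by norm_num,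
    Real.rpow_one] at h2

theorem mul_norm_toEll_sq_le {a : ℤ → ℂ} {C Y : ℝ} (hY : 0 ≤ Y)
    (h : ∀ s : Finset ℤ, C * ∑ k ∈ s, ‖a k‖ ^ 2 ≤ Y) : C * ‖toEll a‖ ^ 2 ≤ Y := by
  by_cases ha : Memℓp a 2
  · have h1 := (hasSum_norm_sq (toEll a)).mul_left C
    refine hasSum_le_of_sum_le h1 fun s => ?_
    rw [← Finset.mul_sum]
    simpa only [coe_toEll ha] using h s
  · simp [toEll, ha, hY]

/-- On a short window `(s, t₁)` the gradient is bounded by a multiple of `(t - s)^{-1/2}`. With the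
coefficients of the linear operator `F.lin p` frozen, the iterates of Duhamel's formula that start
from `0` on the window satisfy such a bound uniformly, and they converge to the solution in `L⁴`. -/
theorem CoeffSolution.exists_window_bound {F : Nonlinearity} {c : ℤ → ℂ} {T : ℝ} {p : ℝ → Ell2}
    (hc : Summable fun k => freq k * ‖c k‖ ^ 2) (hp : CoeffSolution F c (Ioo 0 T) p)
    {s t₁ : ℝ} (hs : 0 ≤ s) (ht₁ : t₁ ≤ T)
    (hwin : F.factor (volume.restrict (Ioo s t₁)) p p ≤ 1 / 4) :
    ∃ Y : ℝ, ∀ᵐ t, t ∈ Ioo s t₁ → (t - s) * ‖p t‖ ^ 2 ≤ Y := by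
  classical
  set J : Set ℝ := Ioo s t₁ with hJ
  set μ : Measure ℝ := volume.restrict J with hμ
  have hsub : Ioo 0 t₁ ⊆ Ioo 0 T := Ioo_subset_Ioo_right ht₁
  have hJ0 : J ⊆ Ioo 0 t₁ := Ioo_subset_Ioo_left hs
  have hp1 := hp.restrict hsub
  have hpJ : MemLp p 4 μ := hp1.memLp.mono_measure (Measure.restrict_mono hJ0 le_rfl)
  have hα : F.α * volume (Ioo 0 t₁) ^ (1 / 2 : ℝ) < ⊤ :=
    ENNReal.mul_lt_top (by simp) (ENNReal.rpow_lt_top_of_nonneg (by norm_num) (by simp))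
  -- the source with the history `p` up to time `s` and `r` afterwards
  set d : (ℝ → Ell2) → ℝ → Ell2 := fun r => (Iic s).piecewise p r with hd
  set src : (ℝ → Ell2) → ℝ → Ell2 := fun r =>
    (Ioo 0 t₁).indicator (fun τ => F.lin (p τ) (d r τ)) with hsrc
  have hdL : ∀ r, MemLp r 4 μ → MemLp (d r) 4 (volume.restrict (Ioo 0 t₁)) := by
    intro r hr
    refine MemLp.piecewise measurableSet_Iic (hp1.memLp.restrict _) ?_
    refine hr.mono_measure ?_
    rw [Measure.restrict_restrict measurableSet_Iic.compl]
    refine Measure.restrict_mono (fun τ (hτ : τ ∈ (Iic s)ᶜ ∩ Ioo 0 t₁) => ?_) le_rfl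
    exact ⟨not_le.1 hτ.1, hτ.2.2⟩
  have hlin : ∀ p' : Ell2, ‖F.lin p'‖ ≤ F.α + F.Γ * (‖p'‖ ^ 2 + ‖p'‖ ^ 2) := fun p' => by
    refine (F.norm_lin_le p').trans ?_
    gcongr
    nlinarith [sq_nonneg ‖p'‖]
  have hsrcL : ∀ r, MemLp r 4 μ → MemLp (src r) (4 / 3) volume := by
    intro r hr
    rw [hsrc, memLp_indicator_iff_restrict measurableSet_Ioo]
    refine ⟨isBoundedBilinearMap_apply.continuous.comp_aestronglyMeasurable
      ((F.continuous_lin.comp_aestronglyMeasurable hp1.memLp.1).prodMk (hdL r hr).1), ?_⟩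
    refine (F.eLpNorm_le_factor_mul (hdL r hr).1 hp1.memLp.1 hp1.memLp.1 (ae_of_all _ fun t => ?_)).trans_lt
      (ENNReal.mul_lt_top (F.factor_lt_top (by simpa using hα) hp1.memLp hp1.memLp) (hdL r hr).2)
    exact (ContinuousLinearMap.le_opNorm _ _).trans (by gcongr; exact hlin _)
  let R : ℕ → ℝ → Ell2 := fun n => Nat.rec 0 (fun _ r => flow c (src r)) n
  have hR0 : R 0 = 0 := rfl
  have hRs : ∀ n, R (n + 1) = flow c (src (R n)) := fun n => rfl
  have hJpos : J ⊆ Ioi 0 := fun t ht => hs.trans_lt ht.1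
  have hflowL : ∀ f : ℝ → Ell2, MemLp f (4 / 3) volume → MemLp (flow c f) 4 μ := fun f hf =>
    MemLp.mono_measure (Measure.restrict_mono hJpos le_rfl)
      ⟨aestronglyMeasurable_flow hf hc, (eLpNorm_flow_le hf hc).trans_lt
        (ENNReal.add_lt_top.2 ⟨ENNReal.ofReal_lt_top, ENNReal.mul_lt_top (by simp) hf.2⟩)⟩
  have hRL : ∀ n, MemLp (R n) 4 μ := by
    intro n
    induction n with
    | zero => exact MemLp.zero
    | succ n ih => exact hflowL _ (hsrcL _ ih)
  -- the iterates converge geometrically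
  have hRp : ∀ n, eLpNorm (R n - p) 4 μ ≤ (1 / 2) ^ n * eLpNorm p 4 μ := by
    intro n
    induction n with
    | zero => rw [hR0, zero_sub, eLpNorm_neg]; simp
    | succ n ih =>
      have h1 := eLpNorm_flow_sub_le (hsrcL _ (hRL n)) (memLp_source measurableSet_Ioo hα hp1.memLp) hc
      have h2 : src (R n) - (Ioo 0 t₁).indicator (F.app ∘ p) =
          J.indicator (fun τ => F.lin (p τ) (R n τ - p τ)) := by
        funext τ
        simp only [hsrc, Pi.sub_apply]
        by_cases h3 : τ ∈ Ioo 0 t₁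
        · rw [indicator_of_mem h3, indicator_of_mem h3]
          by_cases h4 : τ ≤ s
          · rw [indicator_of_notMem (fun h : τ ∈ J => not_le.2 h.1 h4)]
            simp [hd, h4, Nonlinearity.app]
          · rw [indicator_of_mem (show τ ∈ J from ⟨not_le.1 h4, h3.2⟩)]
            simp [hd, h4, Nonlinearity.app]
        · rw [indicator_of_notMem h3, indicator_of_notMem h3,
            indicator_of_notMem (fun h => h3 (hJ0 h)), sub_zero]
      rw [h2, eLpNorm_indicator_eq_eLpNorm_restrict measurableSet_Ioo] at h1
      have h3 := F.eLpNorm_le_factor_mul (μ := μ) (u := fun τ => F.lin (p τ) (R n τ - p τ))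
        (d := R n - p) ((hRL n).sub hpJ).1 hpJ.1 hpJ.1 (ae_of_all _ fun t =>
          (ContinuousLinearMap.le_opNorm _ _).trans (by gcongr; exact hlin _; rfl))
      calc eLpNorm (R (n + 1) - p) 4 μ
          = eLpNorm (flow c (src (R n)) - flow c ((Ioo 0 t₁).indicator (F.app ∘ p))) 4 μ := by
            refine eLpNorm_congr_ae ?_
            filter_upwards [ae_restrict_of_ae_restrict_of_subset hJ0 hp1.eq] with t ht
            rw [hRs, Pi.sub_apply, Pi.sub_apply, ht]
        _ ≤ _ := eLpNorm_mono_measure _ (Measure.restrict_mono hJpos le_rfl)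
        _ ≤ _ := h1
        _ ≤ 2 * (1 / 4 * eLpNorm (R n - p) 4 μ) := by
            gcongr
            exact h3.trans (by gcongr)
        _ = 1 / 2 * eLpNorm (R n - p) 4 μ := by
            rw [← mul_assoc]
            congr 1
            rw [show (4 : ℝ≥0∞) = 2 * 2 by norm_num, one_div, one_div,
              ENNReal.mul_inv (by simp) (by simp), ← mul_assoc,
              ENNReal.mul_inv_cancel (by simp) (by simp), one_mul]
        _ ≤ _ := by
            rw [pow_succ', mul_assoc]
            gcongr
  -- the bound on `∫ ‖R n‖²` over the window
  have : IsFiniteMeasure μ := ⟨by simp [hμ, hJ]⟩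
  set B : ℝ≥0∞ := 2 * eLpNorm p 4 μ * μ univ ^ (1 / (2 : ℝ) - 1 / 4) with hB
  have hBtop : B ≠ ⊤ := ENNReal.mul_ne_top (ENNReal.mul_ne_top (by simp) hpJ.2.ne)
    (ENNReal.rpow_ne_top_of_nonneg (by norm_num) (measure_ne_top _ _))
  have hR2 : ∀ n, MemLp (R n) 2 μ ∧ ∫ t, ‖R n t‖ ^ 2 ∂μ ≤ B.toReal ^ 2 := by
    intro n
    have h2 : MemLp (R n) 2 μ := (hRL n).mono_exponent (by norm_num)
    refine ⟨h2, integral_norm_sq_le h2 ENNReal.toReal_nonneg ?_⟩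
    rw [ENNReal.ofReal_toReal hBtop]
    have h3 := eLpNorm_le_eLpNorm_mul_rpow_measure_univ (μ := μ) (p := 2) (q := 4) (by norm_num) (hRL n).1
    simp only [ENNReal.toReal_ofNat] at h3
    refine h3.trans ?_
    rw [hB]
    gcongr
    calc eLpNorm (R n) 4 μ = eLpNorm ((R n - p) + p) 4 μ := by rw [sub_add_cancel]
      _ ≤ eLpNorm (R n - p) 4 μ + eLpNorm p 4 μ :=
          eLpNorm_add_le ((hRL n).sub hpJ).1 hpJ.1 (by norm_num)
      _ ≤ 1 * eLpNorm p 4 μ + eLpNorm p 4 μ := by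
          gcongr
          refine (hRp n).trans ?_
          gcongr
          exact pow_le_one₀ zero_le (by simp)
      _ = 2 * eLpNorm p 4 μ := by ring
  -- the square of the coefficient is integrable, with a small integral
  set a : ℝ → ℝ := fun t => F.α + F.Γ * (‖p t‖ ^ 2 + ‖p t‖ ^ 2) with ha
  have haL : MemLp a 2 μ := by
    refine ⟨aestronglyMeasurable_const.add (((hpJ.1.norm.pow 2).add (hpJ.1.norm.pow 2)).const_mul _), ?_⟩
    exact (F.eLpNorm_coefficient_le hpJ.1 hpJ.1).trans_lt (hwin.trans_lt (by simp))
  have ha2 : ∫ t, ‖a t‖ ^ 2 ∂μ ≤ 1 := by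
    have := integral_norm_sq_le haL zero_le_one
      ((F.eLpNorm_coefficient_le hpJ.1 hpJ.1).trans (hwin.trans (by simp)))
    simpa using this
  have hai : Integrable (fun t => ‖a t‖ ^ 2) μ := haL.integrable_norm_pow (by norm_num)
  set Y : ℝ := 2 * B.toReal ^ 2 with hY
  have hY0 : 0 ≤ Y := by positivity
  -- the weighted estimate reproduces the bound `Y`: one half comes from `∫ ‖R n‖²`, the other half
  -- from the source, since `∫ a² ≤ 1`
  have hbound : ∀ n, ∀ t ∈ J, (t - s) * ‖R n t‖ ^ 2 ≤ Y := by
    intro n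
    induction n with
    | zero => intro t _; simp [hR0, hY0]
    | succ n ih =>
      intro t ht
      have hts : s ≤ t := ht.1.le
      have hIJ : Ioo s t ⊆ J := Ioo_subset_Ioo_right ht.2.le
      have hf := hsrcL _ (hRL n)
      have hl := hf.locallyIntegrable one_le_four_thirds
      have hle : ∀ τ ∈ Ioo s t, (τ - s) * ‖src (R n) τ‖ ^ 2 ≤ Y * ‖a τ‖ ^ 2 := by
        intro τ hτ
        have h1 : ‖src (R n) τ‖ ≤ ‖a τ‖ * ‖R n τ‖ := by
          rw [hsrc]
          simp only
          rw [indicator_of_mem (hJ0 (hIJ hτ))]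
          simp only [hd, piecewise, mem_Iic, not_le.2 hτ.1, if_false]
          refine (ContinuousLinearMap.le_opNorm _ _).trans ?_
          gcongr
          exact (hlin _).trans (le_abs_self _)
        have h2 := ih τ (hIJ hτ)
        calc (τ - s) * ‖src (R n) τ‖ ^ 2 ≤ (τ - s) * (‖a τ‖ * ‖R n τ‖) ^ 2 := by
              have := sub_nonneg.2 hτ.1.le
              gcongr
          _ = ((τ - s) * ‖R n τ‖ ^ 2) * ‖a τ‖ ^ 2 := by ring
          _ ≤ _ := by gcongr
      have hia : IntegrableOn (fun τ => Y * ‖a τ‖ ^ 2) (Ioo s t) :=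
        (hai.const_mul Y).mono_measure (Measure.restrict_mono hIJ le_rfl)
      have hi : IntegrableOn (fun τ => (τ - s) * ‖src (R n) τ‖ ^ 2) (Ioo s t) := by
        refine Integrable.mono' hia ?_ ?_
        · exact (Continuous.aestronglyMeasurable (by fun_prop)).mul
            ((hl.aestronglyMeasurable.restrict).norm.pow 2)
        · rw [ae_restrict_iff' measurableSet_Ioo]
          refine ae_of_all _ fun τ hτ => ?_
          rw [Real.norm_of_nonneg (mul_nonneg (sub_nonneg.2 hτ.1.le) (by positivity))]
          exact hle τ hτ
      have hii : IntervalIntegrable (fun τ => (τ - s) * ‖src (R n) τ‖ ^ 2) volume s t := by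
        rwa [intervalIntegrable_iff_integrableOn_Ioo_of_le hts]
      have hmem := ae_memℓp_grad_heat hf hc
      rw [hRs]
      refine mul_norm_toEll_sq_le hY0 fun S => ?_
      have key := heat_weighted_le (c := c) hl hts hii S
      have hB1 : ∫ τ in s..t, ∑ k ∈ S, ‖grad (heat c (src (R n)) τ) k‖ ^ 2 ≤ B.toReal ^ 2 := by
        refine le_trans ?_ (hR2 (n + 1)).2
        rw [intervalIntegral.integral_of_le hts, integral_Ioc_eq_integral_Ioo]
        have h3 : Integrable (fun τ => ‖R (n + 1) τ‖ ^ 2) μ :=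
          (hR2 (n + 1)).1.integrable_norm_pow (by norm_num)
        refine le_trans ?_ (setIntegral_mono_set (s := Ioo s t) (t := J) (μ := volume) h3
          (ae_of_all _ fun τ => by positivity) (Filter.Eventually.of_forall hIJ))
        refine setIntegral_mono_ae_restrict ?_
          (h3.mono_measure (Measure.restrict_mono hIJ le_rfl)) ?_
        · simp_rw [norm_grad]
          exact (continuous_finsetSum _ fun k _ =>
            (continuous_const.mul (continuous_heat hl k).norm).pow 2).integrableOn_Icc.mono_set
              Ioo_subset_Icc_self
        · rw [Filter.EventuallyLE, ae_restrict_iff' measurableSet_Ioo]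
          filter_upwards [hmem] with τ h4 h5
          have h6 := sum_norm_sq_le (R (n + 1) τ) S
          rw [hRs] at h6 ⊢
          unfold flow at h6 ⊢
          simpa only [coe_toEll (h4 (hs.trans_lt h5.1))] using h6
      have hB2 : ∫ τ in s..t, (τ - s) * ‖src (R n) τ‖ ^ 2 ≤ Y := by
        rw [intervalIntegral.integral_of_le hts, integral_Ioc_eq_integral_Ioo]
        calc _ ≤ ∫ τ in Ioo s t, Y * ‖a τ‖ ^ 2 :=
              setIntegral_mono_on hi hia measurableSet_Ioo hle
          _ ≤ ∫ τ in J, Y * ‖a τ‖ ^ 2 := setIntegral_mono_set (hai.const_mul Y)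
              (ae_of_all _ fun τ => by positivity) (Filter.Eventually.of_forall hIJ)
          _ ≤ Y := by
              rw [integral_const_mul]
              exact mul_le_of_le_one_right hY0 ha2
      linarith
  have hlim : Filter.Tendsto (fun n => eLpNorm (R n - p) 4 μ) Filter.atTop (nhds 0) := by
    refine tendsto_of_tendsto_of_tendsto_of_le_of_le tendsto_const_nhds ?_ (fun _ => zero_le) hRp
    have h1 := ENNReal.Tendsto.mul_const (b := eLpNorm p 4 μ)
      (ENNReal.tendsto_pow_atTop_nhds_zero_of_lt_one (r := 1 / 2) (by simp))
      (Or.inr hpJ.2.ne)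
    simpa using h1
  obtain ⟨ns, -, hns⟩ := (tendstoInMeasure_of_tendsto_eLpNorm (by simp) (fun n => (hRL n).1)
    hpJ.1 hlim).exists_seq_tendsto_ae
  refine ⟨Y, ?_⟩
  rw [hμ, ae_restrict_iff' measurableSet_Ioo] at hns
  filter_upwards [hns] with t h1 h2
  have h3 : Filter.Tendsto (fun i => (t - s) * ‖R (ns i) t‖ ^ 2) Filter.atTop
      (nhds ((t - s) * ‖p t‖ ^ 2)) := ((h1 h2).norm.pow 2).const_mul _
  exact le_of_tendsto' h3 fun i => hbound _ t h2

/-- The gradient is essentially bounded on compact subsets of `(0, T)`. -/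
theorem CoeffSolution.exists_bound {F : Nonlinearity} {c : ℤ → ℂ} {T : ℝ} {p : ℝ → Ell2}
    (hc : Summable fun k => freq k * ‖c k‖ ^ 2) (hp : CoeffSolution F c (Ioo 0 T) p)
    {K : Set ℝ} (hK : IsCompact K) (hKT : K ⊆ Ioo 0 T) :
    ∃ M : ℝ, ∀ᵐ t, t ∈ K → ‖p t‖ ≤ M := by
  obtain ⟨δ, hδ, hwin⟩ := exists_window F hp.memLp hp.memLp
  refine hK.induction_on (p := fun S => ∃ M : ℝ, ∀ᵐ t, t ∈ S → ‖p t‖ ≤ M) ⟨0, by simp⟩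
    ?_ ?_ ?_
  · rintro S S' hSS' ⟨M, hM⟩
    exact ⟨M, hM.mono fun t h ht => h (hSS' ht)⟩
  · rintro S S' ⟨M, hM⟩ ⟨M', hM'⟩
    refine ⟨max M M', ?_⟩
    filter_upwards [hM, hM'] with t h h' ht
    rcases ht with ht | ht
    · exact (h ht).trans (le_max_left _ _)
    · exact (h' ht).trans (le_max_right _ _)
  · intro t₀ ht₀
    obtain ⟨h0, hT⟩ := hKT ht₀
    set s := max 0 (t₀ - δ / 2) with hs
    set t₁ := min T (t₀ + δ / 2) with ht₁
    have hst₀ : s < t₀ := max_lt h0 (by linarith)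
    have ht₀₁ : t₀ < t₁ := lt_min hT (by linarith)
    have hs0 : 0 ≤ s := le_max_left _ _
    have hw := hwin s t₁ (by
      have h1 : t₀ - δ / 2 ≤ s := le_max_right _ _
      have h2 : t₁ ≤ t₀ + δ / 2 := min_le_right _ _
      linarith)
    rw [inter_eq_right.2 (Ioo_subset_Ioo hs0 (min_le_left _ _))] at hw
    obtain ⟨Y, hY⟩ := hp.exists_window_bound hc hs0 (min_le_left _ _) hw
    set m := (s + t₀) / 2 with hm
    have hsm : s < m := by simp only [hm]; linarith
    have hmt : m < t₀ := by simp only [hm]; linarith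
    refine ⟨Ioo m t₁, mem_nhdsWithin_of_mem_nhds (Ioo_mem_nhds hmt ht₀₁), √(Y / (m - s)), ?_⟩
    filter_upwards [hY] with t h1 h2
    have h3 := h1 ⟨hsm.trans h2.1, h2.2⟩
    refine Real.le_sqrt_of_sq_le ?_
    rw [le_div_iff₀ (by linarith)]
    nlinarith [sq_nonneg ‖p t‖, h2.1]

/-! ### The periodic primitive -/

theorem volume_eq_haar : (volume : Measure 𝕋) = μ𝕋 := by
  rw [AddCircle.volume_eq_smul_haarAddCircle]; simp

theorem intervalIntegral_coe {E : Type*} [NormedAddCommGroup E] [NormedSpace ℝ E] (g : 𝕋 → E)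
    (a : ℝ) : ∫ s in a..a + 1, g s = ∫ x, g x ∂μ𝕋 := by
  rw [UnitAddCircle.intervalIntegral_preimage, volume_eq_haar]

theorem intervalIntegral_coe_zero {E : Type*} [NormedAddCommGroup E] [NormedSpace ℝ E]
    (g : 𝕋 → E) : ∫ s in (0 : ℝ)..1, g s = ∫ x, g x ∂μ𝕋 := by
  simpa using intervalIntegral_coe g 0

theorem intervalIntegrable_coe {E : Type*} [NormedAddCommGroup E] {g : 𝕋 → E}
    (hg : Integrable g μ𝕋) (a b : ℝ) : IntervalIntegrable (fun s : ℝ => g s) volume a b := by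
  have hper : Function.Periodic (fun s : ℝ => g s) 1 := fun s => by simp
  refine hper.intervalIntegrable₀ one_ne_zero ?_ a b
  rw [intervalIntegrable_iff_integrableOn_Ioc_of_le zero_le_one]
  have h1 := UnitAddCircle.measurePreserving_mk 0
  rw [volume_eq_haar, zero_add] at h1
  exact h1.integrable_comp_of_integrable hg

/-- The periodic primitive `∫₀ˣ g - x ∫ g` of an integrable function on the circle, as a function
of a real variable. -/
def primReal (g : 𝕋 → ℂ) (x : ℝ) : ℂ := (∫ s in (0 : ℝ)..x, g s) - x * ∫ y, g y ∂μ𝕋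

@[simp] theorem primReal_zero (g : 𝕋 → ℂ) : primReal g 0 = 0 := by simp [primReal]

@[simp] theorem primReal_one (g : 𝕋 → ℂ) : primReal g 1 = 0 := by
  simp [primReal, intervalIntegral_coe_zero]

theorem continuous_primReal {g : 𝕋 → ℂ} (hg : Integrable g μ𝕋) : Continuous (primReal g) := by
  have := intervalIntegral.continuous_primitive (fun a b => intervalIntegrable_coe hg a b) 0
  unfold primReal
  fun_prop

/-- The periodic primitive as a function on the circle. -/
def prim (g : 𝕋 → ℂ) : 𝕋 → ℂ := AddCircle.liftIco 1 0 (primReal g)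

theorem prim_coe (g : 𝕋 → ℂ) {x : ℝ} (hx : x ∈ Icc (0 : ℝ) 1) : prim g x = primReal g x := by
  rcases hx.2.eq_or_lt with rfl | h
  · have : ((1 : ℝ) : 𝕋) = ((0 : ℝ) : 𝕋) := by simp
    rw [this, prim, AddCircle.liftIco_zero_coe_apply (by simp)]
    simp
  · exact AddCircle.liftIco_zero_coe_apply ⟨hx.1, h⟩

theorem prim_zero (g : 𝕋 → ℂ) : prim g 0 = 0 := by
  have := prim_coe g (x := 0) (by simp)
  simpa using this

theorem continuous_prim {g : 𝕋 → ℂ} (hg : Integrable g μ𝕋) : Continuous (prim g) :=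
  AddCircle.liftIco_zero_continuous (by simp) (continuous_primReal hg).continuousOn

theorem exists_coe_eq (x : 𝕋) : ∃ y ∈ Icc (0 : ℝ) 1, (y : 𝕋) = x := by
  refine ⟨AddCircle.equivIco 1 0 x, ?_, AddCircle.coe_equivIco⟩
  have := (AddCircle.equivIco 1 0 x).2
  exact ⟨this.1, by linarith [this.2]⟩

theorem norm_prim_le {g : 𝕋 → ℂ} (hg : Integrable g μ𝕋) (x : 𝕋) :
    ‖prim g x‖ ≤ 2 * ∫ y, ‖g y‖ ∂μ𝕋 := by
  obtain ⟨y, hy, rfl⟩ := exists_coe_eq x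
  rw [prim_coe g hy, primReal, two_mul]
  refine (norm_sub_le _ _).trans (add_le_add ?_ ?_)
  · refine (intervalIntegral.norm_integral_le_integral_norm hy.1).trans ?_
    rw [← intervalIntegral_coe_zero]
    exact intervalIntegral.integral_mono_interval le_rfl hy.1 hy.2
      (ae_of_all _ fun _ => norm_nonneg _) (intervalIntegrable_coe hg.norm 0 1)
  · rw [norm_mul, Complex.norm_real, Real.norm_of_nonneg hy.1]
    exact (mul_le_of_le_one_left (norm_nonneg _) hy.2).trans (norm_integral_le_integral_norm _)

theorem prim_congr {g h : 𝕋 → ℂ} (hgh : g =ᵐ[μ𝕋] h) : prim g = prim h := by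
  have e : (fun s : ℝ => g s) =ᵐ[volume.restrict (Ioc 0 1)] fun s : ℝ => h s := by
    have h1 := UnitAddCircle.measurePreserving_mk 0
    rw [volume_eq_haar, zero_add] at h1
    exact h1.quasiMeasurePreserving.ae_eq_comp hgh
  funext x
  obtain ⟨y, hy, rfl⟩ := exists_coe_eq x
  rw [prim_coe g hy, prim_coe h hy, primReal, primReal, integral_congr_ae hgh]
  congr 1
  refine intervalIntegral.integral_congr_ae ?_
  rw [Filter.EventuallyEq, ae_restrict_iff' measurableSet_Ioc] at e
  filter_upwards [e] with s h1 h2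
  rw [uIoc_of_le hy.1] at h2
  exact h1 ⟨h2.1, h2.2.trans hy.2⟩

theorem prim_add {g h : 𝕋 → ℂ} (hg : Integrable g μ𝕋) (hh : Integrable h μ𝕋) :
    prim (fun x => g x + h x) = fun x => prim g x + prim h x := by
  funext x
  obtain ⟨y, hy, rfl⟩ := exists_coe_eq x
  simp only [prim_coe _ hy, primReal]
  rw [integral_add hg hh, intervalIntegral.integral_add (intervalIntegrable_coe hg _ _)
    (intervalIntegrable_coe hh _ _)]
  ring

theorem prim_smul (a : ℂ) (g : 𝕋 → ℂ) :
    prim (fun x => a * g x) = fun x => a * prim g x := by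
  funext x
  obtain ⟨y, hy, rfl⟩ := exists_coe_eq x
  simp only [prim_coe _ hy, primReal]
  rw [integral_const_mul, intervalIntegral.integral_const_mul]
  ring

theorem prim_ofReal (g : 𝕋 → ℝ) (x : 𝕋) :
    ((prim (fun x => (g x : ℂ)) x).re : ℂ) = prim (fun x => (g x : ℂ)) x := by
  obtain ⟨y, hy, rfl⟩ := exists_coe_eq x
  have h1 : ∫ z, (g z : ℂ) ∂μ𝕋 = ((∫ z, g z ∂μ𝕋 : ℝ) : ℂ) := integral_ofReal
  have h2 : ∫ s in (0 : ℝ)..y, (g s : ℂ) = ((∫ s in (0 : ℝ)..y, g s : ℝ) : ℂ) :=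
    intervalIntegral.integral_ofReal
  rw [prim_coe _ hy, primReal, h1, h2, ← Complex.ofReal_mul, ← Complex.ofReal_sub,
    Complex.ofReal_re]

/-- The Fourier coefficients of the periodic primitive. -/
theorem fourierCoeff_prim {g : 𝕋 → ℂ} (hg : Integrable g μ𝕋) {k : ℤ} (hk : k ≠ 0) :
    fourierCoeff (prim g) k = fourierCoeff g k / (2 * Real.pi * Complex.I * k) := by
  set m := ∫ y, g y ∂μ𝕋 with hm
  set w : ℂ := 2 * Real.pi * Complex.I * k with hw
  have hw0 : w ≠ 0 := by
    rw [hw]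
    simp [hk, Real.pi_ne_zero]
  have hder : ∀ x : ℝ, HasDerivAt (fun y : ℝ => fourier (-k) (y : 𝕋)) (-w * fourier (-k) (x : 𝕋)) x := by
    intro x
    have := hasDerivAt_fourier_neg 1 k x
    simpa [hw] using this
  have hcont : Continuous (fun y : ℝ => (fourier (-k) (y : 𝕋) : ℂ)) :=
    continuous_iff_continuousAt.2 fun x => (hder x).continuousAt
  have hprimE : ∀ x : ℝ, (-1 / w) + ∫ s in (0 : ℝ)..x, (fourier (-k) (s : 𝕋) : ℂ) =
      -1 / w * fourier (-k) (x : 𝕋) := by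
    intro x
    have h1 : ∀ s ∈ uIcc 0 x, HasDerivAt (fun y : ℝ => -1 / w * (fourier (-k) (y : 𝕋) : ℂ))
        (fourier (-k) (s : 𝕋)) s := fun s _ => by
      have := (hder s).const_mul (-1 / w)
      convert! this using 1
      field_simp
    rw [intervalIntegral.integral_eq_sub_of_hasDerivAt h1 (hcont.intervalIntegrable _ _)]
    have : ((0 : ℝ) : 𝕋) = 0 := rfl
    rw [this, fourier_eval_zero]
    ring
  have hg1 : IntervalIntegrable (fun s : ℝ => g s - m) volume 0 1 :=
    (intervalIntegrable_coe hg 0 1).sub intervalIntegrable_const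
  have hprimG : ∀ x : ℝ, (0 : ℂ) + ∫ s in (0 : ℝ)..x, (g s - m) = primReal g x := by
    intro x
    rw [intervalIntegral.integral_sub (intervalIntegrable_coe hg _ _) intervalIntegrable_const]
    simp [primReal, hm]
  have key := integral_primitive_mul zero_le_one 0 (-1 / w) hg1 (hcont.intervalIntegrable 0 1)
  simp_rw [hprimE, hprimG] at key
  have i1 : IntervalIntegrable (fun x : ℝ => (g x - m) * (-1 / w * fourier (-k) (x : 𝕋)))
      volume 0 1 := hg1.mul_continuousOn (by fun_prop)
  have i2 : IntervalIntegrable (fun x : ℝ => primReal g x * fourier (-k) (x : 𝕋)) volume 0 1 :=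
    ((continuous_primReal hg).mul hcont).intervalIntegrable _ _
  rw [primReal_one, zero_mul, zero_mul, sub_zero, intervalIntegral.integral_add i1 i2] at key
  have e1 : ∫ x in (0 : ℝ)..1, primReal g x * fourier (-k) (x : 𝕋) = fourierCoeff (prim g) k := by
    rw [fourierCoeff_eq_intervalIntegral _ _ 0]
    simp only [zero_add, div_one, one_smul]
    refine intervalIntegral.integral_congr fun x hx => ?_
    rw [uIcc_of_le zero_le_one] at hx
    rw [smul_eq_mul, prim_coe _ hx, mul_comm]
  have e2 : ∫ x in (0 : ℝ)..1, (g x - m) * (-1 / w * fourier (-k) (x : 𝕋)) =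
      -1 / w * fourierCoeff g k := by
    have e3 : ∀ x : ℝ, (g x - m) * (-1 / w * fourier (-k) (x : 𝕋)) =
      -1 / w * (fourier (-k) (x : 𝕋) * g x) - -1 / w * m * fourier (-k) (x : 𝕋) := fun x => by ring
    simp_rw [e3]
    have h1 : IntervalIntegrable (fun x : ℝ => (fourier (-k) (x : 𝕋) : ℂ) * g x) volume 0 1 :=
      (intervalIntegrable_coe hg 0 1).continuousOn_mul hcont.continuousOn
    rw [intervalIntegral.integral_sub (h1.const_mul _)
      ((hcont.intervalIntegrable 0 1).const_mul _), intervalIntegral.integral_const_mul,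
      intervalIntegral.integral_const_mul]
    have h2 := hprimE 1
    have h3 : ((1 : ℝ) : 𝕋) = 0 := by
      have := AddCircle.coe_period (1 : ℝ)
      exact this
    rw [h3, fourier_eval_zero] at h2
    have h4 : ∫ s in (0 : ℝ)..1, (fourier (-k) (s : 𝕋) : ℂ) = 0 := by linear_combination h2
    rw [h4, fourierCoeff_eq_intervalIntegral _ _ 0]
    simp
  rw [e1, e2] at key
  rw [div_eq_mul_inv]
  linear_combination key

/-! ### Fourier coefficients of integrable and of square integrable functions -/

/-- The isometry between `L²(𝕋)` and `ℓ²(ℤ)` given by the Fourier coefficients. -/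
def fourierEquiv : Lp ℂ 2 μ𝕋 ≃ₗᵢ[ℂ] Ell2 := fourierBasis.repr

theorem fourierEquiv_apply (f : Lp ℂ 2 μ𝕋) (k : ℤ) : fourierEquiv f k = fourierCoeff f k :=
  fourierBasis_repr f k

/-- The square integrable function with given Fourier coefficients. -/
def synth (p : Ell2) : 𝕋 → ℂ := (fourierEquiv.symm p : Lp ℂ 2 μ𝕋)

theorem memLp_synth (p : Ell2) : MemLp (synth p) 2 μ𝕋 := Lp.memLp _

theorem fourierCoeff_synth (p : Ell2) : fourierCoeff (synth p) = p := by
  funext k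
  rw [synth, ← fourierEquiv_apply, LinearIsometryEquiv.apply_symm_apply]

theorem fourierEquiv_toLp {g : 𝕋 → ℂ} (hg : MemLp g 2 μ𝕋) (k : ℤ) :
    fourierEquiv hg.toLp k = fourierCoeff g k := by
  rw [fourierEquiv_apply, fourierCoeff_congr_ae hg.coeFn_toLp]

theorem coe_fourierEquiv_toLp {g : 𝕋 → ℂ} (hg : MemLp g 2 μ𝕋) :
    (fourierEquiv hg.toLp : ℤ → ℂ) = fourierCoeff g :=
  funext (fourierEquiv_toLp hg)

theorem memℓp_fourierCoeff {g : 𝕋 → ℂ} (hg : MemLp g 2 μ𝕋) : Memℓp (fourierCoeff g) 2 := by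
  rw [← coe_fourierEquiv_toLp hg]
  exact lp.memℓp _

theorem toEll_fourierCoeff {g : 𝕋 → ℂ} (hg : MemLp g 2 μ𝕋) :
    toEll (fourierCoeff g) = fourierEquiv hg.toLp := by
  rw [← coe_fourierEquiv_toLp hg, toEll_coe]

theorem fourierCoeff_sub {f g : 𝕋 → ℂ} (hf : Integrable f μ𝕋) (hg : Integrable g μ𝕋) (k : ℤ) :
    fourierCoeff (fun x => f x - g x) k = fourierCoeff f k - fourierCoeff g k := by
  rw [fourierCoeff, fourierCoeff, fourierCoeff, ← integral_sub (hf.fourier_smul _)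
    (hg.fourier_smul _)]
  simp_rw [smul_sub]

theorem fourierCoeff_zero_eq (f : 𝕋 → ℂ) : fourierCoeff f 0 = ∫ x, f x ∂μ𝕋 := by
  simp [fourierCoeff]

theorem fourierCoeff_const (m : ℂ) {k : ℤ} (hk : k ≠ 0) :
    fourierCoeff (fun _ : 𝕋 => m) k = 0 := by
  have h := fourierCoeff_fourier (T := 1) 0
  have h1 : (fun _ : 𝕋 => m) = fun x => m * (fourier 0 : C(𝕋, ℂ)) x := by
    funext x; simp
  have h2 := congrFun h k
  rw [Pi.single_eq_of_ne hk] at h2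
  rw [h1, fourierCoeff.const_mul, h2, mul_zero]

theorem synth_ae_eq {g : 𝕋 → ℂ} (hg : MemLp g 2 μ𝕋) :
    synth (toEll (fourierCoeff g)) =ᵐ[μ𝕋] g := by
  rw [toEll_fourierCoeff hg, synth, LinearIsometryEquiv.symm_apply_apply]
  exact hg.coeFn_toLp

theorem ae_eq_of_fourierCoeff_eq_of_memLp {f g : 𝕋 → ℂ} (hf : MemLp f 2 μ𝕋) (hg : MemLp g 2 μ𝕋)
    (h : fourierCoeff f = fourierCoeff g) : f =ᵐ[μ𝕋] g := by
  refine (synth_ae_eq hf).symm.trans ?_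
  rw [h]
  exact synth_ae_eq hg

/-- Haar measure charges every nonempty open set. -/
theorem continuous_eq_of_ae_eq {f g : 𝕋 → ℂ} (hf : Continuous f) (hg : Continuous g)
    (h : f =ᵐ[μ𝕋] g) : f = g := by
  exact Continuous.ae_eq_iff_eq μ𝕋 hf hg |>.1 h

theorem memLp_of_continuous {g : 𝕋 → ℂ} (hg : Continuous g) (q : ℝ≥0∞) : MemLp g q μ𝕋 := by
  obtain ⟨C, hC⟩ := isCompact_univ.exists_bound_of_continuousOn hg.continuousOn
  exact MemLp.of_bound hg.aestronglyMeasurable C (ae_of_all _ fun x => hC x (mem_univ x))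

/-- An integrable function on the circle is determined by its Fourier coefficients: its periodic
primitive is continuous, hence determined by them. -/
theorem ae_eq_zero_of_fourierCoeff_eq_zero {g : 𝕋 → ℂ} (hg : Integrable g μ𝕋)
    (h : ∀ k, fourierCoeff g k = 0) : g =ᵐ[μ𝕋] 0 := by
  have hm : ∫ x, g x ∂μ𝕋 = 0 := by rw [← fourierCoeff_zero_eq, h]
  have hc := continuous_prim hg
  set c := ∫ x, prim g x ∂μ𝕋
  have h1 : prim g = fun _ => c := by
    refine continuous_eq_of_ae_eq hc continuous_const
      (ae_eq_of_fourierCoeff_eq_of_memLp (memLp_of_continuous hc 2) (memLp_const c) ?_)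
    funext k
    rcases eq_or_ne k 0 with rfl | hk
    · rw [fourierCoeff_zero_eq, fourierCoeff_zero_eq]
      simp [c]
    · rw [fourierCoeff_const _ hk, fourierCoeff_prim hg hk, h, zero_div]
  have h0 : ∀ y ∈ Icc (0 : ℝ) 1, ∫ s in (0 : ℝ)..y, g s = 0 := by
    intro y hy
    have h2 := prim_coe g hy
    rw [h1, ← congrFun h1 0, prim_zero, primReal, hm] at h2
    simpa using h2.symm
  have h3 := (intervalIntegrable_coe hg 0 1).ae_hasDerivAt_integral
  have h4 : ∀ᵐ s : ℝ ∂volume.restrict (Ioc 0 1), g s = 0 := by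
    rw [ae_restrict_iff' measurableSet_Ioc]
    have h5 : ∀ᵐ s : ℝ, s ≠ 1 := by simp [ae_iff]
    filter_upwards [h3, h5] with s hs hs1 hs2
    have h6 := hs (by rw [uIcc_of_le zero_le_one]; exact Ioc_subset_Icc_self hs2) 0
      (by simp)
    have h7 : (fun y => ∫ t in (0 : ℝ)..y, g t) =ᶠ[nhds s] fun _ => 0 := by
      filter_upwards [Icc_mem_nhds hs2.1 (lt_of_le_of_ne hs2.2 hs1)] with y hy using h0 y hy
    exact (h6.congr_of_eventuallyEq h7.symm).unique (hasDerivAt_const _ _)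
  have h8 := UnitAddCircle.measurePreserving_mk 0
  rw [volume_eq_haar, zero_add] at h8
  have h9 : NullMeasurableSet {x | ¬ g x = 0} μ𝕋 :=
    (nullMeasurableSet_eq_fun hg.1.aemeasurable aemeasurable_const).compl
  rw [Filter.EventuallyEq, ae_iff]
  exact (h8.measure_preimage h9).symm.trans (ae_iff.1 h4)

theorem ae_eq_of_fourierCoeff_eq {f g : 𝕋 → ℂ} (hf : Integrable f μ𝕋) (hg : Integrable g μ𝕋)
    (h : fourierCoeff f = fourierCoeff g) : f =ᵐ[μ𝕋] g := by
  have := ae_eq_zero_of_fourierCoeff_eq_zero (hf.sub hg) fun k => by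
    have := fourierCoeff_sub hf hg k
    rw [h, sub_self] at this
    exact this
  filter_upwards [this] with x hx using sub_eq_zero.1 hx

theorem memLp_two_of_memℓp {g : 𝕋 → ℂ} (hg : Integrable g μ𝕋) (h : Memℓp (fourierCoeff g) 2) :
    MemLp g 2 μ𝕋 := by
  refine (memLp_congr_ae ?_).1 (memLp_synth (toEll (fourierCoeff g)))
  refine ae_eq_of_fourierCoeff_eq ((memLp_synth _).integrable (by norm_num)) hg ?_
  rw [fourierCoeff_synth, coe_toEll h]

theorem integrable_mul_of_memLp {f g : 𝕋 → ℂ} (hf : MemLp f 2 μ𝕋) (hg : MemLp g 2 μ𝕋) :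
    Integrable (fun x => f x * g x) μ𝕋 :=
  hf.integrable_mul hg

/-- The Fourier coefficients of a product are the convolution of the Fourier coefficients. -/
theorem hasSum_fourierCoeff_mul {f g : 𝕋 → ℂ} (hf : MemLp f 2 μ𝕋) (hg : MemLp g 2 μ𝕋) (k : ℤ) :
    HasSum (fun j => fourierCoeff f j * fourierCoeff g (k - j))
      (fourierCoeff (fun x => f x * g x) k) := by
  have hx : MemLp (fun x => star (g x) * fourier k x) 2 μ𝕋 :=
    (memLp_of_continuous (fourier k).continuous ⊤).mul' (r := 2) hg.star
  have h := fourierBasis.hasSum_inner_mul_inner hx.toLp hf.toLp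
  have e1 : ∀ j, inner ℂ (fourierBasis j) hf.toLp = fourierCoeff f j := fun j => by
    rw [← fourierBasis.repr_apply_apply, fourierBasis_repr, fourierCoeff_congr_ae hf.coeFn_toLp]
  have e2 : ∀ j, inner ℂ hx.toLp (fourierBasis j) = fourierCoeff g (k - j) := fun j => by
    rw [L2.inner_def, coe_fourierBasis, fourierCoeff]
    refine integral_congr_ae ?_
    filter_upwards [coeFn_fourierLp (T := 1) 2 j, hx.coeFn_toLp] with x h1 h2
    rw [h1, h2, RCLike.inner_apply', map_mul, ← fourier_neg, neg_sub, sub_eq_add_neg, fourier_add,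
      smul_eq_mul]
    simp only [starRingEnd_apply, star_star]
    ring
  have e3 : inner ℂ hx.toLp hf.toLp = fourierCoeff (fun x => f x * g x) k := by
    rw [L2.inner_def, fourierCoeff]
    refine integral_congr_ae ?_
    filter_upwards [hf.coeFn_toLp, hx.coeFn_toLp] with x h1 h2
    rw [h1, h2, RCLike.inner_apply', map_mul, ← fourier_neg, smul_eq_mul]
    simp only [starRingEnd_apply, star_star]
    ring
  simp_rw [e1, e2, e3] at h
  refine h.congr_fun fun j => mul_comm _ _

/-! ### The nonlinearity of the limit system -/

section

set_option maxSynthPendingDepth 3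

/-- The nonlinearity `A p + B(p) p + G(p)(p) p` attached to a linear, a bilinear and a trilinear
map. -/
def Nonlinearity.ofMultilinear (A : Ell2 →L[ℂ] Ell2) (B : Ell2 →L[ℂ] Ell2 →L[ℂ] Ell2)
    (G : Ell2 →L[ℂ] Ell2 →L[ℂ] Ell2 →L[ℂ] Ell2) : Nonlinearity where
  lin p := A + B p + G p p
  α := ‖A‖₊ + ‖B‖₊
  Γ := ‖B‖₊ + 2 * ‖G‖₊
  continuous_lin := by fun_prop
  norm_lin_le p := by
    have h1 := B.le_opNorm p
    have h2 := (G p).le_opNorm p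
    have h3 := G.le_opNorm p
    have h4 := norm_add_le (A + B p) (G p p)
    have h5 := norm_add_le A (B p)
    have hB := norm_nonneg B
    have hG := norm_nonneg G
    have hp := norm_nonneg p
    have h6 : ‖G p p‖ ≤ ‖G‖ * ‖p‖ ^ 2 := by
      calc ‖G p p‖ ≤ ‖G p‖ * ‖p‖ := h2
        _ ≤ ‖G‖ * ‖p‖ * ‖p‖ := by gcongr
        _ = _ := by ring
    have h7 : ‖B p‖ ≤ ‖B‖ * (1 + ‖p‖ ^ 2) :=
      h1.trans (by gcongr; nlinarith [sq_nonneg (‖p‖ - 1)])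
    push_cast
    nlinarith [mul_nonneg hG (sq_nonneg ‖p‖)]
  norm_sub_le p q := by
    have hB := norm_nonneg B
    have hG := norm_nonneg G
    have hp := norm_nonneg p
    have hq := norm_nonneg q
    have hd := norm_nonneg (p - q)
    have e : (A + B p + G p p) p - (A + B q + G q q) q = A (p - q) + (B p (p - q) + B (p - q) q)
        + (G p p (p - q) + G p (p - q) q + G (p - q) q q) := by
      simp only [add_apply, map_sub, sub_apply]
      abel
    have b : ∀ x y, ‖B x y‖ ≤ ‖B‖ * ‖x‖ * ‖y‖ := fun x y => B.le_opNorm₂ x y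
    have g : ∀ x y z, ‖G x y z‖ ≤ ‖G‖ * ‖x‖ * ‖y‖ * ‖z‖ := fun x y z =>
      ((G x y).le_opNorm z).trans (by gcongr; exact G.le_opNorm₂ x y)
    rw [e]
    have h0 : ‖A (p - q) + (B p (p - q) + B (p - q) q)
        + (G p p (p - q) + G p (p - q) q + G (p - q) q q)‖ ≤ ‖A‖ * ‖p - q‖
        + (‖B‖ * ‖p‖ * ‖p - q‖ + ‖B‖ * ‖p - q‖ * ‖q‖) + (‖G‖ * ‖p‖ * ‖p‖ * ‖p - q‖ +
          ‖G‖ * ‖p‖ * ‖p - q‖ * ‖q‖ + ‖G‖ * ‖p - q‖ * ‖q‖ * ‖q‖) :=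
      norm_add_le_of_le (norm_add_le_of_le (A.le_opNorm _) (norm_add_le_of_le (b _ _) (b _ _)))
        (norm_add_le_of_le (norm_add_le_of_le (g _ _ _) (g _ _ _)) (g _ _ _))
    refine h0.trans ?_
    push_cast
    have h1 : ‖p‖ + ‖q‖ ≤ 1 + (‖p‖ ^ 2 + ‖q‖ ^ 2) := by
      nlinarith [sq_nonneg (‖p‖ - 1), sq_nonneg (‖q‖ - 1)]
    have h2 : ‖p‖ ^ 2 + ‖p‖ * ‖q‖ + ‖q‖ ^ 2 ≤ 2 * (‖p‖ ^ 2 + ‖q‖ ^ 2) := by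
      nlinarith [sq_nonneg (‖p‖ - ‖q‖)]
    calc _ = (‖A‖ + ‖B‖ * (‖p‖ + ‖q‖) + ‖G‖ * (‖p‖ ^ 2 + ‖p‖ * ‖q‖ + ‖q‖ ^ 2)) * ‖p - q‖ := by ring
      _ ≤ (‖A‖ + ‖B‖ * (1 + (‖p‖ ^ 2 + ‖q‖ ^ 2)) + ‖G‖ * (2 * (‖p‖ ^ 2 + ‖q‖ ^ 2))) * ‖p - q‖ := by
        gcongr
      _ = _ := by ring

/-- The product of two elements of `L²(𝕋)`. -/
def mulL2 : Lp ℂ 2 μ𝕋 →L[ℂ] Lp ℂ 2 μ𝕋 →L[ℂ] Lp ℂ 1 μ𝕋 :=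
  (ContinuousLinearMap.mul ℂ ℂ).holderL μ𝕋 2 2 1

theorem mulL2_ae (f g : Lp ℂ 2 μ𝕋) : mulL2 f g =ᵐ[μ𝕋] fun x => f x * g x :=
  (ContinuousLinearMap.mul ℂ ℂ).coeFn_holder f g

/-- The product of a continuous function and an element of `L²(𝕋)`. -/
def mulC : C(𝕋, ℂ) →L[ℂ] Lp ℂ 2 μ𝕋 →L[ℂ] Lp ℂ 2 μ𝕋 :=
  ((ContinuousLinearMap.mul ℂ ℂ).holderL μ𝕋 ∞ 2 2).comp (ContinuousMap.toLp ∞ μ𝕋 ℂ)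

theorem mulC_ae (f : C(𝕋, ℂ)) (g : Lp ℂ 2 μ𝕋) : mulC f g =ᵐ[μ𝕋] fun x => f x * g x := by
  refine ((ContinuousLinearMap.mul ℂ ℂ).coeFn_holder _ g).trans ?_
  filter_upwards [ContinuousMap.coeFn_toLp (𝕜 := ℂ) (p := ∞) μ𝕋 f] with x hx
  exact congrArg (fun a => a * g x) hx

theorem integrable_coe (g : Lp ℂ 1 μ𝕋) : Integrable g μ𝕋 := L1.integrable_coeFn g

/-- The periodic primitive, as an operator from `L¹(𝕋)` to the continuous functions. -/
def primC : Lp ℂ 1 μ𝕋 →L[ℂ] C(𝕋, ℂ) :=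
  LinearMap.mkContinuous
    { toFun := fun g => ⟨prim g, continuous_prim (integrable_coe g)⟩
      map_add' := fun f g => by
        ext x
        simp only [ContinuousMap.coe_mk, ContinuousMap.add_apply]
        rw [prim_congr (Lp.coeFn_add f g)]
        exact congrFun (prim_add (integrable_coe f) (integrable_coe g)) x
      map_smul' := fun a g => by
        ext x
        simp only [ContinuousMap.coe_mk, RingHom.id_apply, ContinuousMap.smul_apply, smul_eq_mul]
        rw [prim_congr (Lp.coeFn_smul a g)]
        exact congrFun (prim_smul a g) x } 2 (fun g => by
      rw [ContinuousMap.norm_le _ (by positivity), L1.norm_eq_integral_norm]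
      exact fun x => norm_prim_le (integrable_coe g) x)

theorem primC_apply (g : Lp ℂ 1 μ𝕋) (x : 𝕋) : primC g x = prim g x := rfl

/-- The projection of the continuous functions onto the functions of mean zero. -/
def subMean : C(𝕋, ℂ) →L[ℂ] C(𝕋, ℂ) :=
  LinearMap.mkContinuous
    { toFun := fun f => f - ContinuousMap.const _ (∫ x, f x ∂μ𝕋)
      map_add' := fun f g => by
        ext x
        simp only [ContinuousMap.sub_apply, ContinuousMap.add_apply, ContinuousMap.const_apply]
        rw [integral_add ((memLp_of_continuous f.continuous 1).integrable le_rfl)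
          ((memLp_of_continuous g.continuous 1).integrable le_rfl)]
        ring
      map_smul' := fun a g => by
        ext x
        simp only [ContinuousMap.sub_apply, ContinuousMap.smul_apply, ContinuousMap.const_apply,
          integral_smul, RingHom.id_apply, smul_sub] } 2 (fun f => by
      refine (norm_sub_le _ _).trans ?_
      have h : ‖ContinuousMap.const 𝕋 (∫ x, f x ∂μ𝕋)‖ ≤ ‖f‖ := by
        rw [ContinuousMap.norm_le _ (norm_nonneg _)]
        intro x
        have := norm_integral_le_of_norm_le_const (μ := μ𝕋) (ae_of_all _ fun y => f.norm_coe_le_norm y)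
        simpa using this
      change ‖f‖ + ‖ContinuousMap.const 𝕋 (∫ x, f x ∂μ𝕋)‖ ≤ _
      linarith)

theorem subMean_apply (f : C(𝕋, ℂ)) (x : 𝕋) : subMean f x = f x - ∫ y, f y ∂μ𝕋 := rfl

/-- The inclusion of the continuous functions in `L²(𝕋)`. -/
def incl : C(𝕋, ℂ) →L[ℂ] Lp ℂ 2 μ𝕋 := ContinuousMap.toLp 2 μ𝕋 ℂ

theorem incl_ae (f : C(𝕋, ℂ)) : incl f =ᵐ[μ𝕋] f := ContinuousMap.coeFn_toLp μ𝕋 f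

/-- The periodic primitive of mean zero of an element of `L²(𝕋)`. -/
def primMean : Lp ℂ 2 μ𝕋 →L[ℂ] C(𝕋, ℂ) :=
  subMean.comp (primC.comp (mulL2 (incl (ContinuousMap.const 𝕋 1))))

theorem primMean_apply (g : Lp ℂ 2 μ𝕋) (x : 𝕋) : primMean g x = prim g x - ∫ y, prim g y ∂μ𝕋 := by
  have h : mulL2 (incl (ContinuousMap.const 𝕋 1)) g =ᵐ[μ𝕋] g := by
    refine (mulL2_ae _ g).trans ?_
    filter_upwards [incl_ae (ContinuousMap.const 𝕋 1)] with x hx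
    rw [hx, ContinuousMap.const_apply, one_mul]
  simp only [primMean, ContinuousLinearMap.comp_apply, subMean_apply, primC_apply]
  rw [prim_congr h]

/-- An operator on `L²(𝕋)` as an operator on the Fourier coefficients. -/
def conjEll : (Lp ℂ 2 μ𝕋 →L[ℂ] Lp ℂ 2 μ𝕋) →L[ℂ] Ell2 →L[ℂ] Ell2 :=
  (ContinuousLinearMap.compL ℂ Ell2 (Lp ℂ 2 μ𝕋) Ell2
      fourierEquiv.toContinuousLinearEquiv.toContinuousLinearMap).comp
    ((ContinuousLinearMap.compL ℂ Ell2 (Lp ℂ 2 μ𝕋) (Lp ℂ 2 μ𝕋)).flip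
      fourierEquiv.symm.toContinuousLinearEquiv.toContinuousLinearMap)

theorem conjEll_apply (Q : Lp ℂ 2 μ𝕋 →L[ℂ] Lp ℂ 2 μ𝕋) (p : Ell2) :
    conjEll Q p = fourierEquiv (Q (fourierEquiv.symm p)) := rfl

/-- The inverse of `fourierEquiv`, as a continuous linear map. -/
def synthL : Ell2 →L[ℂ] Lp ℂ 2 μ𝕋 :=
  fourierEquiv.symm.toContinuousLinearEquiv.toContinuousLinearMap

theorem synthL_apply (p : Ell2) : synthL p = fourierEquiv.symm p := rfl

/-- The linear part of the nonlinearity. -/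
def linPart : Ell2 →L[ℂ] Ell2 := conjEll (incl.comp primMean)

/-- The part `(ζ - ∫ ζ) ∂ₓ ζ` of the nonlinearity. -/
def transportPart : Ell2 →L[ℂ] Ell2 →L[ℂ] Ell2 := conjEll.comp (mulC.comp (primMean.comp synthL))

/-- The nonlocal part `-v` of the nonlinearity. -/
def velocityPart : Ell2 →L[ℂ] Ell2 →L[ℂ] Ell2 :=
  conjEll.comp ((ContinuousLinearMap.compL ℂ _ _ _ (incl.comp primC)).comp (mulL2.comp synthL))

/-- The part `-v ∂ₓ ζ` of the nonlinearity. -/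
def cubicPart : Ell2 →L[ℂ] Ell2 →L[ℂ] Ell2 →L[ℂ] Ell2 :=
  (ContinuousLinearMap.compL ℂ _ _ _ (conjEll.comp (mulC.comp primC))).comp
    (((ContinuousLinearMap.compL ℂ Ell2 (Lp ℂ 2 μ𝕋) (Lp ℂ 1 μ𝕋)).flip synthL).comp
      (mulL2.comp synthL))

/-- The nonlinearity of the limit system, acting on the Fourier coefficients of `∂ₓ ζ`. -/
def nonlin (N : ℤ) : Nonlinearity :=
  Nonlinearity.ofMultilinear ((8 * Real.pi ^ 2 * N ^ 2 : ℂ) • linPart)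
    ((4 * Real.pi * N : ℂ) • transportPart + (2 * Real.pi * N : ℂ) • velocityPart) cubicPart

theorem nonlin_zero_α : (nonlin 0).α = 0 := by
  have : (4 * Real.pi * ((0 : ℤ) : ℂ)) • transportPart + (2 * Real.pi * ((0 : ℤ) : ℂ)) • velocityPart
      = 0 := by
    simp only [Int.cast_zero, mul_zero, zero_smul, add_zero]
  simp only [nonlin, Nonlinearity.ofMultilinear, this, nnnorm_zero, add_zero]
  simp

/-- The nonlinearity as a function of the derivative `g = ∂ₓ ζ`; the velocity is `-prim (g²)`. -/
def sourceFun (N : ℤ) (g : 𝕋 → ℂ) (x : 𝕋) : ℂ :=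
  8 * Real.pi ^ 2 * N ^ 2 * (prim g x - ∫ y, prim g y ∂μ𝕋)
    + 4 * Real.pi * N * ((prim g x - ∫ y, prim g y ∂μ𝕋) * g x)
    + 2 * Real.pi * N * prim (fun y => g y * g y) x + prim (fun y => g y * g y) x * g x

/-- The multilinear definition of `nonlin` agrees with the pointwise formula `sourceFun`. -/
theorem nonlin_app (N : ℤ) {g : 𝕋 → ℂ} (hg : MemLp g 2 μ𝕋) {p : Ell2} (hp : p = fourierCoeff g) :
    ((nonlin N).app p : ℤ → ℂ) = fourierCoeff (sourceFun N g) := by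
  obtain rfl : p = fourierEquiv hg.toLp := lp.ext (by rw [hp, coe_fourierEquiv_toLp])
  set f : Lp ℂ 2 μ𝕋 := hg.toLp with hf
  have hfg : f =ᵐ[μ𝕋] g := hg.coeFn_toLp
  have hz : ∀ x, primMean f x = prim g x - ∫ y, prim g y ∂μ𝕋 := fun x => by
    rw [primMean_apply, prim_congr hfg]
  have hu : ∀ x, primC (mulL2 f f) x = prim (fun y => g y * g y) x := fun x => by
    have : mulL2 f f =ᵐ[μ𝕋] fun y => g y * g y := by
      filter_upwards [mulL2_ae f f, hfg] with y h1 h2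
      rw [h1, h2]
    rw [primC_apply, prim_congr this]
  have e : (nonlin N).app (fourierEquiv f) = fourierEquiv
      ((8 * Real.pi ^ 2 * N ^ 2 : ℂ) • incl (primMean f) + (4 * Real.pi * N : ℂ) •
        mulC (primMean f) f + (2 * Real.pi * N : ℂ) • incl (primC (mulL2 f f)) +
        mulC (primC (mulL2 f f)) f) := by
    simp only [nonlin, Nonlinearity.ofMultilinear, Nonlinearity.app, linPart, transportPart,
      velocityPart, cubicPart, add_apply, smul_apply,
      ContinuousLinearMap.comp_apply, conjEll_apply, synthL_apply, ContinuousLinearMap.compL_apply,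
      LinearIsometryEquiv.symm_apply_apply, map_add, map_smul, ContinuousLinearMap.flip_apply]
    abel
  rw [e]
  funext k
  rw [fourierEquiv_apply]
  refine congrFun (fourierCoeff_congr_ae ?_) k
  refine (Lp.coeFn_add _ _).trans ?_
  filter_upwards [Lp.coeFn_add ((8 * Real.pi ^ 2 * N ^ 2 : ℂ) • incl (primMean f) +
    (4 * Real.pi * N : ℂ) • mulC (primMean f) f) ((2 * Real.pi * N : ℂ) • incl (primC (mulL2 f f))),
    Lp.coeFn_add ((8 * Real.pi ^ 2 * N ^ 2 : ℂ) • incl (primMean f))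
    ((4 * Real.pi * N : ℂ) • mulC (primMean f) f),
    Lp.coeFn_smul (8 * Real.pi ^ 2 * N ^ 2 : ℂ) (incl (primMean f)),
    Lp.coeFn_smul (4 * Real.pi * N : ℂ) (mulC (primMean f) f),
    Lp.coeFn_smul (2 * Real.pi * N : ℂ) (incl (primC (mulL2 f f))), incl_ae (primMean f),
    mulC_ae (primMean f) f, incl_ae (primC (mulL2 f f)), mulC_ae (primC (mulL2 f f)) f, hfg]
    with x h1 h2 h3 h4 h5 h6 h7 h8 h9 h10
  simp only [Pi.add_apply, Pi.smul_apply, h1, h2, h3, h4, h5, h6, h7, h8, h9, h10, hz, hu,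
    smul_eq_mul, sourceFun]

end

/-! ### Weights and convolutions of majorants -/

/-- The weight `1 + |k|`. -/
def wt (k : ℤ) : ℝ≥0∞ := 1 + (k.natAbs : ℝ≥0∞)

theorem one_le_wt (k : ℤ) : 1 ≤ wt k := le_self_add

theorem wt_ne_zero (k : ℤ) : wt k ≠ 0 := (zero_lt_one.trans_le (one_le_wt k)).ne'

theorem wt_ne_top (k : ℤ) : wt k ≠ ⊤ := by simp [wt]

theorem wt_eq_ofReal (k : ℤ) : wt k = ENNReal.ofReal (1 + |(k : ℝ)|) := by
  have h : |(k : ℝ)| = (k.natAbs : ℝ) := by rw [Nat.cast_natAbs, Int.cast_abs]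
  rw [wt, ENNReal.ofReal_add zero_le_one (abs_nonneg _), ENNReal.ofReal_one, h,
    ENNReal.ofReal_natCast]

theorem wt_neg (k : ℤ) : wt (-k) = wt k := by simp [wt]

theorem wt_le_add (j k : ℤ) : wt k ≤ wt j + wt (k - j) := by
  have : k.natAbs ≤ j.natAbs + (k - j).natAbs := by omega
  have h : (k.natAbs : ℝ≥0∞) ≤ j.natAbs + (k - j).natAbs := by exact_mod_cast this
  calc wt k ≤ 1 + (j.natAbs + (k - j).natAbs) := by unfold wt; gcongr
    _ ≤ 1 + (j.natAbs + (k - j).natAbs) + 1 := le_self_add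
    _ = _ := by unfold wt; ring

theorem wt_le_mul (j k : ℤ) : wt k ≤ wt j * wt (k - j) := by
  have : k.natAbs ≤ j.natAbs + (k - j).natAbs := by omega
  have h : (k.natAbs : ℝ≥0∞) ≤ j.natAbs + (k - j).natAbs := by exact_mod_cast this
  calc wt k ≤ 1 + (j.natAbs + (k - j).natAbs) := by unfold wt; gcongr
    _ ≤ 1 + (j.natAbs + (k - j).natAbs) + j.natAbs * (k - j).natAbs := le_self_add
    _ = _ := by unfold wt; ring

/-- The convolution of two nonnegative sequences. -/
def cnv (m n : ℤ → ℝ≥0∞) (k : ℤ) : ℝ≥0∞ := ∑' j, m j * n (k - j)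

theorem cnv_mono {m m' n n' : ℤ → ℝ≥0∞} (hm : ∀ k, m k ≤ m' k) (hn : ∀ k, n k ≤ n' k) (k : ℤ) :
    cnv m n k ≤ cnv m' n' k :=
  ENNReal.tsum_le_tsum fun j => mul_le_mul' (hm j) (hn _)

theorem tsum_cnv (m n : ℤ → ℝ≥0∞) : ∑' k, cnv m n k = (∑' k, m k) * ∑' k, n k := by
  unfold cnv
  rw [ENNReal.tsum_comm, ← ENNReal.tsum_mul_right]
  refine tsum_congr fun j => ?_
  rw [ENNReal.tsum_mul_left]
  congr 1
  exact (Equiv.subRight j).tsum_eq n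

/-- Weighted `ℓ¹` is an algebra under convolution, because the weight is submultiplicative. -/
theorem tsum_wt_cnv_le (r : ℕ) (m n : ℤ → ℝ≥0∞) :
    ∑' k, wt k ^ r * cnv m n k ≤ (∑' k, wt k ^ r * m k) * ∑' k, wt k ^ r * n k := by
  rw [← tsum_cnv]
  refine ENNReal.tsum_le_tsum fun k => ?_
  unfold cnv
  rw [← ENNReal.tsum_mul_left]
  refine ENNReal.tsum_le_tsum fun j => ?_
  calc wt k ^ r * (m j * n (k - j)) ≤ (wt j * wt (k - j)) ^ r * (m j * n (k - j)) := by
        gcongr; exact wt_le_mul j k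
    _ = _ := by ring

theorem cnv_const_left (a : ℝ≥0∞) (m n : ℤ → ℝ≥0∞) (k : ℤ) :
    cnv (fun j => a * m j) n k = a * cnv m n k := by
  unfold cnv
  rw [← ENNReal.tsum_mul_left]
  simp_rw [mul_assoc]

theorem cnv_const_right (a : ℝ≥0∞) (m n : ℤ → ℝ≥0∞) (k : ℤ) :
    cnv m (fun j => a * n j) k = a * cnv m n k := by
  unfold cnv
  rw [← ENNReal.tsum_mul_left]
  simp_rw [mul_left_comm]

theorem tsum_wt_rpow_lt_top {s : ℝ} (hs : 1 < s) : ∑' k, wt k ^ (-s) < ⊤ := by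
  have h := (Real.summable_one_div_int_add_rpow (1 / 2) s).2 hs
  refine lt_of_le_of_lt (ENNReal.tsum_le_tsum fun k => ?_) h.tsum_ofReal_lt_top
  have hk : 0 < |(k : ℝ) + 1 / 2| := by
    rw [abs_pos]
    intro h0
    have h1 : ((2 * k + 1 : ℤ) : ℝ) = 0 := by push_cast; linarith
    have h2 : (2 * k + 1 : ℤ) = 0 := by exact_mod_cast h1
    omega
  have hle : |(k : ℝ) + 1 / 2| ≤ 1 + |(k : ℝ)| := by
    refine (abs_add_le _ _).trans ?_
    norm_num
    linarith
  rw [wt_eq_ofReal, ENNReal.ofReal_rpow_of_pos (by positivity), Real.rpow_neg (by positivity),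
    one_div]
  gcongr

/-- The inverse of the weight. -/
def iw (k : ℤ) : ℝ≥0∞ := (wt k)⁻¹

theorem wt_mul_iw (k : ℤ) : wt k * iw k = 1 := ENNReal.mul_inv_cancel (wt_ne_zero k) (wt_ne_top k)

theorem iw_le_one (k : ℤ) : iw k ≤ 1 := ENNReal.inv_le_one.2 (one_le_wt k)

theorem iw_neg (k : ℤ) : iw (-k) = iw k := by rw [iw, iw, wt_neg]

theorem iw_rpow (k : ℤ) (s : ℝ) : iw k ^ s = wt k ^ (-s) := by
  rw [iw, ENNReal.inv_rpow, ENNReal.rpow_neg]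

theorem tsum_iw_rpow_lt_top {s : ℝ} (hs : 1 < s) : ∑' k, iw k ^ s < ⊤ := by
  simp_rw [iw_rpow]
  exact tsum_wt_rpow_lt_top hs

theorem tsum_iw_sq_lt_top : ∑' k, iw k ^ 2 < ⊤ := by
  have := tsum_iw_rpow_lt_top (s := 2) (by norm_num)
  simpa using this

theorem rpow_half_mul_le (a b : ℝ≥0∞) :
    a ^ (1 / 2 : ℝ) * b ≤ a ^ (3 / 2 : ℝ) + b ^ (3 / 2 : ℝ) := by
  have key : ∀ c : ℝ≥0∞, c ^ (1 / 2 : ℝ) * c = c ^ (3 / 2 : ℝ) := fun c => by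
    nth_rewrite 2 [← ENNReal.rpow_one c]
    rw [← ENNReal.rpow_add_of_nonneg _ _ (by norm_num) (by norm_num)]
    norm_num
  rcases le_total a b with h | h
  · calc a ^ (1 / 2 : ℝ) * b ≤ b ^ (1 / 2 : ℝ) * b := by gcongr
      _ = b ^ (3 / 2 : ℝ) := key b
      _ ≤ _ := le_add_self
  · calc a ^ (1 / 2 : ℝ) * b ≤ a ^ (1 / 2 : ℝ) * a := by gcongr
      _ = a ^ (3 / 2 : ℝ) := key a
      _ ≤ _ := le_self_add

/-- The convolution of `1 / (1 + |k|)` with itself is `O(|k|^{-1/2})`; the logarithmic loss is bounded by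
a power. -/
theorem cnv_iw_le (k : ℤ) : cnv iw iw k ≤ 4 * (∑' j, iw j ^ (3 / 2 : ℝ)) * iw k ^ (1 / 2 : ℝ) := by
  set S := ∑' j, iw j ^ (3 / 2 : ℝ) with hS
  have hS' : ∑' j, iw (k - j) ^ (3 / 2 : ℝ) = S :=
    (Equiv.subLeft k).tsum_eq fun j => iw j ^ (3 / 2 : ℝ)
  have hw : ∀ j, wt j ^ (1 / 2 : ℝ) * iw j = iw j ^ (1 / 2 : ℝ) := fun j => by
    rw [iw_rpow, iw, ← ENNReal.rpow_neg_one, ← ENNReal.rpow_add _ _ (wt_ne_zero j) (wt_ne_top j)]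
    norm_num
  have h1 : wt k ^ (1 / 2 : ℝ) * cnv iw iw k ≤ 4 * S := by
    have : ∀ j, wt k ^ (1 / 2 : ℝ) * (iw j * iw (k - j)) ≤
        2 * (iw j ^ (3 / 2 : ℝ) + iw (k - j) ^ (3 / 2 : ℝ)) := fun j => by
      calc wt k ^ (1 / 2 : ℝ) * (iw j * iw (k - j))
          ≤ (wt j + wt (k - j)) ^ (1 / 2 : ℝ) * (iw j * iw (k - j)) := by
            gcongr; exact wt_le_add j k
        _ ≤ (wt j ^ (1 / 2 : ℝ) + wt (k - j) ^ (1 / 2 : ℝ)) * (iw j * iw (k - j)) := by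
            gcongr; exact ENNReal.rpow_add_le_add_rpow _ _ (by norm_num) (by norm_num)
        _ = wt j ^ (1 / 2 : ℝ) * iw j * iw (k - j) +
            wt (k - j) ^ (1 / 2 : ℝ) * iw (k - j) * iw j := by ring
        _ = iw j ^ (1 / 2 : ℝ) * iw (k - j) + iw (k - j) ^ (1 / 2 : ℝ) * iw j := by
            rw [hw, hw]
        _ ≤ (iw j ^ (3 / 2 : ℝ) + iw (k - j) ^ (3 / 2 : ℝ)) +
            (iw (k - j) ^ (3 / 2 : ℝ) + iw j ^ (3 / 2 : ℝ)) :=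
            add_le_add (rpow_half_mul_le _ _) (rpow_half_mul_le _ _)
        _ = _ := by ring
    unfold cnv
    rw [← ENNReal.tsum_mul_left]
    refine (ENNReal.tsum_le_tsum this).trans_eq ?_
    rw [ENNReal.tsum_mul_left, ENNReal.tsum_add, hS']
    ring
  have h2 : iw k ^ (1 / 2 : ℝ) * wt k ^ (1 / 2 : ℝ) = 1 := by
    rw [← ENNReal.mul_rpow_of_nonneg _ _ (by norm_num), mul_comm, wt_mul_iw, ENNReal.one_rpow]
  calc cnv iw iw k = iw k ^ (1 / 2 : ℝ) * (wt k ^ (1 / 2 : ℝ) * cnv iw iw k) := by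
        rw [← mul_assoc, h2, one_mul]
    _ ≤ iw k ^ (1 / 2 : ℝ) * (4 * S) := by gcongr
    _ = _ := mul_comm _ _

/-- By symmetry, the pairing of `iw` with `v * iw` is the pairing of `v` with the bounded sequence
`iw * iw`. -/
theorem tsum_iw_mul_cnv_le (v : ℤ → ℝ≥0∞) :
    ∑' k, iw k * cnv v iw k ≤ 4 * (∑' j, iw j ^ (3 / 2 : ℝ)) * ∑' j, v j := by
  have e : ∑' k, iw k * cnv v iw k = ∑' j, v j * cnv iw iw j := by
    unfold cnv
    simp_rw [← ENNReal.tsum_mul_left]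
    rw [ENNReal.tsum_comm]
    refine tsum_congr fun j => tsum_congr fun k => ?_
    rw [← iw_neg (k - j), neg_sub]
    ring
  rw [e, ← ENNReal.tsum_mul_left]
  refine ENNReal.tsum_le_tsum fun j => ?_
  rw [mul_comm]
  gcongr
  refine (cnv_iw_le j).trans ?_
  refine mul_le_of_le_one_right' ?_
  exact ENNReal.rpow_le_one (iw_le_one j) (by norm_num)

/-! ### The nonlinearity in terms of the Fourier coefficients -/

/-- The convolution of two complex sequences. -/
def cv (a b : ℤ → ℂ) (k : ℤ) : ℂ := ∑' j, a j * b (k - j)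

/-- The Fourier coefficients of the primitive of mean zero. The coefficient at `k = 0` is zero
by division by zero. -/
def zc (a : ℤ → ℂ) (k : ℤ) : ℂ := a k / (2 * Real.pi * Complex.I * k)

theorem enorm_cv_le (a b : ℤ → ℂ) (k : ℤ) : ‖cv a b k‖ₑ ≤ cnv (‖a ·‖ₑ) (‖b ·‖ₑ) k := by
  unfold cv cnv
  refine enorm_tsum_le_tsum_enorm.trans (le_of_eq (tsum_congr fun j => enorm_mul _ _))

theorem one_add_abs_le_freq {k : ℤ} (hk : k ≠ 0) : 1 + |(k : ℝ)| ≤ freq k := by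
  have h1 : (1 : ℝ) ≤ |(k : ℝ)| := by exact_mod_cast Int.one_le_abs hk
  have := Real.pi_gt_three
  unfold freq
  nlinarith

theorem enorm_zc_le (a : ℤ → ℂ) (k : ℤ) : ‖zc a k‖ₑ ≤ iw k * ‖a k‖ₑ := by
  rcases eq_or_ne k 0 with rfl | hk
  · simp [zc]
  have h := one_add_abs_le_freq hk
  have hp : (0 : ℝ) < 1 + |(k : ℝ)| := by positivity
  rw [iw, wt_eq_ofReal, ← ENNReal.ofReal_inv_of_pos hp, ← ofReal_norm, ← ofReal_norm,
    ← ENNReal.ofReal_mul (by positivity)]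
  refine ENNReal.ofReal_le_ofReal ?_
  have e : ‖(2 * Real.pi * Complex.I * k : ℂ)‖ = freq k := by
    simp [freq, abs_of_pos Real.pi_pos]
  rw [zc, norm_div, e, div_eq_inv_mul]
  gcongr

/-- The Fourier coefficients of `prim (g²)`, where `g` has the Fourier coefficients `p`. -/
def velCoeff (p : Ell2) : ℤ → ℂ := fourierCoeff (prim fun y => synth p y * synth p y)

theorem integrable_synth_sq (p : Ell2) : Integrable (fun y => synth p y * synth p y) μ𝕋 :=
  integrable_mul_of_memLp (memLp_synth p) (memLp_synth p)

theorem fourierCoeff_synth_sq (p : Ell2) :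
    fourierCoeff (fun y => synth p y * synth p y) = cv p p := by
  funext k
  have h := (hasSum_fourierCoeff_mul (memLp_synth p) (memLp_synth p) k).tsum_eq
  rw [fourierCoeff_synth] at h
  exact h.symm

theorem velCoeff_of_ne (p : Ell2) {k : ℤ} (hk : k ≠ 0) : velCoeff p k = zc (cv p p) k := by
  rw [velCoeff, fourierCoeff_prim (integrable_synth_sq p) hk, fourierCoeff_synth_sq, zc]

theorem integral_norm_synth_sq (p : Ell2) :
    ∫ y, ‖synth p y * synth p y‖ ∂μ𝕋 = ‖p‖ ^ 2 := by
  have h := tsum_sq_fourierCoeff (fourierEquiv.symm p)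
  have e : fourierCoeff (fourierEquiv.symm p : 𝕋 → ℂ) = p := fourierCoeff_synth p
  rw [e, (hasSum_norm_sq p).tsum_eq] at h
  rw [h]
  refine integral_congr_ae (ae_of_all _ fun y => ?_)
  simp only [norm_mul, synth]
  ring

theorem norm_velCoeff_zero_le (p : Ell2) : ‖velCoeff p 0‖ ≤ 2 * ‖p‖ ^ 2 := by
  rw [velCoeff, fourierCoeff_zero_eq]
  refine (norm_integral_le_of_norm_le_const (ae_of_all _ fun y =>
    norm_prim_le (integrable_synth_sq p) y)).trans_eq ?_
  rw [integral_norm_synth_sq]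
  simp

/-- The mean of a primitive which vanishes at the origin: its Fourier series is absolutely convergent,
and is evaluated at `0`. -/
theorem velCoeff_zero (p : Ell2) (h : Summable (zc (cv p p))) :
    velCoeff p 0 = -∑' k, zc (cv p p) k := by
  set u : C(𝕋, ℂ) := ⟨prim fun y => synth p y * synth p y, continuous_prim (integrable_synth_sq p)⟩
    with hu
  have h1 : fourierCoeff u = Function.update (zc (cv p p)) 0 (velCoeff p 0) := by
    funext k
    rcases eq_or_ne k 0 with rfl | hk
    · rw [Function.update_self]; rfl
    · rw [Function.update_of_ne hk]; exact velCoeff_of_ne p hk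
  have h2 := h.hasSum.update 0 (velCoeff p 0)
  rw [← h1] at h2
  have h3 := has_pointwise_sum_fourier_series_of_summable h2.summable 0
  simp only [fourier_eval_zero, smul_eq_mul, mul_one] at h3
  have h4 := h2.unique h3
  have h5 : u 0 = 0 := prim_zero (fun y => synth p y * synth p y)
  have h6 : zc (cv p p) 0 = 0 := by simp [zc]
  rw [h5, h6] at h4
  linear_combination h4

/-- The nonlinearity as a sum of convolutions of Fourier coefficients. -/
theorem nonlin_apply (N : ℤ) (p : Ell2) (k : ℤ) :
    (nonlin N).app p k = 8 * Real.pi ^ 2 * N ^ 2 * zc p k + 4 * Real.pi * N * cv (zc p) p k +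
      2 * Real.pi * N * velCoeff p k + cv (velCoeff p) p k := by
  have hg := memLp_synth p
  set g := synth p with hgdef
  have hgp : fourierCoeff g = p := fourierCoeff_synth p
  have hgi : Integrable g μ𝕋 := hg.integrable (by norm_num)
  rw [nonlin_app N hg hgp.symm]
  set z : 𝕋 → ℂ := fun x => prim g x - ∫ y, prim g y ∂μ𝕋 with hz
  set u : 𝕋 → ℂ := prim (fun y => g y * g y) with hu
  have hzc : Continuous z := (continuous_prim hgi).sub continuous_const
  have huc : Continuous u := continuous_prim (integrable_synth_sq p)
  have hz2 := memLp_of_continuous hzc 2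
  have hu2 := memLp_of_continuous huc 2
  have hzk : fourierCoeff z = zc p := by
    funext k
    rw [hz, fourierCoeff_sub ((memLp_of_continuous (continuous_prim hgi) 1).integrable le_rfl)
      (integrable_const _)]
    rcases eq_or_ne k 0 with rfl | hk
    · simp [fourierCoeff_zero_eq, zc]
    · rw [fourierCoeff_const _ hk, fourierCoeff_prim hgi hk, hgp, zc, sub_zero]
  have h1 : Integrable z μ𝕋 := hz2.integrable (by norm_num)
  have h2 : Integrable (fun x => z x * g x) μ𝕋 := integrable_mul_of_memLp hz2 hg
  have h3 : Integrable u μ𝕋 := hu2.integrable (by norm_num)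
  have h4 : Integrable (fun x => u x * g x) μ𝕋 := integrable_mul_of_memLp hu2 hg
  have e : sourceFun N g = ((fun x => 8 * Real.pi ^ 2 * N ^ 2 * z x) +
      (fun x => 4 * Real.pi * N * (z x * g x)) + (fun x => 2 * Real.pi * N * u x)) +
      fun x => u x * g x := by
    funext x
    simp only [sourceFun, Pi.add_apply, hz, hu]
  rw [e, fourierCoeff.add (((h1.const_mul _).add (h2.const_mul _)).add (h3.const_mul _)) h4,
    fourierCoeff.add ((h1.const_mul _).add (h2.const_mul _)) (h3.const_mul _),
    fourierCoeff.add (h1.const_mul _) (h2.const_mul _)]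
  simp only [Pi.add_apply]
  rw [fourierCoeff.const_mul, fourierCoeff.const_mul, fourierCoeff.const_mul,
    ← (hasSum_fourierCoeff_mul hz2 hg k).tsum_eq, ← (hasSum_fourierCoeff_mul hu2 hg k).tsum_eq,
    hzk, hgp]
  rfl

/-- A majorant of the Fourier coefficients of the velocity, in terms of a majorant `m` of those of
the derivative and of a bound `L` at `k = 0`. -/
def velMaj (L : ℝ≥0∞) (m : ℤ → ℝ≥0∞) (k : ℤ) : ℝ≥0∞ :=
  iw k * cnv m m k + if k = 0 then L else 0

/-- A majorant of the nonlinearity, in terms of a majorant `m` of the derivative. -/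
def srcMaj (L : ℝ≥0∞) (m : ℤ → ℝ≥0∞) (k : ℤ) : ℝ≥0∞ :=
  iw k * m k + cnv (fun j => iw j * m j) m k + velMaj L m k + cnv (velMaj L m) m k

theorem enorm_velCoeff_le {L : ℝ≥0∞} {m : ℤ → ℝ≥0∞} {p : Ell2} (hm : ∀ k, ‖p k‖ₑ ≤ m k)
    (hL : 2 * ‖p‖ₑ ^ 2 ≤ L) (k : ℤ) : ‖velCoeff p k‖ₑ ≤ velMaj L m k := by
  rcases eq_or_ne k 0 with rfl | hk
  · refine le_trans ?_ le_add_self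
    rw [if_pos rfl]
    refine le_trans ?_ hL
    have := ENNReal.ofReal_le_ofReal (norm_velCoeff_zero_le p)
    rwa [ofReal_norm, ENNReal.ofReal_mul zero_le_two, ENNReal.ofReal_pow (norm_nonneg _),
      ofReal_norm, ENNReal.ofReal_ofNat] at this
  · rw [velCoeff_of_ne p hk]
    refine le_trans (enorm_zc_le _ k) (le_trans ?_ le_self_add)
    gcongr
    exact (enorm_cv_le _ _ k).trans (cnv_mono hm hm k)

/-- The constant in the bound of the nonlinearity by `srcMaj`. -/
def srcConst (N : ℤ) : ℝ≥0∞ :=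
  ‖(8 * Real.pi ^ 2 * N ^ 2 : ℂ)‖ₑ + ‖(4 * Real.pi * N : ℂ)‖ₑ + ‖(2 * Real.pi * N : ℂ)‖ₑ + 1

theorem srcConst_ne_top (N : ℤ) : srcConst N ≠ ⊤ := by
  simp only [srcConst, ne_eq, ENNReal.add_eq_top, enorm_ne_top, ENNReal.one_ne_top, or_self,
    not_false_eq_true]

theorem enorm_nonlin_le (N : ℤ) {L : ℝ≥0∞} {m : ℤ → ℝ≥0∞} {p : Ell2} (hm : ∀ k, ‖p k‖ₑ ≤ m k)
    (hL : 2 * ‖p‖ₑ ^ 2 ≤ L) (k : ℤ) : ‖(nonlin N).app p k‖ₑ ≤ srcConst N * srcMaj L m k := by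
  have hv := enorm_velCoeff_le hm hL
  have hz : ∀ k, ‖zc p k‖ₑ ≤ iw k * m k := fun k =>
    (enorm_zc_le _ k).trans (by gcongr; exact hm k)
  have h2 := (enorm_cv_le (zc p) p k).trans (cnv_mono hz hm k)
  have h4 := (enorm_cv_le (velCoeff p) p k).trans (cnv_mono hv hm k)
  rw [nonlin_apply]
  refine (enorm_add_le _ _).trans ?_
  refine (add_le_add_left ((enorm_add_le _ _).trans
    (add_le_add_left (enorm_add_le _ _) _)) _).trans ?_
  rw [enorm_mul, enorm_mul (4 * Real.pi * N : ℂ), enorm_mul (2 * Real.pi * N : ℂ)]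
  set A := ‖(8 * Real.pi ^ 2 * N ^ 2 : ℂ)‖ₑ with hA
  set B := ‖(4 * Real.pi * N : ℂ)‖ₑ with hB
  set D := ‖(2 * Real.pi * N : ℂ)‖ₑ with hD
  have hA' : A ≤ srcConst N := by rw [srcConst, add_assoc, add_assoc]; exact le_self_add
  have hB' : B ≤ srcConst N := by
    rw [srcConst, ← hA, ← hB, ← hD, add_comm A B, add_assoc, add_assoc]; exact le_self_add
  have hD' : D ≤ srcConst N := by
    rw [srcConst, ← hA, ← hB, ← hD, add_comm (A + B) D, add_assoc]; exact le_self_add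
  have h1' : 1 ≤ srcConst N := le_add_self
  calc _ ≤ srcConst N * (iw k * m k) + srcConst N * cnv (fun j => iw j * m j) m k +
        srcConst N * velMaj L m k + srcConst N * cnv (velMaj L m) m k :=
        add_le_add (add_le_add (add_le_add (mul_le_mul' hA' (hz k)) (mul_le_mul' hB' h2))
          (mul_le_mul' hD' (hv k))) (h4.trans (le_mul_of_one_le_left' h1'))
    _ = _ := by unfold srcMaj; ring

theorem tsum_wt_velMaj_lt_top {L : ℝ≥0∞} (hL : L ≠ ⊤) {m : ℤ → ℝ≥0∞} {r : ℕ}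
    (hm : ∑' k, wt k ^ r * m k < ⊤) : ∑' k, wt k ^ r * velMaj L m k < ⊤ := by
  have e : ∀ k, wt k ^ r * velMaj L m k ≤ wt k ^ r * cnv m m k + if k = 0 then L else 0 := by
    intro k
    rw [velMaj, mul_add]
    refine add_le_add ?_ ?_
    · gcongr
      exact mul_le_of_le_one_left' (iw_le_one k)
    · split_ifs with h
      · simp [h, wt]
      · simp
  refine (ENNReal.tsum_le_tsum e).trans_lt ?_
  rw [ENNReal.tsum_add, tsum_ite_eq]
  exact ENNReal.add_lt_top.2
    ⟨(tsum_wt_cnv_le r m m).trans_lt (ENNReal.mul_lt_top hm hm), hL.lt_top⟩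

/-- The Wiener algebras with polynomial weights are preserved by the nonlinearity. -/
theorem tsum_wt_srcMaj_lt_top {L : ℝ≥0∞} (hL : L ≠ ⊤) {m : ℤ → ℝ≥0∞} {r : ℕ}
    (hm : ∑' k, wt k ^ r * m k < ⊤) : ∑' k, wt k ^ r * srcMaj L m k < ⊤ := by
  have hv := tsum_wt_velMaj_lt_top hL hm
  have hz : ∑' k, wt k ^ r * (iw k * m k) < ⊤ := by
    refine (ENNReal.tsum_le_tsum fun k => ?_).trans_lt hm
    gcongr
    exact mul_le_of_le_one_left' (iw_le_one k)
  simp only [srcMaj, mul_add, ENNReal.tsum_add]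
  exact ENNReal.add_lt_top.2 ⟨ENNReal.add_lt_top.2 ⟨ENNReal.add_lt_top.2 ⟨hz,
    (tsum_wt_cnv_le r _ _).trans_lt (ENNReal.mul_lt_top hz hm)⟩, hv⟩,
    (tsum_wt_cnv_le r _ _).trans_lt (ENNReal.mul_lt_top hv hm)⟩

/-- The nonlinearity at coefficients decaying like `1 / |k|`. -/
theorem tsum_iw_srcMaj_lt_top {L : ℝ≥0∞} (hL : L ≠ ⊤) {B : ℝ≥0∞} (hB : B ≠ ⊤) :
    ∑' k, iw k * srcMaj L (fun j => B * iw j) k < ⊤ := by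
  set S := ∑' j, iw j ^ (3 / 2 : ℝ) with hS
  have hSt : S < ⊤ := tsum_iw_rpow_lt_top (by norm_num)
  have hz : ∑' k, iw k * (B * iw k) < ⊤ := by
    have : ∀ k, iw k * (B * iw k) = B * iw k ^ 2 := fun k => by ring
    simp_rw [this]
    rw [ENNReal.tsum_mul_left]
    exact ENNReal.mul_lt_top hB.lt_top tsum_iw_sq_lt_top
  have hv : ∑' k, velMaj L (fun j => B * iw j) k < ⊤ := by
    simp only [velMaj, ENNReal.tsum_add, tsum_ite_eq]
    refine ENNReal.add_lt_top.2 ⟨?_, hL.lt_top⟩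
    have : ∀ k, iw k * cnv (fun j => B * iw j) (fun j => B * iw j) k ≤
        B * (B * (4 * S)) * iw k ^ (3 / 2 : ℝ) := fun k => by
      rw [cnv_const_left, cnv_const_right]
      have e : iw k ^ (3 / 2 : ℝ) = iw k * iw k ^ (1 / 2 : ℝ) := by
        nth_rewrite 2 [← ENNReal.rpow_one (iw k)]
        rw [← ENNReal.rpow_add_of_nonneg _ _ (by norm_num) (by norm_num)]
        norm_num
      calc iw k * (B * (B * cnv iw iw k)) ≤ iw k * (B * (B * (4 * S * iw k ^ (1 / 2 : ℝ)))) := by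
            gcongr; exact cnv_iw_le k
        _ = _ := by rw [e]; ring
    refine (ENNReal.tsum_le_tsum this).trans_lt ?_
    rw [ENNReal.tsum_mul_left]
    exact ENNReal.mul_lt_top (ENNReal.mul_lt_top hB.lt_top (ENNReal.mul_lt_top hB.lt_top
      (ENNReal.mul_lt_top (by simp) hSt))) hSt
  have hc : ∀ v : ℤ → ℝ≥0∞, ∑' k, v k < ⊤ → ∑' k, iw k * cnv v (fun j => B * iw j) k < ⊤ := by
    intro v hv
    have : ∀ k, iw k * cnv v (fun j => B * iw j) k = B * (iw k * cnv v iw k) := fun k => by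
      rw [cnv_const_right]; ring
    simp_rw [this]
    rw [ENNReal.tsum_mul_left]
    exact ENNReal.mul_lt_top hB.lt_top ((tsum_iw_mul_cnv_le v).trans_lt
      (ENNReal.mul_lt_top (ENNReal.mul_lt_top (by simp) hSt) hv))
  simp only [srcMaj, mul_add, ENNReal.tsum_add]
  refine ENNReal.add_lt_top.2 ⟨ENNReal.add_lt_top.2 ⟨ENNReal.add_lt_top.2 ⟨?_, hc _ hz⟩, ?_⟩, hc _ hv⟩
  · exact (ENNReal.tsum_le_tsum fun k => mul_le_of_le_one_left' (iw_le_one k)).trans_lt hz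
  · exact (ENNReal.tsum_le_tsum fun k => mul_le_of_le_one_left' (iw_le_one k)).trans_lt hv

/-! ### Gain of regularity -/

/-- Parabolic smoothing of a single mode: a bounded source gains the factor `1 / l`, and the data at
time `t₀` decay exponentially. -/
theorem norm_duhamel_le {l : ℝ} (hl : 0 < l) {c : ℂ} {f : ℝ → ℂ} (hf : LocallyIntegrable f volume)
    {t₀ t M : ℝ} (h : t₀ ≤ t) (hM0 : 0 ≤ M) (hM : ∀ᵐ s, s ∈ Ioc t₀ t → ‖f s‖ ≤ M) :
    ‖duhamel l c f t‖ ≤ Real.exp (-(l * (t - t₀))) * ‖duhamel l c f t₀‖ + M / l := by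
  rw [duhamel_restart hf t₀ t]
  refine (norm_add_le _ _).trans (add_le_add ?_ ?_)
  · rw [norm_mul, Complex.norm_real, Real.norm_of_nonneg (Real.exp_pos _).le]
  · have hd : ∀ s ∈ uIcc t₀ t, HasDerivAt (fun s => M / l * Real.exp (-(l * (t - s))))
        (Real.exp (-(l * (t - s))) * M) s := fun s _ => by
      have h1 : HasDerivAt (fun s => -(l * (t - s))) l s := by
        have := (((hasDerivAt_id s).const_sub t).const_mul l).neg
        convert! this using 1
        simp
      convert! (h1.exp.const_mul (M / l)) using 1
      field_simp
    have hint : ∫ s in t₀..t, Real.exp (-(l * (t - s))) * M =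
        M / l - M / l * Real.exp (-(l * (t - t₀))) := by
      rw [intervalIntegral.integral_eq_sub_of_hasDerivAt hd
        (Continuous.intervalIntegrable (by fun_prop) _ _)]
      simp
    calc ‖∫ s in t₀..t, (Real.exp (-(l * (t - s))) : ℂ) * f s‖
        ≤ ∫ s in t₀..t, Real.exp (-(l * (t - s))) * M := by
          refine intervalIntegral.norm_integral_le_of_norm_le h ?_
            (Continuous.intervalIntegrable (by fun_prop) _ _)
          filter_upwards [hM] with s hs hs'
          rw [norm_mul, Complex.norm_real, Real.norm_of_nonneg (Real.exp_pos _).le]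
          exact mul_le_mul_of_nonneg_left (hs hs') (Real.exp_pos _).le
      _ ≤ M / l := by
          rw [hint]
          have : 0 ≤ M / l * Real.exp (-(l * (t - t₀))) := by positivity
          linarith

theorem norm_duhamel_le_add {l : ℝ} (hl : 0 ≤ l) {c : ℂ} {f : ℝ → ℂ}
    (hf : LocallyIntegrable f volume) {t : ℝ} (h : 0 ≤ t) :
    ‖duhamel l c f t‖ ≤ ‖c‖ + ∫ s in (0 : ℝ)..t, ‖f s‖ := by
  have e := duhamel_restart (l := l) (c := c) hf 0 t
  rw [duhamel_zero] at e
  rw [e]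
  refine (norm_add_le _ _).trans (add_le_add ?_ ?_)
  · rw [norm_mul, Complex.norm_real, Real.norm_of_nonneg (Real.exp_pos _).le]
    refine mul_le_of_le_one_left (norm_nonneg _) (Real.exp_le_one_iff.2 ?_)
    nlinarith
  · refine intervalIntegral.norm_integral_le_of_norm_le h ?_
      (intervalIntegrable_of_locallyIntegrable hf 0 t).norm
    refine ae_of_all _ fun s hs => ?_
    rw [norm_mul, Complex.norm_real, Real.norm_of_nonneg (Real.exp_pos _).le]
    refine mul_le_of_le_one_left (norm_nonneg _) (Real.exp_le_one_iff.2 ?_)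
    nlinarith [hs.2]

/-- The contribution of the data to the majorants, after the time `δ`. -/
def dataMaj (B δ : ℝ) (k : ℤ) : ℝ≥0∞ :=
  ENNReal.ofReal (freq k * (Real.exp (-(freq k ^ 2 * δ)) * B))

theorem tsum_wt_dataMaj_lt_top {B δ : ℝ} (hB : 0 ≤ B) (hδ : 0 < δ) (r : ℕ) :
    ∑' k, wt k ^ r * dataMaj B δ k < ⊤ := by
  set n := r + 3 with hn
  set C : ℝ := B * (n.factorial / δ ^ n) with hC
  have key : ∀ k, wt k ^ r * dataMaj B δ k ≤ ENNReal.ofReal C * iw k ^ 2 := by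
    intro k
    rcases eq_or_ne k 0 with rfl | hk
    · simp [dataMaj, freq]
    have h1 := one_add_abs_le_freq hk
    have h1' : 1 ≤ freq k := by linarith [abs_nonneg (k : ℝ)]
    have h2 : wt k ^ (r + 2) * dataMaj B δ k ≤ ENNReal.ofReal C := by
      rw [wt_eq_ofReal, dataMaj, ← ENNReal.ofReal_pow (by positivity),
        ← ENNReal.ofReal_mul (by positivity)]
      refine ENNReal.ofReal_le_ofReal ?_
      have h3 := Real.pow_div_factorial_le_exp (freq k ^ 2 * δ) (by positivity) n
      have h4 : freq k ^ n * Real.exp (-(freq k ^ 2 * δ)) ≤ n.factorial / δ ^ n := by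
        rw [Real.exp_neg, ← div_eq_mul_inv, div_le_div_iff₀ (Real.exp_pos _) (by positivity)]
        rw [div_le_iff₀ (by positivity)] at h3
        calc freq k ^ n * δ ^ n ≤ (freq k ^ 2) ^ n * δ ^ n := by
              gcongr; nlinarith
          _ = (freq k ^ 2 * δ) ^ n := by ring
          _ ≤ _ := h3.trans_eq (mul_comm _ _)
      calc (1 + |(k : ℝ)|) ^ (r + 2) * (freq k * (Real.exp (-(freq k ^ 2 * δ)) * B))
          ≤ freq k ^ (r + 2) * (freq k * (Real.exp (-(freq k ^ 2 * δ)) * B)) := by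
            have := freq_nonneg k
            gcongr
        _ = B * (freq k ^ n * Real.exp (-(freq k ^ 2 * δ))) := by rw [hn]; ring
        _ ≤ C := by rw [hC]; gcongr
    calc wt k ^ r * dataMaj B δ k
        = (wt k * iw k) ^ 2 * (wt k ^ r * dataMaj B δ k) := by rw [wt_mul_iw]; simp
      _ = wt k ^ (r + 2) * dataMaj B δ k * iw k ^ 2 := by ring
      _ ≤ _ := by gcongr
  refine (ENNReal.tsum_le_tsum key).trans_lt ?_
  rw [ENNReal.tsum_mul_left]
  exact ENNReal.mul_lt_top ENNReal.ofReal_lt_top tsum_iw_sq_lt_top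

theorem exists_bound_of_summable {c : ℤ → ℂ} (hc : Summable fun k => freq k * ‖c k‖ ^ 2) :
    ∃ B, 0 ≤ B ∧ ∀ k ≠ 0, ‖c k‖ ≤ B := by
  refine ⟨1 + ∑' k, freq k * ‖c k‖ ^ 2, ?_, fun k hk => ?_⟩
  · have : 0 ≤ ∑' k, freq k * ‖c k‖ ^ 2 :=
      tsum_nonneg fun k => mul_nonneg (freq_nonneg k) (sq_nonneg ‖c k‖)
    linarith
  · have h := hc.le_tsum k fun j _ => mul_nonneg (freq_nonneg j) (sq_nonneg ‖c j‖)
    have h1 := one_add_abs_le_freq hk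
    have h1' : 1 ≤ freq k := by linarith [abs_nonneg (k : ℝ)]
    have h2 : ‖c k‖ ^ 2 ≤ freq k * ‖c k‖ ^ 2 := le_mul_of_one_le_left (sq_nonneg _) h1'
    nlinarith [sq_nonneg (‖c k‖ - 1)]

section

variable {F : Nonlinearity} {c : ℤ → ℂ} {T : ℝ} {p : ℝ → Ell2}

/-- The source of a solution on `(0, T)`, extended by zero. -/
def src (F : Nonlinearity) (T : ℝ) (p : ℝ → Ell2) : ℝ → Ell2 := (Ioo 0 T).indicator (F.app ∘ p)

theorem src_apply {t : ℝ} (ht : t ∈ Ioo 0 T) : src F T p t = F.app (p t) :=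
  indicator_of_mem ht _

theorem CoeffSolution.memLp_src (hp : CoeffSolution F c (Ioo 0 T) p) :
    MemLp (src F T p) (4 / 3) volume :=
  memLp_source measurableSet_Ioo (ENNReal.mul_lt_top (by simp)
    (ENNReal.rpow_lt_top_of_nonneg (by norm_num) (by simp))) hp.memLp

theorem CoeffSolution.locallyIntegrable_src (hp : CoeffSolution F c (Ioo 0 T) p) :
    LocallyIntegrable (src F T p) volume :=
  hp.memLp_src.locallyIntegrable one_le_four_thirds

theorem CoeffSolution.ae_coe_eq (hc : Summable fun k => freq k * ‖c k‖ ^ 2)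
    (hp : CoeffSolution F c (Ioo 0 T) p) :
    ∀ᵐ t, t ∈ Ioo 0 T → (p t : ℤ → ℂ) = grad (heat c (src F T p) t) := by
  have h1 := hp.eq
  rw [Filter.EventuallyEq, ae_restrict_iff' measurableSet_Ioo] at h1
  filter_upwards [h1, ae_memℓp_grad_heat hp.memLp_src hc] with t h2 h3 ht
  rw [h2 ht, flow, coe_toEll]
  · rfl
  · exact h3 ht.1

theorem CoeffSolution.exists_heat_bound (hc : Summable fun k => freq k * ‖c k‖ ^ 2)
    (hp : CoeffSolution F c (Ioo 0 T) p) {a : ℝ} (ha : 0 ≤ a) :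
    ∃ B, 0 ≤ B ∧ ∀ k ≠ 0, ‖heat c (src F T p) a k‖ ≤ B := by
  obtain ⟨B, hB, hB'⟩ := exists_bound_of_summable hc
  have hl := hp.locallyIntegrable_src
  have hi : ∀ k, ∫ s in (0 : ℝ)..a, ‖src F T p s k‖ ≤ ∫ s in (0 : ℝ)..a, ‖src F T p s‖ := fun k =>
    intervalIntegral.integral_mono ha
      (intervalIntegrable_of_locallyIntegrable (locallyIntegrable_coord hl k) 0 a).norm
      (intervalIntegrable_of_locallyIntegrable hl 0 a).norm fun s => norm_coord_le _ k
  refine ⟨B + ∫ s in (0 : ℝ)..a, ‖src F T p s‖, ?_, fun k hk => ?_⟩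
  · have : 0 ≤ ∫ s in (0 : ℝ)..a, ‖src F T p s‖ :=
      intervalIntegral.integral_nonneg ha fun s _ => norm_nonneg _
    linarith
  · exact (norm_duhamel_le_add (sq_nonneg _) (locallyIntegrable_coord hl k) ha).trans
      (add_le_add (hB' k hk) (hi k))

/-- The gain of one derivative in the equation for `∂ₓ ζ`, in terms of majorants. -/
theorem CoeffSolution.exists_enorm_grad_le (hc : Summable fun k => freq k * ‖c k‖ ^ 2)
    (hp : CoeffSolution F c (Ioo 0 T) p) {a a' b : ℝ} (ha : 0 < a) (haa' : a < a') (hb : b < T) :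
    ∃ R : ℤ → ℝ≥0∞, (∀ r : ℕ, ∑' k, wt k ^ r * R k < ⊤) ∧ ∀ m : ℤ → ℝ≥0∞,
      (∀ᵐ s, s ∈ Icc a b → ∀ k, ‖F.app (p s) k‖ₑ ≤ m k) →
        ∀ t ∈ Icc a' b, ∀ k, ‖grad (heat c (src F T p) t) k‖ₑ ≤ R k + iw k * m k := by
  obtain ⟨B, hB, hB'⟩ := hp.exists_heat_bound hc ha.le
  refine ⟨dataMaj B (a' - a), tsum_wt_dataMaj_lt_top hB (sub_pos.2 haa'), fun m hm t ht k => ?_⟩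
  rcases eq_or_ne k 0 with rfl | hk
  · simp [grad]
  rcases eq_or_ne (m k) ⊤ with hmk | hmk
  · have : iw k ≠ 0 := by simp [iw, wt_ne_top]
    simp [hmk, ENNReal.mul_top this]
  have h1 := one_add_abs_le_freq hk
  have hk0 : (0 : ℝ) < 1 + |(k : ℝ)| := by positivity
  have hfr : 0 < freq k := by linarith
  have hl := locallyIntegrable_coord hp.locallyIntegrable_src k
  have hat : a ≤ t := haa'.le.trans ht.1
  have hbd : ∀ᵐ s, s ∈ Ioc a t → ‖src F T p s k‖ ≤ (m k).toReal := by
    filter_upwards [hm] with s hs hs'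
    have hsI : s ∈ Ioo 0 T := ⟨ha.trans hs'.1, (hs'.2.trans ht.2).trans_lt hb⟩
    rw [src_apply hsI]
    have := hs ⟨hs'.1.le, hs'.2.trans ht.2⟩ k
    rwa [← ofReal_norm, ENNReal.ofReal_le_iff_le_toReal hmk] at this
  have h2 := norm_duhamel_le (c := c k) (pow_pos hfr 2) hl hat ENNReal.toReal_nonneg hbd
  have h3 : ‖grad (heat c (src F T p) t) k‖ ≤
      freq k * (Real.exp (-(freq k ^ 2 * (a' - a))) * B) + (1 + |(k : ℝ)|)⁻¹ * (m k).toReal := by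
    rw [norm_grad]
    have h4 : Real.exp (-(freq k ^ 2 * (t - a))) * ‖duhamel (freq k ^ 2) (c k)
        (fun s => src F T p s k) a‖ ≤ Real.exp (-(freq k ^ 2 * (a' - a))) * B := by
      refine mul_le_mul (Real.exp_le_exp.2 ?_) (hB' k hk) (norm_nonneg _) (Real.exp_pos _).le
      nlinarith [mul_nonneg (sq_nonneg (freq k)) (sub_nonneg.2 ht.1)]
    have h5 : freq k * ((m k).toReal / freq k ^ 2) ≤ (1 + |(k : ℝ)|)⁻¹ * (m k).toReal := by
      have : freq k * ((m k).toReal / freq k ^ 2) = (freq k)⁻¹ * (m k).toReal := by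
        field_simp
      rw [this]
      gcongr
    calc freq k * ‖heat c (src F T p) t k‖
        ≤ freq k * (Real.exp (-(freq k ^ 2 * (a' - a))) * B + (m k).toReal / freq k ^ 2) :=
          mul_le_mul_of_nonneg_left (h2.trans (add_le_add h4 le_rfl)) hfr.le
      _ ≤ _ := by rw [mul_add]; exact add_le_add le_rfl h5
  rw [← ofReal_norm]
  refine (ENNReal.ofReal_le_ofReal h3).trans ?_
  rw [ENNReal.ofReal_add (by positivity) (by positivity),
    ENNReal.ofReal_mul (p := (1 + |(k : ℝ)|)⁻¹) (by positivity), ENNReal.ofReal_toReal hmk, ENNReal.ofReal_inv_of_pos hk0, ← wt_eq_ofReal]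
  rfl

end

section

variable {N : ℤ} {c : ℤ → ℂ} {T : ℝ} {p : ℝ → Ell2}

/-- Away from the initial time, the Fourier coefficients of `∂ₓ ζ` have majorants which are summable
against any power of the frequency. -/
theorem CoeffSolution.exists_majorant (hc : Summable fun k => freq k * ‖c k‖ ^ 2)
    (hp : CoeffSolution (nonlin N) c (Ioo 0 T) p) (r : ℕ) :
    ∀ a b : ℝ, 0 < a → b < T → ∃ m : ℤ → ℝ≥0∞, ∑' k, wt k ^ r * m k < ⊤ ∧
      ∀ t ∈ Icc a b, ∀ k, ‖grad (heat c (src (nonlin N) T p) t) k‖ₑ ≤ m k := by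
  have hae := hp.ae_coe_eq hc
  -- the bound of the nonlinearity resulting from a majorant
  have hsrc : ∀ a b : ℝ, 0 < a → b < T → ∃ L : ℝ≥0∞, L ≠ ⊤ ∧ ∀ m : ℤ → ℝ≥0∞,
      (∀ t ∈ Icc a b, ∀ k, ‖grad (heat c (src (nonlin N) T p) t) k‖ₑ ≤ m k) →
      ∀ᵐ s, s ∈ Icc a b → ∀ k, ‖(nonlin N).app (p s) k‖ₑ ≤ srcConst N * srcMaj L m k := by
    intro a b ha hb
    have hsub : Icc a b ⊆ Ioo 0 T := fun s hs => ⟨ha.trans_le hs.1, hs.2.trans_lt hb⟩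
    obtain ⟨M, hM⟩ := hp.exists_bound hc isCompact_Icc hsub
    refine ⟨2 * ENNReal.ofReal M ^ 2, by simp [ENNReal.mul_eq_top], fun m hm => ?_⟩
    filter_upwards [hM, hae] with s h1 h2 hs k
    refine enorm_nonlin_le N (fun k => ?_) ?_ k
    · rw [h2 (hsub hs)]; exact hm s hs k
    · rw [← ofReal_norm]
      gcongr
      exact h1 hs
  induction r with
  | zero =>
    intro a b ha hb
    have hsub : Icc (a / 4) b ⊆ Ioo 0 T := fun s hs =>
      ⟨(by linarith : 0 < a / 4).trans_le hs.1, hs.2.trans_lt hb⟩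
    obtain ⟨M, hM⟩ := hp.exists_bound hc isCompact_Icc hsub
    obtain ⟨R, hR, hR'⟩ := hp.exists_enorm_grad_le hc (a := a / 4) (a' := a / 2) (by linarith)
      (by linarith) hb
    -- the gradient is bounded in `ℓ²`, hence its coefficients are bounded, and so is the nonlinearity;
    -- a first gain gives coefficients `O(1 / |k|)`, a second one summable coefficients
    set K : ℝ≥0∞ := ENNReal.ofReal (((nonlin N).α + (nonlin N).Γ * M ^ 2) * M)
    have hK : ∀ᵐ s, s ∈ Icc (a / 4) b → ∀ k, ‖(nonlin N).app (p s) k‖ₑ ≤ K := by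
      filter_upwards [hM] with s h1 hs k
      rw [← ofReal_norm]
      refine ENNReal.ofReal_le_ofReal ((norm_coord_le _ k).trans ?_)
      refine (((nonlin N).lin (p s)).le_opNorm (p s)).trans ?_
      have h2 := (nonlin N).norm_lin_le (p s)
      have h3 := h1 hs
      refine mul_le_mul (h2.trans ?_) h3 (norm_nonneg _) (by positivity)
      gcongr
    have h1 := hR' (fun _ => K) hK
    set B : ℝ≥0∞ := (∑' k, wt k ^ 1 * R k) + K
    have hB : B ≠ ⊤ := ENNReal.add_ne_top.2 ⟨(hR 1).ne, ENNReal.ofReal_ne_top⟩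
    have h2 : ∀ t ∈ Icc (a / 2) b, ∀ k, ‖grad (heat c (src (nonlin N) T p) t) k‖ₑ ≤ B * iw k := by
      intro t ht k
      refine (h1 t ht k).trans ?_
      rw [add_mul, mul_comm (iw k)]
      gcongr
      calc R k = (wt k * iw k) * R k := by rw [wt_mul_iw, one_mul]
        _ = wt k ^ 1 * R k * iw k := by ring
        _ ≤ _ := by gcongr; exact ENNReal.le_tsum (f := fun k => wt k ^ 1 * R k) k
    obtain ⟨L, hL, hL'⟩ := hsrc (a / 2) b (by linarith) hb
    obtain ⟨R₂, hR₂, hR₂'⟩ := hp.exists_enorm_grad_le hc (a := a / 2) (a' := a) (by linarith)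
      (by linarith) hb
    refine ⟨_, ?_, hR₂' _ (hL' _ h2)⟩
    simp only [pow_zero, one_mul, ENNReal.tsum_add]
    refine ENNReal.add_lt_top.2 ⟨by simpa using hR₂ 0, ?_⟩
    simp_rw [mul_left_comm (iw _)]
    rw [ENNReal.tsum_mul_left]
    exact ENNReal.mul_lt_top (srcConst_ne_top N).lt_top (tsum_iw_srcMaj_lt_top hL hB)
  | succ r ih =>
    intro a b ha hb
    obtain ⟨m, hm, hm'⟩ := ih (a / 2) b (by linarith) hb
    obtain ⟨L, hL, hL'⟩ := hsrc (a / 2) b (by linarith) hb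
    obtain ⟨R, hR, hR'⟩ := hp.exists_enorm_grad_le hc (a := a / 2) (a' := a) (by linarith)
      (by linarith) hb
    refine ⟨_, ?_, hR' _ (hL' m hm')⟩
    simp only [mul_add, ENNReal.tsum_add]
    refine ENNReal.add_lt_top.2 ⟨hR _, ?_⟩
    have e : ∀ k, wt k ^ (r + 1) * (iw k * (srcConst N * srcMaj L m k)) =
        srcConst N * (wt k ^ r * srcMaj L m k) := fun k => by
      calc _ = (wt k * iw k) * (srcConst N * (wt k ^ r * srcMaj L m k)) := by ring
        _ = _ := by rw [wt_mul_iw, one_mul]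
    simp_rw [e]
    rw [ENNReal.tsum_mul_left]
    exact ENNReal.mul_lt_top (srcConst_ne_top N).lt_top (tsum_wt_srcMaj_lt_top hL hm)

end

/-! ### Smooth families of rapidly decreasing sequences -/

theorem summable_of_enorm_le {ι E : Type*} [NormedAddCommGroup E] [CompleteSpace E] {f : ι → E}
    {m : ι → ℝ≥0∞} (hm : ∑' i, m i ≠ ⊤) (h : ∀ i, ‖f i‖ₑ ≤ m i) : Summable f := by
  refine Summable.of_norm_bounded (ENNReal.summable_toReal hm) fun i => ?_
  have hi := ENNReal.ne_top_of_tsum_ne_top hm i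
  rw [← ENNReal.ofReal_le_iff_le_toReal hi, ofReal_norm]
  exact h i

theorem norm_le_toReal_of_enorm_le {E : Type*} [NormedAddCommGroup E] {x : E} {m : ℝ≥0∞}
    (hm : m ≠ ⊤) (h : ‖x‖ₑ ≤ m) : ‖x‖ ≤ m.toReal := by
  rwa [← ENNReal.ofReal_le_iff_le_toReal hm, ofReal_norm]

/-- Termwise differentiation of a series, with majorants in `[0, ∞]`. -/
theorem hasDerivAt_tsum_of_enorm_le {ι : Type*} {g g' : ι → ℝ → ℂ} {α β : ℝ} {m m' : ι → ℝ≥0∞}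
    (hm : ∑' i, m i ≠ ⊤) (hm' : ∑' i, m' i ≠ ⊤) (h : ∀ s ∈ Icc α β, ∀ i, ‖g i s‖ₑ ≤ m i)
    (h' : ∀ s ∈ Icc α β, ∀ i, ‖g' i s‖ₑ ≤ m' i)
    (hd : ∀ s ∈ Icc α β, ∀ i, HasDerivAt (g i) (g' i s) s) {t : ℝ} (ht : t ∈ Ioo α β) :
    HasDerivAt (fun s => ∑' i, g i s) (∑' i, g' i t) t :=
  hasDerivAt_tsum_of_isPreconnected (ENNReal.summable_toReal hm') isOpen_Ioo isPreconnected_Ioo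
    (fun i s hs => hd s (Ioo_subset_Icc_self hs) i)
    (fun i s hs => norm_le_toReal_of_enorm_le (ENNReal.ne_top_of_tsum_ne_top hm' i)
      (h' s (Ioo_subset_Icc_self hs) i)) ht
    (summable_of_enorm_le hm (h t (Ioo_subset_Icc_self ht))) ht

/-- The Weierstrass criterion, with majorants in `[0, ∞]`. -/
theorem continuousOn_tsum_of_enorm_le {ι X E : Type*} [TopologicalSpace X] [NormedAddCommGroup E]
    [CompleteSpace E] {g : ι → X → E} {S : Set X} {m : ι → ℝ≥0∞} (hm : ∑' i, m i ≠ ⊤)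
    (h : ∀ s ∈ S, ∀ i, ‖g i s‖ₑ ≤ m i) (hc : ∀ i, ContinuousOn (g i) S) :
    ContinuousOn (fun s => ∑' i, g i s) S :=
  continuousOn_tsum hc (ENNReal.summable_toReal hm) fun i s hs =>
    norm_le_toReal_of_enorm_le (ENNReal.ne_top_of_tsum_ne_top hm i) (h s hs i)

theorem exists_Icc_nhds {T t : ℝ} (ht : t ∈ Ioo 0 T) :
    ∃ α β, 0 < α ∧ β < T ∧ t ∈ Ioo α β ∧ Icc α β ⊆ Ioo 0 T := by
  refine ⟨t / 2, (t + T) / 2, by linarith [ht.1], by linarith [ht.2],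
    ⟨by linarith [ht.1], by linarith [ht.2]⟩, fun s hs => ⟨?_, ?_⟩⟩
  · linarith [ht.1, hs.1]
  · linarith [ht.2, hs.2]

/-- Families of sequences, continuous in time, and rapidly decreasing locally uniformly in
`(0, T)`. -/
structure Rapid (T : ℝ) (a : ℝ → ℤ → ℂ) : Prop where
  cont : ∀ k, ContinuousOn (fun t => a t k) (Ioo 0 T)
  maj : ∀ r : ℕ, ∀ α β : ℝ, 0 < α → β < T → ∃ m : ℤ → ℝ≥0∞, ∑' k, wt k ^ r * m k < ⊤ ∧
    ∀ t ∈ Icc α β, ∀ k, ‖a t k‖ₑ ≤ m k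

/-- Families of rapidly decreasing sequences which are `n` times continuously differentiable in
time, together with the decay. -/
def RapidC (T : ℝ) : ℕ → (ℝ → ℤ → ℂ) → Prop
  | 0, a => Rapid T a
  | n + 1, a => Rapid T a ∧ ∃ b, RapidC T n b ∧
      ∀ t ∈ Ioo 0 T, ∀ k, HasDerivAt (fun s => a s k) (b t k) t

variable {T : ℝ} {a b : ℝ → ℤ → ℂ} {n : ℕ}

theorem RapidC.rapid : ∀ {n : ℕ} {a : ℝ → ℤ → ℂ}, RapidC T n a → Rapid T a
  | 0, _, h => h
  | _ + 1, _, h => h.1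

theorem RapidC.of_succ : ∀ {n : ℕ} {a : ℝ → ℤ → ℂ}, RapidC T (n + 1) a → RapidC T n a
  | 0, _, h => h.1
  | _ + 1, _, ⟨h, b, hb, hd⟩ => ⟨h, b, hb.of_succ, hd⟩

theorem Rapid.congr (ha : Rapid T a) (h : ∀ t ∈ Ioo 0 T, a t = b t) : Rapid T b := by
  refine ⟨fun k => (ha.cont k).congr fun t ht => congrFun (h t ht).symm k, fun r α β hα hβ => ?_⟩
  obtain ⟨m, hm, hm'⟩ := ha.maj r α β hα hβ
  refine ⟨m, hm, fun t ht k => ?_⟩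
  rw [← h t ⟨hα.trans_le ht.1, ht.2.trans_lt hβ⟩]
  exact hm' t ht k

theorem RapidC.congr (ha : RapidC T n a) (h : ∀ t ∈ Ioo 0 T, a t = b t) : RapidC T n b := by
  cases n with
  | zero => exact Rapid.congr ha h
  | succ n =>
    obtain ⟨h0, a', ha', hd⟩ := ha
    refine ⟨h0.congr h, a', ha', fun t ht k => (hd t ht k).congr_of_eventuallyEq ?_⟩
    filter_upwards [isOpen_Ioo.mem_nhds ht] with s hs
    rw [h s hs]

theorem Rapid.add (ha : Rapid T a) (hb : Rapid T b) : Rapid T (fun t k => a t k + b t k) := by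
  refine ⟨fun k => (ha.cont k).add (hb.cont k), fun r α β hα hβ => ?_⟩
  obtain ⟨m, hm, hm'⟩ := ha.maj r α β hα hβ
  obtain ⟨m₂, hm₂, hm₂'⟩ := hb.maj r α β hα hβ
  refine ⟨fun k => m k + m₂ k, ?_, fun t ht k => (enorm_add_le _ _).trans
    (add_le_add (hm' t ht k) (hm₂' t ht k))⟩
  simp only [mul_add, ENNReal.tsum_add]
  exact ENNReal.add_lt_top.2 ⟨hm, hm₂⟩

theorem RapidC.add : ∀ {n : ℕ} {a b : ℝ → ℤ → ℂ}, RapidC T n a → RapidC T n b →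
    RapidC T n (fun t k => a t k + b t k)
  | 0, _, _, ha, hb => Rapid.add ha hb
  | _ + 1, _, _, ⟨h0, _, ha', hd⟩, ⟨h0', _, hb', hd'⟩ =>
    ⟨h0.add h0', _, ha'.add hb', fun t ht k => (hd t ht k).add (hd' t ht k)⟩

theorem Rapid.multiplier (ha : Rapid T a) {μ : ℤ → ℂ} {C : ℝ≥0} {d : ℕ}
    (hμ : ∀ k, ‖μ k‖ₑ ≤ C * wt k ^ d) : Rapid T (fun t k => μ k * a t k) := by
  refine ⟨fun k => continuousOn_const.mul (ha.cont k), fun r α β hα hβ => ?_⟩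
  obtain ⟨m, hm, hm'⟩ := ha.maj (r + d) α β hα hβ
  refine ⟨fun k => C * wt k ^ d * m k, ?_, fun t ht k => ?_⟩
  · have : ∀ k, wt k ^ r * (C * wt k ^ d * m k) = C * (wt k ^ (r + d) * m k) := fun k => by ring
    simp_rw [this]
    rw [ENNReal.tsum_mul_left]
    exact ENNReal.mul_lt_top ENNReal.coe_lt_top hm
  · rw [enorm_mul]
    exact mul_le_mul' (hμ k) (hm' t ht k)

/-- Multipliers of polynomial growth. -/
theorem RapidC.multiplier {μ : ℤ → ℂ} {C : ℝ≥0} {d : ℕ} (hμ : ∀ k, ‖μ k‖ₑ ≤ C * wt k ^ d) :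
    ∀ {n : ℕ} {a : ℝ → ℤ → ℂ}, RapidC T n a → RapidC T n (fun t k => μ k * a t k)
  | 0, _, ha => Rapid.multiplier ha hμ
  | _ + 1, _, ⟨h0, _, ha', hd⟩ =>
    ⟨h0.multiplier hμ, _, RapidC.multiplier hμ ha', fun t ht k => (hd t ht k).const_mul (μ k)⟩

theorem RapidC.const_mul (z : ℂ) (ha : RapidC T n a) : RapidC T n (fun t k => z * a t k) :=
  ha.multiplier (C := ‖z‖₊) (d := 0) fun k => by simp [enorm_eq_nnnorm]

theorem RapidC.zc (ha : RapidC T n a) : RapidC T n (fun t => zc (a t)) := by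
  have h : ∀ k, ‖((2 * Real.pi * Complex.I * (k : ℤ) : ℂ))⁻¹‖ₑ ≤ (1 : ℝ≥0) * wt k ^ 0 := fun k => by
    have := enorm_zc_le (fun _ => 1) k
    rw [LimitSystem.zc, one_div, enorm_one, mul_one] at this
    simpa using this.trans (iw_le_one k)
  refine (ha.multiplier h).congr fun t _ => ?_
  funext k
  rw [LimitSystem.zc, div_eq_inv_mul]

theorem enorm_two_pi_mul_le (k : ℤ) :
    ‖(2 * Real.pi * Complex.I * k : ℂ)‖ₑ ≤ (7 : ℝ≥0) * wt k ^ 1 := by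
  rw [wt_eq_ofReal, pow_one, ← ENNReal.ofReal_coe_nnreal, ← ENNReal.ofReal_mul (by positivity),
    ← ofReal_norm]
  refine ENNReal.ofReal_le_ofReal ?_
  have e : ‖(2 * Real.pi * Complex.I * k : ℂ)‖ = 2 * Real.pi * |(k : ℝ)| := by
    simp [abs_of_pos Real.pi_pos]
  rw [e]
  have := Real.pi_lt_d2
  have h2 := abs_nonneg (k : ℝ)
  push_cast
  nlinarith

theorem RapidC.grad (ha : RapidC T n a) : RapidC T n (fun t => grad (a t)) :=
  ha.multiplier enorm_two_pi_mul_le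

theorem Rapid.exists_maj (ha : Rapid T a) {α β : ℝ} (hα : 0 < α) (hβ : β < T) :
    ∃ m : ℤ → ℝ≥0∞, ∑' k, m k ≠ ⊤ ∧ ∀ t ∈ Icc α β, ∀ k, ‖a t k‖ₑ ≤ m k := by
  obtain ⟨m, hm, hm'⟩ := ha.maj 0 α β hα hβ
  exact ⟨m, by simpa using hm.ne, hm'⟩

theorem Rapid.summable (ha : Rapid T a) {t : ℝ} (ht : t ∈ Ioo 0 T) : Summable (a t) := by
  obtain ⟨m, hm, hm'⟩ := ha.exists_maj ht.1 ht.2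
  exact summable_of_enorm_le hm (hm' t ⟨le_rfl, le_rfl⟩)

theorem cnv_ne_top {m m' : ℤ → ℝ≥0∞} (hm : ∑' k, m k ≠ ⊤) (hm' : ∑' k, m' k ≠ ⊤) (k : ℤ) :
    cnv m m' k ≠ ⊤ := by
  refine ENNReal.ne_top_of_tsum_ne_top ?_ k
  rw [tsum_cnv]
  exact ENNReal.mul_ne_top hm hm'

theorem enorm_mul_le_of_le {x y : ℂ} {m m' : ℝ≥0∞} (hx : ‖x‖ₑ ≤ m) (hy : ‖y‖ₑ ≤ m') :
    ‖x * y‖ₑ ≤ m * m' := by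
  rw [enorm_mul]
  exact mul_le_mul' hx hy

theorem Rapid.cv (ha : Rapid T a) (hb : Rapid T b) : Rapid T (fun t => cv (a t) (b t)) := by
  refine ⟨fun k t ht => ?_, fun r α β hα hβ => ?_⟩
  · obtain ⟨α, β, hα, hβ, htI, hsub⟩ := exists_Icc_nhds ht
    obtain ⟨m, hm, hm'⟩ := ha.exists_maj hα hβ
    obtain ⟨m₂, hm₂, hm₂'⟩ := hb.exists_maj hα hβ
    have h := continuousOn_tsum_of_enorm_le (g := fun j s => a s j * b s (k - j)) (S := Icc α β)
      (cnv_ne_top hm hm₂ k) (fun s hs j => enorm_mul_le_of_le (hm' s hs j) (hm₂' s hs _))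
      fun j => ((ha.cont j).mono hsub).mul ((hb.cont _).mono hsub)
    exact (h.continuousAt (Icc_mem_nhds htI.1 htI.2)).continuousWithinAt
  · obtain ⟨m, hm, hm'⟩ := ha.maj r α β hα hβ
    obtain ⟨m₂, hm₂, hm₂'⟩ := hb.maj r α β hα hβ
    exact ⟨cnv m m₂, (tsum_wt_cnv_le r m m₂).trans_lt (ENNReal.mul_lt_top hm hm₂),
      fun t ht k => (enorm_cv_le _ _ k).trans (cnv_mono (hm' t ht) (hm₂' t ht) k)⟩

theorem RapidC.cv : ∀ {n : ℕ} {a b : ℝ → ℤ → ℂ}, RapidC T n a → RapidC T n b →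
    RapidC T n (fun t => cv (a t) (b t))
  | 0, _, _, ha, hb => Rapid.cv ha hb
  | n + 1, a, b, ha, hb => by
    obtain ⟨h0, a', ha', hd⟩ := id ha
    obtain ⟨h0', b', hb', hd'⟩ := id hb
    refine ⟨h0.cv h0', _, (ha'.cv hb.of_succ).add (ha.of_succ.cv hb'), fun t ht k => ?_⟩
    obtain ⟨α, β, hα, hβ, htI, hsub⟩ := exists_Icc_nhds ht
    obtain ⟨m, hm, hmb⟩ := h0.exists_maj hα hβ
    obtain ⟨m₂, hm₂, hmb₂⟩ := h0'.exists_maj hα hβ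
    obtain ⟨m', hm', hmb'⟩ := ha'.rapid.exists_maj hα hβ
    obtain ⟨m₂', hm₂', hmb₂'⟩ := hb'.rapid.exists_maj hα hβ
    have e1 : ∑' j, (m' j * m₂ (k - j) + m j * m₂' (k - j)) ≠ ⊤ := by
      rw [ENNReal.tsum_add]
      exact ENNReal.add_ne_top.2 ⟨cnv_ne_top hm' hm₂ k, cnv_ne_top hm hm₂' k⟩
    have h := hasDerivAt_tsum_of_enorm_le (g := fun j s => a s j * b s (k - j))
      (g' := fun j s => a' s j * b s (k - j) + a s j * b' s (k - j)) (cnv_ne_top hm hm₂ k) e1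
      (fun s hs j => enorm_mul_le_of_le (hmb s hs j) (hmb₂ s hs _))
      (fun s hs j => (enorm_add_le _ _).trans (add_le_add
        (enorm_mul_le_of_le (hmb' s hs j) (hmb₂ s hs _))
        (enorm_mul_le_of_le (hmb s hs j) (hmb₂' s hs _))))
      (fun s hs j => (hd s (hsub hs) j).mul (hd' s (hsub hs) _)) htI
    have htc := Ioo_subset_Icc_self htI
    rw [Summable.tsum_add
      (summable_of_enorm_le (cnv_ne_top hm' hm₂ k) fun j =>
        enorm_mul_le_of_le (hmb' t htc j) (hmb₂ t htc _))
      (summable_of_enorm_le (cnv_ne_top hm hm₂' k) fun j =>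
        enorm_mul_le_of_le (hmb t htc j) (hmb₂' t htc _))] at h
    exact h

/-- The sum of a sequence, placed at the frequency zero. -/
def total (a : ℤ → ℂ) (k : ℤ) : ℂ := if k = 0 then ∑' j, a j else 0

theorem Rapid.total (ha : Rapid T a) : Rapid T (fun t => total (a t)) := by
  refine ⟨fun k => ?_, fun r α β hα hβ => ?_⟩
  · unfold LimitSystem.total
    split_ifs
    · intro t ht
      obtain ⟨α, β, hα, hβ, htI, hsub⟩ := exists_Icc_nhds ht
      obtain ⟨m, hm, hm'⟩ := ha.exists_maj hα hβ
      have h := continuousOn_tsum_of_enorm_le (g := fun j s => a s j) (S := Icc α β) hm hm'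
        fun j => (ha.cont j).mono hsub
      exact (h.continuousAt (Icc_mem_nhds htI.1 htI.2)).continuousWithinAt
    · exact continuousOn_const
  · obtain ⟨m, hm, hm'⟩ := ha.exists_maj hα hβ
    refine ⟨fun k => if k = 0 then ∑' j, m j else 0, ?_, fun t ht k => ?_⟩
    · simp only [mul_ite, mul_zero, tsum_ite_eq]
      simpa [wt] using hm.lt_top
    · unfold LimitSystem.total
      beta_reduce
      split_ifs
      · exact enorm_tsum_le_tsum_enorm.trans (ENNReal.tsum_le_tsum (hm' t ht))
      · simp

theorem RapidC.total : ∀ {n : ℕ} {a : ℝ → ℤ → ℂ}, RapidC T n a →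
    RapidC T n (fun t => total (a t))
  | 0, _, ha => Rapid.total ha
  | n + 1, a, ⟨h0, a', ha', hd⟩ => by
    refine ⟨h0.total, _, ha'.total, fun t ht k => ?_⟩
    by_cases hk : k = 0
    · simp only [LimitSystem.total, hk, if_true]
      obtain ⟨α, β, hα, hβ, htI, hsub⟩ := exists_Icc_nhds ht
      obtain ⟨m, hm, hmb⟩ := h0.exists_maj hα hβ
      obtain ⟨m', hm', hmb'⟩ := ha'.rapid.exists_maj hα hβ
      exact hasDerivAt_tsum_of_enorm_le hm hm' hmb hmb' (fun s hs j => hd s (hsub hs) j) htI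
    · simp only [LimitSystem.total, hk, if_false]
      exact hasDerivAt_const _ _

/-! ### Smoothness of the Fourier series -/

/-- The Fourier series with coefficients depending on time. -/
def series (a : ℝ → ℤ → ℂ) (q : ℝ × ℝ) : ℂ :=
  ∑' k, a q.1 k * (fourier k (q.2 : UnitAddCircle) : ℂ)

theorem norm_fourier (k : ℤ) (x : UnitAddCircle) : ‖(fourier k x : ℂ)‖ = 1 := Circle.norm_coe _

theorem enorm_fourier (k : ℤ) (x : UnitAddCircle) : ‖(fourier k x : ℂ)‖ₑ = 1 := by
  rw [← ofReal_norm, norm_fourier, ENNReal.ofReal_one]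

theorem hasDerivAt_fourier_unit (k : ℤ) (x : ℝ) :
    HasDerivAt (fun y : ℝ => (fourier k (y : UnitAddCircle) : ℂ))
      (2 * Real.pi * Complex.I * k * fourier k (x : UnitAddCircle)) x := by
  have := hasDerivAt_fourier 1 k x
  simpa using this

/-- A Fourier series whose coefficients are rapidly decreasing, together with their time derivatives, may
be differentiated term by term. -/
theorem contDiffOn_series : ∀ (n : ℕ) (a : ℝ → ℤ → ℂ), RapidC T n a →
    ContDiffOn ℝ n (series a) (Ioo 0 T ×ˢ univ) := by
  have hopen : IsOpen (Ioo 0 T ×ˢ (univ : Set ℝ)) := isOpen_Ioo.prod isOpen_univ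
  intro n
  induction n with
  | zero =>
    intro a ha
    have ha : Rapid T a := ha
    rw [Nat.cast_zero, contDiffOn_zero]
    rintro ⟨t, x⟩ hq
    obtain ⟨α, β, hα, hβ, htI, hsub⟩ := exists_Icc_nhds hq.1
    obtain ⟨m, hm, hm'⟩ := ha.exists_maj hα hβ
    have h := continuousOn_tsum_of_enorm_le (S := Icc α β ×ˢ (univ : Set ℝ))
      (g := fun k (q : ℝ × ℝ) => a q.1 k * (fourier k (q.2 : UnitAddCircle) : ℂ)) hm
      (fun q hq k => by rw [enorm_mul, enorm_fourier, mul_one]; exact hm' _ hq.1 k)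
      fun k => (((ha.cont k).mono hsub).comp continuousOn_fst fun q hq => hq.1).mul (by fun_prop)
    exact (h.continuousAt (prod_mem_nhds (Icc_mem_nhds htI.1 htI.2)
      Filter.univ_mem)).continuousWithinAt
  | succ n ih =>
    intro a ha
    obtain ⟨h0, b, hb, hd⟩ := id ha
    have hg := ha.of_succ.grad
    set f' : ℝ × ℝ → (ℝ × ℝ →L[ℝ] ℂ) := fun q =>
      (ContinuousLinearMap.fst ℝ ℝ ℝ).smulRight (series b q) +
        (ContinuousLinearMap.snd ℝ ℝ ℝ).smulRight (series (fun t => grad (a t)) q) with hf'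
    have hder : ∀ q ∈ Ioo 0 T ×ˢ (univ : Set ℝ), HasFDerivAt (series a) (f' q) q := by
      rintro ⟨t, x⟩ hq
      obtain ⟨α, β, hα, hβ, htI, hsub⟩ := exists_Icc_nhds hq.1
      obtain ⟨m, hm, hmb⟩ := h0.exists_maj hα hβ
      obtain ⟨m₁, hm₁, hmb₁⟩ := hb.rapid.exists_maj hα hβ
      obtain ⟨m₂, hm₂, hmb₂⟩ := hg.rapid.exists_maj hα hβ
      set e : ℤ → ℝ × ℝ → ℂ := fun k q => (fourier k (q.2 : UnitAddCircle) : ℂ) with he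
      set G : ℤ → ℝ × ℝ → (ℝ × ℝ →L[ℝ] ℂ) := fun k q =>
        (ContinuousLinearMap.fst ℝ ℝ ℝ).smulRight (b q.1 k * e k q) +
          (ContinuousLinearMap.snd ℝ ℝ ℝ).smulRight (grad (a q.1) k * e k q) with hG
      have hGd : ∀ k (q : ℝ × ℝ), q ∈ Ioo α β ×ˢ (univ : Set ℝ) →
          HasFDerivAt (fun q : ℝ × ℝ => a q.1 k * e k q) (G k q) q := by
        rintro k ⟨s, y⟩ hsy
        have hs : HasFDerivAt (fun q : ℝ × ℝ => a q.1 k) _ (s, y) :=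
          HasFDerivAt.comp (f := Prod.fst) (g := fun s => a s k) (s, y)
            (hd s (hsub (Ioo_subset_Icc_self hsy.1)) k).hasFDerivAt hasFDerivAt_fst
        have hy : HasFDerivAt (fun q : ℝ × ℝ => e k q) _ (s, y) :=
          HasFDerivAt.comp (f := Prod.snd) (g := fun y : ℝ => (fourier k (y : UnitAddCircle) : ℂ))
            (s, y) (hasDerivAt_fourier_unit k y).hasFDerivAt hasFDerivAt_snd
        convert! hs.mul hy using 1
        ext <;> simp [hG, he, grad] <;> ring
      have hfst : ‖ContinuousLinearMap.fst ℝ ℝ ℝ‖ ≤ 1 := ContinuousLinearMap.norm_fst_le ..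
      have hsnd : ‖ContinuousLinearMap.snd ℝ ℝ ℝ‖ ≤ 1 := ContinuousLinearMap.norm_snd_le ..
      have hsum : ∑' k, (m₁ k + m₂ k) ≠ ⊤ := by
        rw [ENNReal.tsum_add]
        exact ENNReal.add_ne_top.2 ⟨hm₁, hm₂⟩
      have hGb : ∀ k (q : ℝ × ℝ), q ∈ Ioo α β ×ˢ (univ : Set ℝ) →
          ‖G k q‖ ≤ (m₁ k + m₂ k).toReal := by
        intro k q hq
        have hqc := Ioo_subset_Icc_self hq.1
        have t1 := ENNReal.ne_top_of_tsum_ne_top hm₁ k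
        have t2 := ENNReal.ne_top_of_tsum_ne_top hm₂ k
        rw [ENNReal.toReal_add t1 t2]
        have hek : ‖e k q‖ = 1 := norm_fourier _ _
        refine norm_add_le_of_le ?_ ?_
        · rw [ContinuousLinearMap.norm_smulRight_apply, norm_mul, hek, mul_one]
          exact (mul_le_of_le_one_left (norm_nonneg _) hfst).trans
            (norm_le_toReal_of_enorm_le t1 (hmb₁ _ hqc k))
        · rw [ContinuousLinearMap.norm_smulRight_apply, norm_mul, hek, mul_one]
          exact (mul_le_of_le_one_left (norm_nonneg _) hsnd).trans
            (norm_le_toReal_of_enorm_le t2 (hmb₂ _ hqc k))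
      have hmem : (t, x) ∈ Ioo α β ×ˢ (univ : Set ℝ) := ⟨htI, mem_univ _⟩
      have htc := Ioo_subset_Icc_self htI
      have hbd : ∀ (c : ℝ → ℤ → ℂ) (m : ℤ → ℝ≥0∞), ∑' k, m k ≠ ⊤ →
          (∀ s ∈ Icc α β, ∀ k, ‖c s k‖ₑ ≤ m k) → Summable fun k => c t k * e k (t, x) :=
        fun c m hm hmb => summable_of_enorm_le hm fun k => by
          rw [enorm_mul, enorm_fourier, mul_one]; exact hmb t htc k
      have key := hasFDerivAt_tsum_of_isPreconnected (ENNReal.summable_toReal hsum)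
        (isOpen_Ioo.prod isOpen_univ) (isPreconnected_Ioo.prod isPreconnected_univ) hGd hGb
        hmem (hbd a m hm hmb) hmem
      convert! key using 1
      have s1 := hbd b m₁ hm₁ hmb₁
      have s2 := hbd (fun t => grad (a t)) m₂ hm₂ hmb₂
      have h1 : HasSum (fun k => G k (t, x)) (f' (t, x)) := by
        have a1 := s1.hasSum.mapL
          (ContinuousLinearMap.smulRightL ℝ (ℝ × ℝ) ℂ (ContinuousLinearMap.fst ℝ ℝ ℝ))
        have a2 := s2.hasSum.mapL
          (ContinuousLinearMap.smulRightL ℝ (ℝ × ℝ) ℂ (ContinuousLinearMap.snd ℝ ℝ ℝ))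
        exact a1.add a2
      exact h1.tsum_eq.symm
    have hf'c : ContDiffOn ℝ n f' (Ioo 0 T ×ˢ univ) := by
      have a1 := (ContinuousLinearMap.smulRightL ℝ (ℝ × ℝ) ℂ
        (ContinuousLinearMap.fst ℝ ℝ ℝ)).contDiff.comp_contDiffOn (ih b hb)
      have a2 := (ContinuousLinearMap.smulRightL ℝ (ℝ × ℝ) ℂ
        (ContinuousLinearMap.snd ℝ ℝ ℝ)).contDiff.comp_contDiffOn (ih _ hg)
      exact a1.add a2
    rw [Nat.cast_succ, contDiffOn_succ_iff_fderiv_of_isOpen hopen]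
    refine ⟨fun q hq => (hder q hq).differentiableAt.differentiableWithinAt, by simp, ?_⟩
    exact hf'c.congr fun q hq => (hder q hq).fderiv

/-! ### Smoothness of the Fourier coefficients of the solutions -/

/-- The Fourier coefficients of `-v`, in terms of those of `∂ₓ ζ`: the coefficient at zero is
determined by `v(0) = 0`. -/
def velSeq (a : ℤ → ℂ) (k : ℤ) : ℂ := zc (cv a a) k + -1 * total (zc (cv a a)) k

/-- The nonlinearity in terms of the Fourier coefficients of `∂ₓ ζ`. -/
def srcSeq (N : ℤ) (a : ℤ → ℂ) (k : ℤ) : ℂ :=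
  8 * Real.pi ^ 2 * N ^ 2 * zc a k + 4 * Real.pi * N * cv (zc a) a k +
    2 * Real.pi * N * velSeq a k + cv (velSeq a) a k

theorem velCoeff_eq_velSeq {p : Ell2} (h : Summable (zc (cv p p))) : velCoeff p = velSeq p := by
  funext k
  rcases eq_or_ne k 0 with rfl | hk
  · rw [velCoeff_zero p h, velSeq, total, if_pos rfl]
    simp [zc]
  · rw [velCoeff_of_ne p hk, velSeq, total, if_neg hk, mul_zero, add_zero]

theorem nonlin_apply_eq_srcSeq (N : ℤ) {p : Ell2} (h : Summable (zc (cv p p))) (k : ℤ) :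
    (nonlin N).app p k = srcSeq N p k := by
  rw [nonlin_apply, velCoeff_eq_velSeq h, srcSeq]

theorem RapidC.velSeq {T : ℝ} {n : ℕ} {a : ℝ → ℤ → ℂ} (ha : RapidC T n a) :
    RapidC T n (fun t => velSeq (a t)) :=
  (ha.cv ha).zc.add ((ha.cv ha).zc.total.const_mul (-1))

theorem RapidC.srcSeq (N : ℤ) {T : ℝ} {n : ℕ} {a : ℝ → ℤ → ℂ} (ha : RapidC T n a) :
    RapidC T n (fun t => srcSeq N (a t)) :=
  (((ha.zc.const_mul _).add ((ha.zc.cv ha).const_mul _)).add (ha.velSeq.const_mul _)).add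
    (ha.velSeq.cv ha)

/-- Duhamel's formula with a source which is continuous up to a null set is differentiable, and solves
the equation pointwise. -/
theorem hasDerivAt_duhamel {l : ℝ} {c : ℂ} {f g : ℝ → ℂ} {T : ℝ}
    (hf : LocallyIntegrable f volume) (hg : ContinuousOn g (Ioo 0 T))
    (hfg : ∀ᵐ s, s ∈ Ioo 0 T → f s = g s) {t : ℝ} (ht : t ∈ Ioo 0 T) :
    HasDerivAt (duhamel l c f) (-l * duhamel l c f t + g t) t := by
  classical
  set f' : ℝ → ℂ := fun s => if s ∈ Ioo 0 T then g s else f s with hf'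
  have hff' : f =ᵐ[volume] f' := by
    filter_upwards [hfg] with s hs
    simp only [hf']
    split_ifs with h
    · exact hs h
    · rfl
  have hl' : LocallyIntegrable f' volume := fun x => (hf x).congr hff'
  have e : duhamel l c f = duhamel l c f' := by
    funext s
    unfold duhamel
    congr 2
    refine intervalIntegral.integral_congr_ae ?_
    filter_upwards [hff'] with r hr _
    rw [hr]
  have hf't : f' t = g t := by simp only [hf']; rw [if_pos ht]
  have hca : ContinuousAt f' t := by
    refine (hg.continuousAt (isOpen_Ioo.mem_nhds ht)).congr ?_
    filter_upwards [isOpen_Ioo.mem_nhds ht] with s hs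
    simp only [hf']; rw [if_pos hs]
  have hexp : HasDerivAt (fun s : ℝ => (Real.exp (-(l * s)) : ℂ)) (-l * Real.exp (-(l * t)) : ℝ) t := by
    have h1 : HasDerivAt (fun s : ℝ => -(l * s)) (-l) t := by
      have := ((hasDerivAt_id t).const_mul l).neg
      convert! this using 1
      simp
    have := h1.exp.ofReal_comp
    rwa [mul_comm] at this
  have hc2 : ContinuousAt (fun s => (Real.exp (l * s) : ℂ) * f' s) t :=
    ContinuousAt.mul (by fun_prop) hca
  have hint := intervalIntegral.integral_hasDerivAt_right (intervalIntegrable_exp_mul hl' l 0 t)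
    (AEStronglyMeasurable.stronglyMeasurableAtFilter
      (AEStronglyMeasurable.mul (Continuous.aestronglyMeasurable (by fun_prop))
        hl'.aestronglyMeasurable)) hc2
  have key := hexp.mul (hint.const_add c)
  rw [e]
  convert! key using 1
  have e1 : (Real.exp (-(l * t)) : ℂ) * Real.exp (l * t) = 1 := by
    rw [← Complex.ofReal_mul, ← Real.exp_add]
    simp
  rw [hf't, duhamel, Complex.ofReal_mul, Complex.ofReal_neg]
  linear_combination -g t * e1

variable {N : ℤ} {c : ℤ → ℂ} {T : ℝ} {p : ℝ → Ell2}

theorem CoeffSolution.rapid_grad (hc : Summable fun k => freq k * ‖c k‖ ^ 2)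
    (hp : CoeffSolution (nonlin N) c (Ioo 0 T) p) :
    Rapid T (fun t => grad (heat c (src (nonlin N) T p) t)) :=
  ⟨fun k => ((continuous_heat hp.locallyIntegrable_src k).const_mul _).continuousOn,
    fun r α β hα hβ => hp.exists_majorant hc r α β hα hβ⟩

theorem CoeffSolution.rapid (hc : Summable fun k => freq k * ‖c k‖ ^ 2)
    (hp : CoeffSolution (nonlin N) c (Ioo 0 T) p) :
    Rapid T (heat c (src (nonlin N) T p)) := by
  have hcont := fun k => continuous_heat (c := c) hp.locallyIntegrable_src k
  refine ⟨fun k => (hcont k).continuousOn, fun r α β hα hβ => ?_⟩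
  obtain ⟨m, hm, hm'⟩ := hp.exists_majorant hc r α β hα hβ
  obtain ⟨C, hC⟩ := isCompact_Icc.exists_bound_of_continuousOn (s := Icc α β) (hcont 0).continuousOn
  refine ⟨fun k => m k + if k = 0 then ENNReal.ofReal C else 0, ?_, fun t ht k => ?_⟩
  · simp only [mul_add, ENNReal.tsum_add, mul_ite, mul_zero, tsum_ite_eq]
    exact ENNReal.add_lt_top.2 ⟨hm, by simp [wt]⟩
  · rcases eq_or_ne k 0 with rfl | hk
    · beta_reduce
      rw [if_pos rfl, ← ofReal_norm]
      exact (ENNReal.ofReal_le_ofReal (hC t ht)).trans le_add_self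
    · refine le_trans ?_ le_self_add
      refine le_trans ?_ (hm' t ht k)
      rw [← ofReal_norm, ← ofReal_norm, norm_grad]
      refine ENNReal.ofReal_le_ofReal (le_mul_of_one_le_left (norm_nonneg _) ?_)
      have := one_add_abs_le_freq hk
      linarith [abs_nonneg (k : ℝ)]

theorem CoeffSolution.ae_src_eq (hc : Summable fun k => freq k * ‖c k‖ ^ 2)
    (hp : CoeffSolution (nonlin N) c (Ioo 0 T) p) :
    ∀ᵐ t, t ∈ Ioo 0 T → ∀ k, src (nonlin N) T p t k =
      srcSeq N (grad (heat c (src (nonlin N) T p) t)) k := by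
  have hr : RapidC T 0 _ := hp.rapid_grad hc
  filter_upwards [hp.ae_coe_eq hc] with t h1 ht k
  have h2 := (hr.cv hr).zc.rapid.summable ht
  rw [← h1 ht] at h2 ⊢
  rw [src_apply ht, nonlin_apply_eq_srcSeq N h2]

theorem CoeffSolution.hasDerivAt_heat (hc : Summable fun k => freq k * ‖c k‖ ^ 2)
    (hp : CoeffSolution (nonlin N) c (Ioo 0 T) p) {t : ℝ} (ht : t ∈ Ioo 0 T) (k : ℤ) :
    HasDerivAt (fun s => heat c (src (nonlin N) T p) s k)
      (-(freq k ^ 2 : ℝ) * heat c (src (nonlin N) T p) t k +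
        srcSeq N (grad (heat c (src (nonlin N) T p) t)) k) t := by
  have hr : RapidC T 0 _ := hp.rapid_grad hc
  refine hasDerivAt_duhamel (g := fun t => srcSeq N (grad (heat c (src (nonlin N) T p) t)) k)
    (locallyIntegrable_coord hp.locallyIntegrable_src k) ((hr.srcSeq N).rapid.cont k) ?_ ht
  filter_upwards [hp.ae_src_eq hc] with s hs hs' using hs hs' k

/-- The Fourier coefficients of a solution are smooth in time and rapidly decreasing, together with
all their derivatives. -/
theorem CoeffSolution.rapidC (hc : Summable fun k => freq k * ‖c k‖ ^ 2)
    (hp : CoeffSolution (nonlin N) c (Ioo 0 T) p) (n : ℕ) :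
    RapidC T n (heat c (src (nonlin N) T p)) := by
  induction n with
  | zero => exact hp.rapid hc
  | succ n ih =>
    have hlap : RapidC T n (fun t k => (-(freq k ^ 2 : ℝ) : ℂ) * heat c (src (nonlin N) T p) t k) := by
      refine (ih.grad.grad).congr fun t _ => ?_
      funext k
      simp only [grad]
      have : freq k ^ 2 = 4 * Real.pi ^ 2 * (k : ℝ) ^ 2 := by
        rw [freq, mul_pow, mul_pow, sq_abs]; ring
      rw [this]
      push_cast
      linear_combination (4 * Real.pi ^ 2 * (k : ℂ) ^ 2 * heat c (src (nonlin N) T p) t k) *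
        Complex.I_sq
    exact ⟨hp.rapid hc, _, hlap.add (ih.grad.srcSeq N), fun t ht k => hp.hasDerivAt_heat hc ht k⟩

/-- The function with the Fourier coefficients of a solution is smooth. -/
theorem CoeffSolution.contDiffOn (hc : Summable fun k => freq k * ‖c k‖ ^ 2)
    (hp : CoeffSolution (nonlin N) c (Ioo 0 T) p) :
    ContDiffOn ℝ ∞ (series (heat c (src (nonlin N) T p))) (Ioo 0 T ×ˢ univ) :=
  contDiffOn_infty.2 fun n => contDiffOn_series n _ (hp.rapidC hc n)

/-! ### Sobolev norms -/

theorem hsNorm_sq (s : ℝ) (a : ℤ → ℂ) :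
    hsNorm s a ^ 2 = ∑' k : ℤ, ENNReal.ofReal ((1 + (k : ℝ) ^ 2) ^ s) * ‖a k‖ₑ ^ 2 := by
  rw [hsNorm, ← ENNReal.rpow_natCast, ← ENNReal.rpow_mul]
  norm_num

theorem freq_sq (k : ℤ) : freq k ^ 2 = (2 * Real.pi) ^ 2 * (k : ℝ) ^ 2 := by
  rw [freq, mul_pow, sq_abs]

/-- The factor `7` is an upper bound of `2π`. -/
theorem freq_sq_le (k : ℤ) : freq k ^ 2 ≤ 7 ^ 2 * (1 + (k : ℝ) ^ 2) := by
  rw [freq_sq]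
  have h1 := Real.pi_lt_d2
  have h2 := Real.pi_pos
  have h3 : (2 * Real.pi) ^ 2 ≤ 7 ^ 2 := by gcongr; linarith
  calc (2 * Real.pi) ^ 2 * (k : ℝ) ^ 2 ≤ 7 ^ 2 * (k : ℝ) ^ 2 := by gcongr
    _ ≤ _ := by gcongr; linarith

theorem freq_le (k : ℤ) : freq k ≤ 7 * (1 + (k : ℝ) ^ 2) ^ (1 / 2 : ℝ) := by
  rw [← Real.sqrt_eq_rpow]
  refine abs_le_of_sq_le_sq' ?_ (by positivity) |>.2
  rw [mul_pow, Real.sq_sqrt (by positivity)]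
  exact freq_sq_le k

theorem tsum_enorm_grad_sq_le (a : ℤ → ℂ) :
    ∑' k, ‖grad a k‖ₑ ^ 2 ≤ 7 ^ 2 * hsNorm 1 a ^ 2 := by
  rw [hsNorm_sq, ← ENNReal.tsum_mul_left]
  refine ENNReal.tsum_le_tsum fun k => ?_
  rw [← ofReal_norm, norm_grad, ENNReal.ofReal_mul (freq_nonneg k), mul_pow, ofReal_norm,
    ← mul_assoc, ← ENNReal.ofReal_pow (freq_nonneg k), Real.rpow_one]
  gcongr
  have e : (7 : ℝ≥0∞) ^ 2 = ENNReal.ofReal (7 ^ 2) := by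
    rw [ENNReal.ofReal_pow (by norm_num), ENNReal.ofReal_ofNat]
  rw [e, ← ENNReal.ofReal_mul (by positivity)]
  exact ENNReal.ofReal_le_ofReal (freq_sq_le k)

theorem memℓp_grad_of_hsNorm {a : ℤ → ℂ} (h : hsNorm 1 a < ⊤) : Memℓp (grad a) 2 := by
  rw [memℓp_two_iff]
  exact (tsum_enorm_grad_sq_le a).trans_lt (ENNReal.mul_lt_top (by simp) (by simpa using h))

theorem enorm_toEll_grad_le (a : ℤ → ℂ) : ‖toEll (grad a)‖ₑ ≤ 7 * hsNorm 1 a := by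
  have h := (enorm_toEll_sq_le (grad a)).trans (tsum_enorm_grad_sq_le a)
  rw [← mul_pow] at h
  exact (ENNReal.pow_le_pow_left_iff two_ne_zero).1 h

theorem tsum_ofReal_freq_le (a : ℤ → ℂ) :
    ∑' k, ENNReal.ofReal (freq k * ‖a k‖ ^ 2) ≤ 7 * hsNorm (1 / 2) a ^ 2 := by
  rw [hsNorm_sq, ← ENNReal.tsum_mul_left]
  refine ENNReal.tsum_le_tsum fun k => ?_
  rw [ENNReal.ofReal_mul (freq_nonneg k), ENNReal.ofReal_pow (norm_nonneg _), ofReal_norm,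
    ← mul_assoc]
  gcongr
  rw [← ENNReal.ofReal_ofNat 7, ← ENNReal.ofReal_mul (by norm_num)]
  exact ENNReal.ofReal_le_ofReal (freq_le k)

theorem summable_of_hsNorm {a : ℤ → ℂ} (h : hsNorm (1 / 2) a < ⊤) :
    Summable fun k => freq k * ‖a k‖ ^ 2 := by
  have h1 := (tsum_ofReal_freq_le a).trans_lt (ENNReal.mul_lt_top (by simp) (by simpa using h))
  have h2 := ENNReal.summable_toReal h1.ne
  refine h2.congr fun k => ?_
  exact ENNReal.toReal_ofReal (mul_nonneg (freq_nonneg k) (sq_nonneg _))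

theorem tsum_freq_le {a : ℤ → ℂ} {η : ℝ} (h : hsNorm (1 / 2) a ≤ ENNReal.ofReal η) (hη : 0 ≤ η) :
    ∑' k, freq k * ‖a k‖ ^ 2 ≤ 7 * η ^ 2 := by
  have hs := summable_of_hsNorm (h.trans_lt ENNReal.ofReal_lt_top)
  rw [← ENNReal.ofReal_le_ofReal_iff (by positivity), ENNReal.ofReal_tsum_of_nonneg
    (fun k => mul_nonneg (freq_nonneg k) (sq_nonneg _)) hs]
  refine (tsum_ofReal_freq_le a).trans ?_
  rw [ENNReal.ofReal_mul (by norm_num), ENNReal.ofReal_pow hη, ENNReal.ofReal_ofNat]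
  gcongr

/-! ### The equation at a fixed time -/

theorem HasWeakDeriv.coeff_eq_grad {f g : 𝕋 → ℝ} (h : HasWeakDeriv f g) :
    coeff g = grad (coeff f) :=
  funext h.coeff_eq

theorem memLp_ofReal {f : 𝕋 → ℝ} {q : ℝ≥0∞} (hf : MemLp f q μ𝕋) :
    MemLp (fun x => (f x : ℂ)) q μ𝕋 := hf.ofReal

theorem memLp_deriv {z p : 𝕋 → ℝ} (hz : hsNorm 1 (coeff z) < ⊤) (h : HasWeakDeriv z p) :
    MemLp (fun x => (p x : ℂ)) 2 μ𝕋 := by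
  refine memLp_two_of_memℓp h.integrable_right.ofReal ?_
  have := memℓp_grad_of_hsNorm hz
  rwa [← h.coeff_eq_grad] at this

/-- A function on the circle is determined, up to a constant, by its Fourier coefficients at the
nonzero frequencies. -/
theorem ae_eq_add_const {f g : 𝕋 → ℂ} (hf : Integrable f μ𝕋) (hg : Integrable g μ𝕋)
    (h : ∀ k ≠ 0, fourierCoeff f k = fourierCoeff g k) :
    (fun x => f x - ∫ y, f y ∂μ𝕋) =ᵐ[μ𝕋] fun x => g x - ∫ y, g y ∂μ𝕋 := by
  refine ae_eq_of_fourierCoeff_eq (hf.sub (integrable_const _)) (hg.sub (integrable_const _)) ?_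
  funext k
  rw [fourierCoeff_sub hf (integrable_const _), fourierCoeff_sub hg (integrable_const _)]
  rcases eq_or_ne k 0 with rfl | hk
  · simp [fourierCoeff_zero_eq]
  · rw [fourierCoeff_const _ hk, fourierCoeff_const _ hk, h k hk]

theorem two_pi_I_mul_ne_zero {k : ℤ} (hk : k ≠ 0) : (2 * Real.pi * Complex.I * k : ℂ) ≠ 0 := by
  simp [hk, Real.pi_ne_zero]

theorem primMean_ae_eq {z p : 𝕋 → ℝ} (h : HasWeakDeriv z p) :
    ∀ᵐ x ∂μ𝕋, ((z x - ∫ y, z y ∂μ𝕋 : ℝ) : ℂ) =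
      prim (fun y => (p y : ℂ)) x - ∫ y, prim (fun y => (p y : ℂ)) y ∂μ𝕋 := by
  have hp : Integrable (fun y => (p y : ℂ)) μ𝕋 := h.integrable_right.ofReal
  have hz : Integrable (fun y => (z y : ℂ)) μ𝕋 := h.integrable_left.ofReal
  have := ae_eq_add_const hz ((memLp_of_continuous (continuous_prim hp) 1).integrable le_rfl)
    fun k hk => by
      rw [fourierCoeff_prim hp hk, eq_div_iff (two_pi_I_mul_ne_zero hk), mul_comm]
      exact (h.coeff_eq k).symm
  filter_upwards [this] with x hx
  rw [← hx, Complex.ofReal_sub]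
  congr 1
  exact (integral_ofReal (𝕜 := ℂ)).symm

theorem IsVelocity.eq_prim {p v : 𝕋 → ℝ} (hp : MemLp (fun x => (p x : ℂ)) 2 μ𝕋)
    (hv : IsVelocity p v) (x : 𝕋) : (v x : ℂ) = -prim (fun y => (p y : ℂ) * p y) x := by
  have hpp := integrable_mul_of_memLp hp hp
  set u := prim (fun y => (p y : ℂ) * p y) with hu
  have huc : Continuous u := continuous_prim hpp
  have hvc : Continuous fun x => (v x : ℂ) := Complex.continuous_ofReal.comp hv.cont
  have hsqi : Integrable (fun x => (-(p x) ^ 2 + ∫ y, (p y) ^ 2 ∂μ𝕋 : ℝ)) μ𝕋 :=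
    hv.deriv.integrable_right
  have hk : ∀ k ≠ 0, fourierCoeff (fun x => (v x : ℂ)) k = fourierCoeff (fun x => -1 * u x) k := by
    intro k hk
    rw [fourierCoeff.const_mul, hu, fourierCoeff_prim hpp hk]
    have h1 := hv.deriv.coeff_eq k
    have h2 : coeff (fun x => -(p x) ^ 2 + ∫ y, (p y) ^ 2 ∂μ𝕋) k =
        -fourierCoeff (fun y => (p y : ℂ) * p y) k := by
      have e : (fun x => ((-(p x) ^ 2 + ∫ y, (p y) ^ 2 ∂μ𝕋 : ℝ) : ℂ)) = fun x =>
          ((∫ y, (p y) ^ 2 ∂μ𝕋 : ℝ) : ℂ) - (p x : ℂ) * p x := by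
        funext x; push_cast; ring
      rw [coeff, e, fourierCoeff_sub (integrable_const _) hpp, fourierCoeff_const _ hk, zero_sub]
    rw [h2] at h1
    have h3 := two_pi_I_mul_ne_zero hk
    change coeff v k = _
    rw [mul_div_assoc', eq_div_iff h3]
    linear_combination -h1
  have h1 := ae_eq_add_const ((memLp_of_continuous hvc 1).integrable le_rfl)
    ((memLp_of_continuous (huc.const_smul (-1 : ℂ)) 1).integrable le_rfl) hk
  have h2 := continuous_eq_of_ae_eq (hvc.sub continuous_const)
    ((huc.const_smul (-1 : ℂ)).sub continuous_const) h1
  have h3 := congrFun h2 0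
  have h4 := congrFun h2 x
  have h5 : u 0 = 0 := prim_zero (fun y => (p y : ℂ) * p y)
  have h6 : v 0 = 0 := hv.zero
  change (v 0 : ℂ) - _ = -1 * u 0 - _ at h3
  change (v x : ℂ) - _ = -1 * u x - _ at h4
  rw [h5, h6, Complex.ofReal_zero] at h3
  linear_combination h4 - h3

/-- The source of the equation is a function of the derivative `p` alone: `z - ∫ z` and `v` are periodic
primitives. -/
theorem source_ae_eq (N : ℤ) {z p v : 𝕋 → ℝ} (hz : hsNorm 1 (coeff z) < ⊤)
    (h : HasWeakDeriv z p) (hv : IsVelocity p v) :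
    (fun x => (source N z p v x : ℂ)) =ᵐ[μ𝕋] sourceFun N fun x => (p x : ℂ) := by
  filter_upwards [primMean_ae_eq h] with x hx
  rw [sourceFun, ← hx, source]
  have := hv.eq_prim (memLp_deriv hz h) x
  rw [← neg_eq_iff_eq_neg] at this
  rw [← this]
  push_cast
  ring

theorem coeff_source (N : ℤ) {z p v : 𝕋 → ℝ} (hz : hsNorm 1 (coeff z) < ⊤)
    (h : HasWeakDeriv z p) (hv : IsVelocity p v) :
    coeff (source N z p v) = (nonlin N).app (toEll (grad (coeff z))) := by
  have hp := memLp_deriv hz h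
  rw [nonlin_app N hp, coeff, fourierCoeff_congr_ae (source_ae_eq N hz h hv)]
  rw [coe_toEll (memℓp_grad_of_hsNorm hz), ← h.coeff_eq_grad]
  rfl

theorem memLp_sourceFun (N : ℤ) {g : 𝕋 → ℂ} (hg : MemLp g 2 μ𝕋) : MemLp (sourceFun N g) 2 μ𝕋 := by
  have hgi : Integrable g μ𝕋 := hg.integrable (by norm_num)
  have hz : Continuous fun x => prim g x - ∫ y, prim g y ∂μ𝕋 :=
    (continuous_prim hgi).sub continuous_const
  have hu : Continuous (prim fun y => g y * g y) := continuous_prim (integrable_mul_of_memLp hg hg)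
  have hm : ∀ {w : 𝕋 → ℂ}, Continuous w → MemLp (fun x => w x * g x) 2 μ𝕋 := fun hw =>
    hg.mul' (r := 2) (memLp_of_continuous hw ⊤)
  exact ((((memLp_of_continuous hz 2).const_mul _).add ((hm hz).const_mul _)).add
    ((memLp_of_continuous hu 2).const_mul _)).add (hm hu)

theorem memLp_source_slice (N : ℤ) {z p v : 𝕋 → ℝ} (hz : hsNorm 1 (coeff z) < ⊤)
    (h : HasWeakDeriv z p) (hv : IsVelocity p v) :
    MemLp (fun x => (source N z p v x : ℂ)) 2 μ𝕋 :=
  (memLp_congr_ae (source_ae_eq N hz h hv)).2 (memLp_sourceFun N (memLp_deriv hz h))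

/-! ### From weak solutions to Duhamel's formula -/

/-- A distributional solution of the scalar equation is given by Duhamel's formula. -/
theorem ae_eq_duhamel {T l : ℝ} (hT : 0 < T) {c : ℂ} {a f : ℝ → ℂ} (ha : IntegrableOn a (Ioo 0 T))
    (hf : LocallyIntegrable f volume)
    (h : ∀ ψ : ℝ → ℝ, ContDiff ℝ ∞ ψ → (∃ T' < T, ∀ t > T', ψ t = 0) →
      (∫ t in Ioo 0 T, (((deriv ψ t - l * ψ t : ℝ) : ℂ) * a t + (ψ t : ℂ) * f t))
        + ψ 0 * c = 0) :
    ∀ᵐ t, t ∈ Ioo 0 T → a t = duhamel l c f t := by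
  have hu : Continuous (duhamel l c f) := continuous_duhamel hf
  have hui : IntegrableOn (duhamel l c f) (Ioo 0 T) :=
    hu.locallyIntegrable.integrableOn_isCompact isCompact_Icc |>.mono_set Ioo_subset_Icc_self
  have hfi : IntegrableOn f (Ioo 0 T) :=
    hf.integrableOn_isCompact isCompact_Icc |>.mono_set Ioo_subset_Icc_self
  have key := isOpen_Ioo.ae_eq_zero_of_integral_contDiff_smul_eq_zero (U := Ioo 0 T)
    (μ := volume) (f := fun t => a t - duhamel l c f t) (ha.sub hui).locallyIntegrableOn ?_
  · filter_upwards [key] with t ht ht' using sub_eq_zero.1 (ht ht')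
  intro χ hχ hχc hχs
  -- the solution `ψ` of the adjoint equation `ψ' - l ψ = χ` vanishing after the support of `χ`
  set G : ℝ → ℝ := fun t => ∫ s in T..t, Real.exp (-(l * s)) * χ s with hG
  have hGd : ∀ t, HasDerivAt G (Real.exp (-(l * t)) * χ t) t := fun t => by
    have hc : Continuous fun s => Real.exp (-(l * s)) * χ s := by
      have := hχ.continuous
      fun_prop
    exact intervalIntegral.integral_hasDerivAt_right (hc.intervalIntegrable _ _)
      hc.aestronglyMeasurable.stronglyMeasurableAtFilter hc.continuousAt
  have hGs : ContDiff ℝ ∞ G := by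
    rw [contDiff_infty_iff_deriv]
    refine ⟨fun t => (hGd t).differentiableAt, ?_⟩
    have : deriv G = fun t => Real.exp (-(l * t)) * χ t := funext fun t => (hGd t).deriv
    rw [this]
    fun_prop
  set ψ : ℝ → ℝ := fun t => Real.exp (l * t) * G t with hψ
  have hψd : ∀ t, HasDerivAt ψ (l * ψ t + χ t) t := fun t => by
    have h1 : HasDerivAt (fun s : ℝ => Real.exp (l * s)) (l * Real.exp (l * t)) t := by
      have := ((hasDerivAt_id t).const_mul l).exp
      simpa [mul_comm] using this
    convert! h1.mul (hGd t) using 1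
    have : Real.exp (l * t) * Real.exp (-(l * t)) = 1 := by rw [← Real.exp_add]; simp
    simp only [hψ]
    linear_combination -χ t * this
  have hψs : ContDiff ℝ ∞ ψ := by
    have : ContDiff ℝ ∞ fun t : ℝ => Real.exp (l * t) := by fun_prop
    exact this.mul hGs
  have hψ0 : ∃ T' < T, ∀ t > T', ψ t = 0 := by
    obtain ⟨T', hT', hs⟩ : ∃ T' < T, ∀ t > T', χ t = 0 := by
      rcases (tsupport χ).eq_empty_or_nonempty with he | hne
      · refine ⟨0, hT, fun t _ => image_eq_zero_of_notMem_tsupport (by simp [he])⟩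
      · have hm := hχc.isCompact.sSup_mem hne
        refine ⟨_, (hχs hm).2, fun t ht => image_eq_zero_of_notMem_tsupport fun hmem => ?_⟩
        exact absurd (le_csSup hχc.isCompact.bddAbove hmem) (not_le.2 ht)
    refine ⟨T', hT', fun t ht => ?_⟩
    have : G t = 0 := by
      simp only [hG]
      rw [intervalIntegral.integral_congr (g := fun _ => 0)]
      · simp
      · intro s hs'
        have : T' < s := lt_of_lt_of_le (lt_min hT' ht) hs'.1
        simp [hs s this]
    simp only [hψ, this, mul_zero]
  have h1 := h ψ hψs hψ0
  have hder : deriv ψ = fun t => l * ψ t + χ t := funext fun t => (hψd t).deriv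
  have hψc : Continuous ψ := hψs.continuous
  have h2 := duhamel_mul_sub (l := l) (c := c) hf hT.le (g := fun t => (ψ t : ℂ))
    (g' := fun t => ((l * ψ t + χ t : ℝ) : ℂ)) (fun t => (hψd t).ofReal_comp)
    (by have := hχ.continuous; fun_prop)
  obtain ⟨T', hT', hs⟩ := hψ0
  rw [hs T hT', duhamel_zero, intervalIntegral.integral_of_le hT.le,
    integral_Ioc_eq_integral_Ioo] at h2
  have hχ' : ∀ {w : ℝ → ℂ}, IntegrableOn w (Ioo 0 T) →
      IntegrableOn (fun t => (χ t : ℂ) * w t) (Ioo 0 T) := fun {w} hw => by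
    obtain ⟨C, hC⟩ := hχc.exists_bound_of_continuous hχ.continuous
    exact hw.bdd_mul (c := C) (Complex.continuous_ofReal.comp hχ.continuous).aestronglyMeasurable
      (ae_of_all _ fun t => by simpa using hC t)
  have hψ' : ∀ {w : ℝ → ℂ}, IntegrableOn w (Ioo 0 T) →
      IntegrableOn (fun t => (ψ t : ℂ) * w t) (Ioo 0 T) := fun {w} hw => by
    obtain ⟨C, hC⟩ := isCompact_Icc.exists_bound_of_continuousOn (s := Icc 0 T) hψc.continuousOn
    refine Integrable.bdd_mul (c := C) hw (Complex.continuous_ofReal.comp hψc).aestronglyMeasurable ?_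
    rw [ae_restrict_iff' measurableSet_Ioo]
    exact ae_of_all _ fun t ht => by simpa using hC t (Ioo_subset_Icc_self ht)
  have e1 : ∫ t in Ioo 0 T, (((deriv ψ t - l * ψ t : ℝ) : ℂ) * a t + (ψ t : ℂ) * f t) =
      (∫ t in Ioo 0 T, (χ t : ℂ) * a t) + ∫ t in Ioo 0 T, (ψ t : ℂ) * f t := by
    rw [← integral_add (hχ' ha) (hψ' hfi)]
    refine integral_congr_ae (ae_of_all _ fun t => ?_)
    simp only [hder, add_sub_cancel_left]
  have e2 : ∫ s in Ioo 0 T, ((-(l : ℂ) * duhamel l c f s + f s) * (ψ s : ℂ) +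
      duhamel l c f s * ((l * ψ s + χ s : ℝ) : ℂ)) =
      (∫ t in Ioo 0 T, (χ t : ℂ) * duhamel l c f t) + ∫ t in Ioo 0 T, (ψ t : ℂ) * f t := by
    rw [← integral_add (hχ' hui) (hψ' hfi)]
    refine integral_congr_ae (ae_of_all _ fun t => ?_)
    push_cast
    ring
  rw [e1] at h1
  rw [e2] at h2
  have e3 : ∫ t, χ t • (a t - duhamel l c f t) = ∫ t in Ioo 0 T, χ t • (a t - duhamel l c f t) := by
    refine (setIntegral_eq_integral_of_forall_compl_eq_zero fun t ht => ?_).symm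
    rw [image_eq_zero_of_notMem_tsupport fun hm => ht (hχs hm), zero_smul]
  rw [e3]
  simp only [Complex.real_smul, mul_sub]
  rw [integral_sub (hχ' ha) (hχ' hui)]
  simp only [Complex.ofReal_zero, mul_zero, zero_sub] at h2
  linear_combination h1 + h2

theorem coeff_eq_integral (f : 𝕋 → ℝ) (k : ℤ) :
    coeff f k = ∫ x, fourier (-k) x * (f x : ℂ) ∂μ𝕋 := rfl

theorem clm_coeff (L : ℂ →L[ℝ] ℝ) {f : 𝕋 → ℝ} (hf : Integrable (fun x => (f x : ℂ)) μ𝕋) (k : ℤ) :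
    ∫ x, f x * L (fourier (-k) x) ∂μ𝕋 = L (coeff f k) := by
  have := L.integral_comp_comm (hf.fourier_smul (-k))
  rw [coeff, fourierCoeff, ← this]
  refine integral_congr_ae (ae_of_all _ fun x => ?_)
  simp only [smul_eq_mul]
  rw [mul_comm (fourier (-k) x), ← Complex.real_smul, L.map_smul, smul_eq_mul]

/-- The test functions `ψ(t) cos(2πkx)` and `ψ(t) sin(2πkx)`. -/
def modeTest (L : ℂ →L[ℝ] ℝ) (k : ℤ) (ψ : ℝ → ℝ) (t : ℝ) (x : 𝕋) : ℝ := ψ t * L (fourier (-k) x)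

theorem contDiff_fourier_coe (k : ℤ) :
    ContDiff ℝ ∞ fun y : ℝ => (fourier k (y : 𝕋) : ℂ) := by
  have : (fun y : ℝ => (fourier k (y : 𝕋) : ℂ)) = fun y : ℝ =>
      Complex.exp (2 * Real.pi * Complex.I * k * y / (1 : ℝ)) := by
    funext y
    exact fourier_coe_apply
  rw [this]
  refine Complex.contDiff_exp.comp ?_
  have h : ContDiff ℝ ∞ fun y : ℝ => (y : ℂ) := Complex.ofRealCLM.contDiff
  fun_prop

theorem isTest_modeTest (L : ℂ →L[ℝ] ℝ) (k : ℤ) {ψ : ℝ → ℝ} {T : ℝ} (hψ : ContDiff ℝ ∞ ψ)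
    (hs : ∃ T' < T, ∀ t > T', ψ t = 0) : IsTest T (modeTest L k ψ) where
  smooth := by
    have h1 : ContDiff ℝ ∞ fun q : ℝ × ℝ => ψ q.1 := hψ.comp contDiff_fst
    have h2 : ContDiff ℝ ∞ fun q : ℝ × ℝ => L (fourier (-k) (q.2 : 𝕋)) :=
      L.contDiff.comp ((contDiff_fourier_coe (-k)).comp contDiff_snd)
    exact h1.mul h2
  support := by
    obtain ⟨T', hT', h⟩ := hs
    exact ⟨T', hT', fun t ht x => by rw [modeTest, h t ht, zero_mul]⟩

theorem dt_modeTest (L : ℂ →L[ℝ] ℝ) (k : ℤ) {ψ : ℝ → ℝ} (hψ : ContDiff ℝ ∞ ψ) (t : ℝ) (x : 𝕋) :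
    dt (modeTest L k ψ) t x = deriv ψ t * L (fourier (-k) x) := by
  have h : DifferentiableAt ℝ ψ t := hψ.differentiable (by simp) t
  exact (h.hasDerivAt.mul_const _).deriv

theorem dxx_modeTest (L : ℂ →L[ℝ] ℝ) (k : ℤ) (ψ : ℝ → ℝ) (t : ℝ) (x : 𝕋) :
    dxx (modeTest L k ψ) t x = -(freq k ^ 2 * ψ t) * L (fourier (-k) x) := by
  set w : ℂ := 2 * Real.pi * Complex.I * ((-k : ℤ) : ℂ) with hw
  have h1 : ∀ (z : ℂ) (y : ℝ), HasDerivAt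
      (fun y : ℝ => ψ t * L (z * (fourier (-k) (x + (y : 𝕋)) : ℂ)))
      (ψ t * L (z * w * fourier (-k) (x + (y : 𝕋)))) y := by
    intro z y
    have h2 : HasDerivAt (fun y : ℝ => z * (fourier (-k) (x + (y : 𝕋)) : ℂ))
        (z * w * fourier (-k) (x + (y : 𝕋))) y := by
      have h3 := ((hasDerivAt_fourier_unit (-k) y).const_mul (fourier (-k) x : ℂ)).const_mul z
      have h4 : ∀ y : ℝ, (fourier (-k) (x + (y : 𝕋)) : ℂ) =
          fourier (-k) x * fourier (-k) (y : 𝕋) := fun y => by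
        rw [fourier_apply, fourier_apply, fourier_apply, smul_add, AddCircle.toCircle_add,
          Circle.coe_mul]
      simp_rw [h4]
      convert! h3 using 1
      rw [hw]
      ring
    exact (L.hasFDerivAt.comp_hasDerivAt y h2).const_mul (ψ t)
  have e1 : deriv (fun y : ℝ => modeTest L k ψ t (x + (y : 𝕋))) =
      fun y : ℝ => ψ t * L (w * (fourier (-k) (x + (y : 𝕋)) : ℂ)) := by
    funext y
    have := (h1 1 y).deriv
    simpa only [one_mul, modeTest] using this
  have e2 : w * w = ((-(freq k ^ 2) : ℝ) : ℂ) := by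
    rw [hw, freq_sq]
    push_cast
    linear_combination ((2 * Real.pi) ^ 2 * (k : ℂ) ^ 2) * Complex.I_sq
  rw [dxx, iteratedDeriv_succ, iteratedDeriv_one, e1, (h1 w 0).deriv, e2, ← Complex.real_smul,
    L.map_smul, QuotientAddGroup.mk_zero, add_zero, smul_eq_mul]
  ring

/-- The derivative `∂ₓ ζ` of a function with values in `H¹`, as an element of `ℓ²`. -/
def derivEll (ζ : ℝ → 𝕋 → ℝ) (t : ℝ) : Ell2 := toEll (grad (coeff (ζ t)))

variable {N : ℤ} {ζ₀ : 𝕋 → ℝ} {T : ℝ} {ζ : ℝ → 𝕋 → ℝ}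

theorem MemL4H1.aestronglyMeasurable_coeff (h : MemL4H1 T ζ) (k : ℤ) :
    AEStronglyMeasurable (fun t => coeff (ζ t) k) (volume.restrict (Ioo 0 T)) := by
  have h1 : AEStronglyMeasurable (fun q : ℝ × 𝕋 => (fourier (-k) q.2 : ℂ) * (ζ q.1 q.2 : ℂ))
      ((volume.restrict (Ioo 0 T)).prod μ𝕋) :=
    (Continuous.aestronglyMeasurable (by fun_prop)).mul
      (Complex.continuous_ofReal.comp_aestronglyMeasurable h.meas)
  exact h1.integral_prod_right'

theorem MemL4H1.memLp_derivEll (h : MemL4H1 T ζ) :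
    MemLp (derivEll ζ) 4 (volume.restrict (Ioo 0 T)) := by
  refine ⟨aestronglyMeasurable_toEll (fun k => (h.aestronglyMeasurable_coeff k).const_mul _) ?_, ?_⟩
  · filter_upwards [h.slice] with t ht using memℓp_grad_of_hsNorm ht.2
  · rw [eLpNorm_lt_top_iff_lintegral_rpow_enorm_lt_top (by norm_num) (by norm_num)]
    have : ∀ t, ‖derivEll ζ t‖ₑ ^ (4 : ℝ≥0∞).toReal ≤ 7 ^ 4 * hsNorm 1 (coeff (ζ t)) ^ 4 := by
      intro t
      rw [ENNReal.toReal_ofNat, ← mul_pow]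
      norm_cast
      exact pow_le_pow_left' (enorm_toEll_grad_le _) 4
    refine (lintegral_mono this).trans_lt ?_
    rw [lintegral_const_mul' _ _ (by simp)]
    exact ENNReal.mul_lt_top (by simp) h.lintegral_lt

theorem enorm_le_hsNorm (a : ℤ → ℂ) (k : ℤ) : ‖a k‖ₑ ≤ hsNorm 1 a := by
  refine (ENNReal.pow_le_pow_left_iff two_ne_zero).1 ?_
  rw [hsNorm_sq]
  refine le_trans ?_ (ENNReal.le_tsum k)
  refine le_mul_of_one_le_left' ?_
  rw [ENNReal.one_le_ofReal, Real.rpow_one]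
  linarith [sq_nonneg (k : ℝ)]

theorem MemL4H1.integrableOn_coeff (h : MemL4H1 T ζ) (k : ℤ) :
    IntegrableOn (fun t => coeff (ζ t) k) (Ioo 0 T) := by
  have h1 : MemLp (fun t => coeff (ζ t) k) 4 (volume.restrict (Ioo 0 T)) := by
    refine ⟨h.aestronglyMeasurable_coeff k, ?_⟩
    rw [eLpNorm_lt_top_iff_lintegral_rpow_enorm_lt_top (by norm_num) (by norm_num)]
    refine (lintegral_mono fun t => ?_).trans_lt h.lintegral_lt
    rw [ENNReal.toReal_ofNat]
    norm_cast
    exact pow_le_pow_left' (enorm_le_hsNorm _ k) 4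
  exact h1.integrable (by norm_num)

theorem memLp_source_derivEll (N : ℤ) (h : MemL4H1 T ζ) :
    MemLp (src (nonlin N) T (derivEll ζ)) (4 / 3) volume :=
  memLp_source measurableSet_Ioo (ENNReal.mul_lt_top (by simp)
    (ENNReal.rpow_lt_top_of_nonneg (by norm_num) (by simp))) h.memLp_derivEll

/-- The Fourier coefficients of a solution are given by Duhamel's formula. -/
theorem IsSolution.ae_coeff_eq (hT : 0 < T) (hζ₀ : MemLp ζ₀ 2 μ𝕋) (h : IsSolution N ζ₀ T ζ) :
    ∀ᵐ t, t ∈ Ioo 0 T → coeff (ζ t) = heat (coeff ζ₀) (src (nonlin N) T (derivEll ζ)) t := by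
  obtain ⟨hm, p, v, -, hpv, hweak⟩ := h
  have hloc : LocallyIntegrable (src (nonlin N) T (derivEll ζ)) volume :=
    (memLp_source_derivEll N hm).locallyIntegrable one_le_four_thirds
  suffices hk : ∀ k, ∀ᵐ t, t ∈ Ioo 0 T →
      coeff (ζ t) k = heat (coeff ζ₀) (src (nonlin N) T (derivEll ζ)) t k by
    filter_upwards [ae_all_iff.2 hk] with t h1 ht
    exact funext fun k => h1 k ht
  intro k
  have hlk := locallyIntegrable_coord hloc k
  refine ae_eq_duhamel hT (hm.integrableOn_coeff k) hlk fun ψ hψ hψs => ?_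
  have hii : Integrable (fun t => ((deriv ψ t - freq k ^ 2 * ψ t : ℝ) : ℂ) * coeff (ζ t) k +
      (ψ t : ℂ) * src (nonlin N) T (derivEll ζ) t k) (volume.restrict (Ioo 0 T)) := by
    have hψ' : ∀ {w : ℝ → ℂ} {g : ℝ → ℝ}, Continuous g → IntegrableOn w (Ioo 0 T) →
        IntegrableOn (fun t => (g t : ℂ) * w t) (Ioo 0 T) := fun {w g} hg hw => by
      obtain ⟨C, hC⟩ := isCompact_Icc.exists_bound_of_continuousOn (s := Icc 0 T) hg.continuousOn
      refine Integrable.bdd_mul (c := C) hw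
        (Complex.continuous_ofReal.comp hg).aestronglyMeasurable ?_
      rw [ae_restrict_iff' measurableSet_Ioo]
      exact ae_of_all _ fun t ht => by simpa using hC t (Ioo_subset_Icc_self ht)
    have hd : Continuous (deriv ψ) := hψ.continuous_deriv (by simp)
    exact (hψ' (by have := hψ.continuous; fun_prop) (hm.integrableOn_coeff k)).add
      (hψ' hψ.continuous ((hlk.integrableOn_isCompact isCompact_Icc).mono_set Ioo_subset_Icc_self))
  -- test functions are real, so the real and the imaginary part of the mode are tested separately
  have hL : ∀ L : ℂ →L[ℝ] ℝ, L ((∫ t in Ioo 0 T, (((deriv ψ t - freq k ^ 2 * ψ t : ℝ) : ℂ) *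
      coeff (ζ t) k + (ψ t : ℂ) * src (nonlin N) T (derivEll ζ) t k)) + ψ 0 * coeff ζ₀ k) = 0 := by
    intro L
    have h1 := hweak _ (isTest_modeTest L k hψ hψs)
    rw [map_add, ← L.integral_comp_comm hii]
    refine Eq.trans ?_ h1
    congr 1
    · refine setIntegral_congr_ae measurableSet_Ioo ?_
      have h2 := hpv
      have h3 := hm.slice
      rw [ae_restrict_iff' measurableSet_Ioo] at h2 h3
      filter_upwards [h2, h3] with t h2 h3 ht
      obtain ⟨hwd, hvel⟩ := h2 ht
      have hz := (h3 ht).2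
      have hzi : Integrable (fun x => (ζ t x : ℂ)) μ𝕋 := hwd.integrable_left.ofReal
      have hsi : Integrable (fun x => (source N (ζ t) (p t) (v t) x : ℂ)) μ𝕋 :=
        (memLp_source_slice N hz hwd hvel).integrable (by norm_num)
      have hsk : src (nonlin N) T (derivEll ζ) t k = coeff (source N (ζ t) (p t) (v t)) k := by
        rw [src_apply ht, coeff_source N hz hwd hvel]
        rfl
      have e : ∀ x, ζ t x * (dt (modeTest L k ψ) t x + dxx (modeTest L k ψ) t x) +
          source N (ζ t) (p t) (v t) x * modeTest L k ψ t x =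
          (deriv ψ t - freq k ^ 2 * ψ t) * (ζ t x * L (fourier (-k) x)) +
            ψ t * (source N (ζ t) (p t) (v t) x * L (fourier (-k) x)) := by
        intro x
        rw [dt_modeTest L k hψ, dxx_modeTest, modeTest]
        ring
      have hbd : ∀ {w : 𝕋 → ℝ}, Integrable (fun x => (w x : ℂ)) μ𝕋 →
          Integrable (fun x => w x * L (fourier (-k) x)) μ𝕋 := fun {w} hw => by
        have := L.integrable_comp (hw.fourier_smul (-k))
        refine this.congr (ae_of_all _ fun x => ?_)
        simp only [smul_eq_mul]
        rw [mul_comm (fourier (-k) x), ← Complex.real_smul, L.map_smul, smul_eq_mul]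
      simp_rw [e]
      rw [integral_add ((hbd hzi).const_mul _) ((hbd hsi).const_mul _), integral_const_mul,
        integral_const_mul, clm_coeff L hzi, clm_coeff L hsi, hsk, map_add, ← Complex.real_smul,
        ← Complex.real_smul, L.map_smul, L.map_smul, smul_eq_mul, smul_eq_mul]
    · have hi : Integrable (fun x => (ζ₀ x : ℂ)) μ𝕋 := (memLp_ofReal hζ₀).integrable (by norm_num)
      rw [← Complex.real_smul, L.map_smul, smul_eq_mul, ← clm_coeff L hi, ← integral_const_mul]
      refine integral_congr_ae (ae_of_all _ fun x => ?_)
      simp only [modeTest]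
      ring
  exact Complex.ext (hL Complex.reCLM) (hL Complex.imCLM)

/-- The derivative of a weak solution is a solution in terms of the Fourier coefficients. -/
theorem IsSolution.coeffSolution (hT : 0 < T) (hζ₀ : MemLp ζ₀ 2 μ𝕋) (h : IsSolution N ζ₀ T ζ) :
    CoeffSolution (nonlin N) (coeff ζ₀) (Ioo 0 T) (derivEll ζ) := by
  refine ⟨h.1.memLp_derivEll, ?_⟩
  rw [Filter.EventuallyEq, ae_restrict_iff' measurableSet_Ioo]
  filter_upwards [h.ae_coeff_eq hT hζ₀] with t h1 ht
  rw [derivEll, h1 ht]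
  rfl

/-! ### Uniqueness -/

theorem ae_eq_of_coeff_eq {f g : 𝕋 → ℝ} (hf : MemLp f 2 μ𝕋) (hg : MemLp g 2 μ𝕋)
    (h : coeff f = coeff g) : f =ᵐ[μ𝕋] g := by
  have := ae_eq_of_fourierCoeff_eq_of_memLp (memLp_ofReal hf) (memLp_ofReal hg) h
  filter_upwards [this] with x hx
  exact Complex.ofReal_injective hx

/-- Joint measurability allows Fubini's theorem for the set where two functions differ. -/
theorem ae_spaceTime_of_ae_slice {T : ℝ} {f g : ℝ → 𝕋 → ℝ}
    (hf : AEStronglyMeasurable (fun q : ℝ × 𝕋 => f q.1 q.2) (spaceTime T))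
    (hg : AEStronglyMeasurable (fun q : ℝ × 𝕋 => g q.1 q.2) (spaceTime T))
    (h : ∀ᵐ t ∂volume.restrict (Ioo 0 T), f t =ᵐ[μ𝕋] g t) :
    ∀ᵐ q ∂spaceTime T, f q.1 q.2 = g q.1 q.2 := by
  obtain ⟨f', hf', hff'⟩ := hf
  obtain ⟨g', hg', hgg'⟩ := hg
  have h1 := Measure.ae_ae_of_ae_prod hff'
  have h2 := Measure.ae_ae_of_ae_prod hgg'
  have h3 : ∀ᵐ q ∂spaceTime T, f' q = g' q := by
    rw [spaceTime, Measure.ae_prod_iff_ae_ae (measurableSet_eq_fun hf'.measurable hg'.measurable)]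
    filter_upwards [h, h1, h2] with t ht h1 h2
    filter_upwards [ht, h1, h2] with x hx h1 h2
    rw [← h1, ← h2]
    exact hx
  filter_upwards [hff', hgg', h3] with q h1 h2 h3
  rw [h1, h2, h3]

variable {N : ℤ} {ζ₀ : 𝕋 → ℝ} {T : ℝ} {ζ ζ' : ℝ → 𝕋 → ℝ}

/-- Two solutions have the same derivative, hence the same source, hence the same coefficients. -/
theorem IsSolution.unique (hT : 0 < T) (hζ₀ : MemHs (1 / 2) ζ₀) (h : IsSolution N ζ₀ T ζ)
    (h' : IsSolution N ζ₀ T ζ') : ∀ᵐ q ∂spaceTime T, ζ q.1 q.2 = ζ' q.1 q.2 := by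
  have hc := summable_of_hsNorm hζ₀.2
  have hp := CoeffSolution.unique hc (h.coeffSolution hT hζ₀.1) (h'.coeffSolution hT hζ₀.1)
  have hsrc : src (nonlin N) T (derivEll ζ) =ᵐ[volume] src (nonlin N) T (derivEll ζ') := by
    rw [Filter.EventuallyEq, ae_restrict_iff' measurableSet_Ioo] at hp
    filter_upwards [hp] with t ht
    by_cases hmem : t ∈ Ioo 0 T
    · rw [src_apply hmem, src_apply hmem, ht hmem]
    · rw [src, src, indicator_of_notMem hmem, indicator_of_notMem hmem]
  refine ae_spaceTime_of_ae_slice h.1.meas h'.1.meas ?_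
  have h1 := h.ae_coeff_eq hT hζ₀.1
  have h2 := h'.ae_coeff_eq hT hζ₀.1
  rw [← ae_restrict_iff' measurableSet_Ioo] at h1 h2
  filter_upwards [h1, h2, h.1.slice, h'.1.slice, ae_restrict_mem measurableSet_Ioo]
    with t h1 h2 h3 h4 ht
  refine ae_eq_of_coeff_eq h3.1 h4.1 ?_
  rw [h1, h2]
  exact heat_congr ht.1.le (hsrc.mono fun s hs _ => hs)

/-! ### Smoothness -/

/-- The function on the circle with given, absolutely summable, Fourier coefficients. -/
def torusSeries (a : ℤ → ℂ) (x : 𝕋) : ℂ := ∑' k, a k * (fourier k x : ℂ)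

theorem continuous_torusSeries {a : ℤ → ℂ} (ha : Summable a) : Continuous (torusSeries a) :=
  continuous_tsum (fun k => by fun_prop) ha.norm fun k x => by
    rw [norm_mul, norm_fourier, mul_one]

theorem fourierCoeff_torusSeries {a : ℤ → ℂ} (ha : Summable a) :
    fourierCoeff (torusSeries a) = a := by
  funext k
  have hi : ∀ j, Integrable (fun x => (fourier (-k) x : ℂ) * (a j * fourier j x)) μ𝕋 := fun j =>
    (memLp_of_continuous (by fun_prop) 1).integrable le_rfl
  have hn : ∀ j, ∫ x, ‖(fourier (-k) x : ℂ) * (a j * fourier j x)‖ ∂μ𝕋 = ‖a j‖ := fun j => by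
    simp_rw [norm_mul, norm_fourier, one_mul, mul_one]
    simp
  have h := hasSum_integral_of_summable_integral_norm hi (by simp_rw [hn]; exact ha.norm)
  have e : ∀ j, ∫ x, (fourier (-k) x : ℂ) * (a j * fourier j x) ∂μ𝕋 =
      if j = k then a k else 0 := fun j => by
    have h1 := congrFun (fourierCoeff_fourier (T := 1) j) k
    have h2 := fourierCoeff.const_mul (T := 1) (fourier j) (a j) k
    rw [h1] at h2
    refine h2.trans ?_
    split_ifs with hjk
    · rw [hjk, Pi.single_eq_same, mul_one]
    · rw [Pi.single_eq_of_ne (Ne.symm hjk), mul_zero]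
  simp_rw [e] at h
  have h3 := h.unique (hasSum_ite_eq k (a k))
  rw [← h3, fourierCoeff]
  refine integral_congr_ae (ae_of_all _ fun x => ?_)
  simp only [smul_eq_mul, torusSeries]
  rw [tsum_mul_left]

theorem Rapid.continuousOn_torusSeries {a : ℝ → ℤ → ℂ} (ha : Rapid T a) :
    ContinuousOn (fun q : ℝ × 𝕋 => torusSeries (a q.1) q.2) (Ioo 0 T ×ˢ univ) := by
  rintro ⟨t, x⟩ hq
  obtain ⟨α, β, hα, hβ, htI, hsub⟩ := exists_Icc_nhds hq.1
  obtain ⟨m, hm, hm'⟩ := ha.exists_maj hα hβ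
  have h := continuousOn_tsum_of_enorm_le (S := Icc α β ×ˢ (univ : Set 𝕋))
    (g := fun k (q : ℝ × 𝕋) => a q.1 k * (fourier k q.2 : ℂ)) hm
    (fun q hq k => by rw [enorm_mul, enorm_fourier, mul_one]; exact hm' _ hq.1 k)
    fun k => (((ha.cont k).mono hsub).comp continuousOn_fst fun q hq => hq.1).mul (by fun_prop)
  exact (h.continuousAt (prod_mem_nhds (Icc_mem_nhds htI.1 htI.2)
    Filter.univ_mem)).continuousWithinAt

theorem aestronglyMeasurable_spaceTime {E : Type*} [NormedAddCommGroup E]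
    {f : ℝ × 𝕋 → E}
    (hf : ContinuousOn f (Ioo 0 T ×ˢ univ)) : AEStronglyMeasurable f (spaceTime T) := by
  have e : spaceTime T = (volume.prod μ𝕋).restrict (Ioo 0 T ×ˢ univ) := by
    rw [← Measure.prod_restrict, Measure.restrict_univ, spaceTime]
  rw [e]
  exact hf.aestronglyMeasurable (measurableSet_Ioo.prod MeasurableSet.univ)

theorem IsSolution.isSmooth (hT : 0 < T) (hζ₀ : MemHs (1 / 2) ζ₀) (h : IsSolution N ζ₀ T ζ) :
    IsSmooth T ζ := by
  have hc := summable_of_hsNorm hζ₀.2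
  have hp := h.coeffSolution hT hζ₀.1
  set a := heat (coeff ζ₀) (src (nonlin N) T (derivEll ζ)) with ha
  have hr : Rapid T a := hp.rapid hc
  refine ⟨fun t x => (torusSeries (a t) x).re, ?_, ?_⟩
  · exact Complex.reCLM.contDiff.comp_contDiffOn (hp.contDiffOn hc)
  · have hcont : ContinuousOn (fun q : ℝ × 𝕋 => (torusSeries (a q.1) q.2).re) (Ioo 0 T ×ˢ univ) :=
      Complex.continuous_re.comp_continuousOn hr.continuousOn_torusSeries
    refine ae_spaceTime_of_ae_slice h.1.meas
      (g := fun t x => (torusSeries (a t) x).re) (aestronglyMeasurable_spaceTime hcont) ?_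
    have h1 := h.ae_coeff_eq hT hζ₀.1
    rw [← ae_restrict_iff' measurableSet_Ioo] at h1
    filter_upwards [h1, h.1.slice, ae_restrict_mem measurableSet_Ioo] with t h1 h2 ht
    have hs := hr.summable ht
    have h3 := ae_eq_of_fourierCoeff_eq_of_memLp (memLp_ofReal h2.1)
      (memLp_of_continuous (continuous_torusSeries hs) 2)
      (by rw [fourierCoeff_torusSeries hs]; exact h1)
    filter_upwards [h3] with x hx
    rw [← hx, Complex.ofReal_re]

/-! ### Hölder continuity in time -/

/-- The Fourier multiplier with a bounded symbol. -/
def mulOp (m : ℤ → ℂ) (C : ℝ≥0) (hm : ∀ k, ‖m k‖ₑ ≤ C) : Ell2 →L[ℂ] Ell2 :=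
  have hmem : ∀ a : Ell2, ∑' k, ‖m k * a k‖ₑ ^ 2 ≤ (C * ‖a‖ₑ) ^ 2 := fun a => by
    rw [mul_pow, ← tsum_enorm_sq, ← ENNReal.tsum_mul_left]
    refine ENNReal.tsum_le_tsum fun k => ?_
    rw [enorm_mul, mul_pow]
    gcongr
    exact hm k
  have hmem' : ∀ a : Ell2, Memℓp (fun k => m k * a k) 2 := fun a =>
    memℓp_two_iff.2 ((hmem a).trans_lt
      (ENNReal.pow_lt_top (ENNReal.mul_lt_top ENNReal.coe_lt_top enorm_lt_top)))
  LinearMap.mkContinuous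
    { toFun := fun a => toEll fun k => m k * a k
      map_add' := fun a b => by
        refine lp.ext (funext fun k => ?_)
        exact ((toEll_apply (hmem' (a + b)) k).trans (mul_add _ _ _)).trans
          (congrArg₂ (· + ·) (toEll_apply (hmem' a) k).symm (toEll_apply (hmem' b) k).symm)
      map_smul' := fun z a => by
        refine lp.ext (funext fun k => ?_)
        exact ((toEll_apply (hmem' (z • a)) k).trans (mul_left_comm _ z _)).trans
          (congrArg (z * ·) (toEll_apply (hmem' a) k).symm) } C fun a => by
      have h := (enorm_toEll_sq_le fun k => m k * a k).trans (hmem a)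
      have h2 := (ENNReal.pow_le_pow_left_iff two_ne_zero).1 h
      rw [← ofReal_norm, ← ofReal_norm, ← ENNReal.ofReal_coe_nnreal,
        ← ENNReal.ofReal_mul C.coe_nonneg, ENNReal.ofReal_le_ofReal_iff (by positivity)] at h2
      exact h2

theorem mulOp_apply (m : ℤ → ℂ) (C : ℝ≥0) (hm : ∀ k, ‖m k‖ₑ ≤ C) (a : Ell2) (k : ℤ) :
    mulOp m C hm a k = m k * a k := by
  refine toEll_apply (memℓp_two_iff.2 ?_) k
  refine lt_of_le_of_lt (b := ∑' k, (C : ℝ≥0∞) ^ 2 * ‖a k‖ₑ ^ 2)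
    (ENNReal.tsum_le_tsum fun k => ?_) ?_
  · rw [enorm_mul, mul_pow]
    gcongr
    exact hm k
  · rw [ENNReal.tsum_mul_left, tsum_enorm_sq]
    exact ENNReal.mul_lt_top (by simp) (by simp)

/-- The weight of the space `H⁻¹`. -/
def negWeight (k : ℤ) : ℂ := (((1 + (k : ℝ) ^ 2) ^ (-(1 / 2) : ℝ) : ℝ) : ℂ)

theorem enorm_negWeight_sq (k : ℤ) :
    ‖negWeight k‖ₑ ^ 2 = ENNReal.ofReal ((1 + (k : ℝ) ^ 2) ^ (-1 : ℝ)) := by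
  have h : (0 : ℝ) < 1 + (k : ℝ) ^ 2 := by positivity
  rw [negWeight, ← ofReal_norm, Complex.norm_real, Real.norm_of_nonneg (by positivity),
    ← ENNReal.ofReal_pow (by positivity), ← Real.rpow_natCast, ← Real.rpow_mul h.le]
  norm_num

theorem hsNorm_neg_one_sq (a : ℤ → ℂ) :
    hsNorm (-1) a ^ 2 = ∑' k, ‖negWeight k * a k‖ₑ ^ 2 := by
  rw [hsNorm_sq]
  simp_rw [enorm_mul, mul_pow, enorm_negWeight_sq]

theorem norm_negWeight_le (k : ℤ) : ‖negWeight k‖ₑ ≤ (1 : ℝ≥0) := by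
  refine (ENNReal.pow_le_pow_left_iff two_ne_zero).1 ?_
  rw [enorm_negWeight_sq, ENNReal.coe_one, one_pow, ENNReal.ofReal_le_one, Real.rpow_neg_one]
  exact inv_le_one_of_one_le₀ (by linarith [sq_nonneg (k : ℝ)])

theorem norm_negWeight_mul_le (k : ℤ) :
    ‖negWeight k * (2 * Real.pi * Complex.I * k)‖ₑ ≤ (7 : ℝ≥0) := by
  refine (ENNReal.pow_le_pow_left_iff two_ne_zero).1 ?_
  have h : (0 : ℝ) < 1 + (k : ℝ) ^ 2 := by positivity
  have e : ‖(2 * Real.pi * Complex.I * k : ℂ)‖ = freq k := by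
    simp [freq, abs_of_pos Real.pi_pos]
  rw [enorm_mul, mul_pow, enorm_negWeight_sq, ← ofReal_norm, e, ← ENNReal.ofReal_pow (freq_nonneg k),
    ← ENNReal.ofReal_mul (by positivity), ← ENNReal.ofReal_coe_nnreal,
    ← ENNReal.ofReal_pow (by positivity), Real.rpow_neg_one]
  refine ENNReal.ofReal_le_ofReal ?_
  rw [inv_mul_le_iff₀ h, mul_comm]
  exact freq_sq_le k

/-- The time derivative lies in `L^{4/3}(0, T; H⁻¹)`, so that Hölder's inequality gives the exponent
`1 - 3/4 = 1/4`. -/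
theorem CoeffSolution.hsNorm_sub_le {c : ℤ → ℂ} {p : ℝ → Ell2}
    (hc : Summable fun k => freq k * ‖c k‖ ^ 2) (hp : CoeffSolution (nonlin N) c (Ioo 0 T) p) :
    ∃ C : ℝ≥0, ∀ s t, 0 ≤ s → s ≤ t → t < T →
      hsNorm (-1) (heat c (src (nonlin N) T p) t - heat c (src (nonlin N) T p) s) ≤
        C * ENNReal.ofReal ((t - s) ^ (1 / 4 : ℝ)) := by
  set f := src (nonlin N) T p with hf
  have hloc : LocallyIntegrable f volume := hp.locallyIntegrable_src
  -- the time derivative of the solution, with the weight of `H⁻¹`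
  set h : ℝ → Ell2 := fun τ => mulOp _ 7 norm_negWeight_mul_le (p τ) +
    mulOp _ 1 norm_negWeight_le (f τ) with hh
  have hmem : MemLp h (4 / 3) (volume.restrict (Ioo 0 T)) := by
    have h1 : MemLp p (4 / 3) (volume.restrict (Ioo 0 T)) := hp.memLp.mono_exponent (by
      refine (ENNReal.div_le_iff (by norm_num) (by norm_num)).2 ?_
      norm_num)
    have h2 : MemLp f (4 / 3) (volume.restrict (Ioo 0 T)) := hp.memLp_src.restrict _
    have h3 := (mulOp _ 7 norm_negWeight_mul_le).comp_memLp' h1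
    have h4 := (mulOp _ 1 norm_negWeight_le).comp_memLp' h2
    exact h3.add h4
  refine ⟨(eLpNorm h (4 / 3) (volume.restrict (Ioo 0 T))).toNNReal, fun s t hs hst ht => ?_⟩
  rw [ENNReal.coe_toNNReal hmem.2.ne]
  have hsub : Ioc s t ⊆ Ioo 0 T := fun τ hτ => ⟨hs.trans_lt hτ.1, hτ.2.trans_lt ht⟩
  have hmem' : MemLp h (4 / 3) (volume.restrict (Ioc s t)) :=
    hmem.mono_measure (Measure.restrict_mono hsub le_rfl)
  have hint : Integrable h (volume.restrict (Ioc s t)) := hmem'.integrable one_le_four_thirds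
  set b : Ell2 := ∫ τ in Ioc s t, h τ with hb
  have hbk : ∀ k, negWeight k * (heat c f t - heat c f s) k = b k := by
    intro k
    have e1 : b k = ∫ τ in Ioc s t, h τ k :=
      ((lp.evalCLM ℂ (fun _ : ℤ => ℂ) 2 k).integral_comp_comm hint).symm
    rw [e1, Pi.sub_apply, heat, heat, duhamel_sub_eq_integral (locallyIntegrable_coord hloc k) hst,
      intervalIntegral.integral_of_le hst, ← integral_const_mul]
    refine setIntegral_congr_ae measurableSet_Ioc ?_
    filter_upwards [hp.ae_coe_eq hc] with τ h1 hτ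
    have h2 := congrFun (h1 (hsub hτ)) k
    simp only [hh]
    rw [lp.coeFn_add, Pi.add_apply, mulOp_apply, mulOp_apply, h2, grad, heat, freq_sq]
    push_cast
    linear_combination (-(negWeight k * (2 * Real.pi) ^ 2 * (k : ℂ) ^ 2 *
      duhamel ((2 * Real.pi) ^ 2 * (k : ℝ) ^ 2) (c k) (fun s => f s k) τ)) * Complex.I_sq
  have e2 : hsNorm (-1) (heat c f t - heat c f s) = ‖b‖ₑ := by
    have : hsNorm (-1) (heat c f t - heat c f s) ^ 2 = ‖b‖ₑ ^ 2 := by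
      rw [hsNorm_neg_one_sq, ← tsum_enorm_sq]
      simp_rw [hbk]
    exact le_antisymm ((ENNReal.pow_le_pow_left_iff two_ne_zero).1 this.le)
      ((ENNReal.pow_le_pow_left_iff two_ne_zero).1 this.ge)
  rw [e2]
  calc ‖b‖ₑ ≤ eLpNorm h 1 (volume.restrict (Ioc s t)) := by
        rw [eLpNorm_one_eq_lintegral_enorm]
        exact enorm_integral_le_lintegral_enorm _
    _ ≤ eLpNorm h (4 / 3) (volume.restrict (Ioc s t)) *
          (volume.restrict (Ioc s t)) univ ^ (1 / (1 : ℝ≥0∞).toReal - 1 / (4 / 3 : ℝ≥0∞).toReal) :=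
        eLpNorm_le_eLpNorm_mul_rpow_measure_univ one_le_four_thirds hmem'.1
    _ ≤ _ := by
        refine mul_le_mul' (eLpNorm_mono_measure _ (Measure.restrict_mono hsub le_rfl)) ?_
        have : (1 / (1 : ℝ≥0∞).toReal - 1 / (4 / 3 : ℝ≥0∞).toReal) = 1 / 4 := by
          rw [ENNReal.toReal_div]
          norm_num
        rw [this, Measure.restrict_apply_univ, Real.volume_Ioc,
          ENNReal.ofReal_rpow_of_nonneg (sub_nonneg.2 hst) (by norm_num)]

theorem IsSolution.holder (hT : 0 < T) (hζ₀ : MemHs (1 / 2) ζ₀) (h : IsSolution N ζ₀ T ζ) :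
    HolderHNegOne ζ₀ T ζ := by
  have hc := summable_of_hsNorm hζ₀.2
  have hp := h.coeffSolution hT hζ₀.1
  obtain ⟨C, hC⟩ := hp.hsNorm_sub_le hc
  set a := heat (coeff ζ₀) (src (nonlin N) T (derivEll ζ)) with ha
  have ha0 : a 0 = coeff ζ₀ := funext fun k => duhamel_zero
  refine ⟨a, fun t ht => ?_, ⟨C, fun s hs t ht => ?_⟩, ?_, ha0⟩
  · have h1 : Memℓp (fun k => negWeight k * (a t - a 0) k) 2 := by
      rw [memℓp_two_iff, ← hsNorm_neg_one_sq]
      exact ENNReal.pow_lt_top ((hC 0 t le_rfl ht.1 ht.2).trans_lt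
        (ENNReal.mul_lt_top ENNReal.coe_lt_top ENNReal.ofReal_lt_top))
    have h2 : Memℓp (fun k => negWeight k * a 0 k) 2 := by
      have := lp.memℓp (mulOp _ 1 norm_negWeight_le (toEll (coeff ζ₀)))
      refine (funext fun k => ?_ : (fun k => negWeight k * a 0 k) = _) ▸ this
      have e := toEll_apply (a := coeff ζ₀) (memℓp_fourierCoeff (memLp_ofReal hζ₀.1)) k
      exact (congrArg (negWeight k * ·) ((congrFun ha0 k).trans e.symm)).trans
        (mulOp_apply _ 1 norm_negWeight_le (toEll (coeff ζ₀)) k).symm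
    have h3 := h1.add h2
    rw [memℓp_two_iff] at h3
    have h4 : hsNorm (-1) (a t) ^ 2 < ⊤ := by
      rw [hsNorm_neg_one_sq]
      refine lt_of_eq_of_lt (tsum_congr fun k => ?_) h3
      rw [Pi.add_apply, Pi.sub_apply, ← mul_add, sub_add_cancel]
    by_contra hcon
    rw [not_lt, top_le_iff] at hcon
    simp [hcon] at h4
  · rcases le_total s t with hst | hst
    · rw [abs_of_nonneg (sub_nonneg.2 hst)]
      exact hC s t hs.1 hst ht.2
    · rw [abs_sub_comm, abs_of_nonneg (sub_nonneg.2 hst)]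
      refine le_trans (le_of_eq ?_) (hC t s ht.1 hst hs.2)
      rw [hsNorm, hsNorm]
      congr 2
      funext k
      rw [← neg_sub, Pi.neg_apply, enorm_neg]
  · rw [ae_restrict_iff' measurableSet_Ioo]
    filter_upwards [h.ae_coeff_eq hT hζ₀.1] with t h1 ht using (h1 ht).symm

/-! ### Reality of the solutions -/

/-- The Fourier coefficients of the complex conjugate. -/
def refl (a : ℤ → ℂ) (k : ℤ) : ℂ := starRingEnd ℂ (a (-k))

theorem refl_refl (a : ℤ → ℂ) : refl (refl a) = a := by
  funext k
  simp [refl]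

theorem fourierCoeff_conj (g : 𝕋 → ℂ) :
    fourierCoeff (fun x => starRingEnd ℂ (g x)) = refl (fourierCoeff g) := by
  funext k
  rw [refl, fourierCoeff, fourierCoeff, ← integral_conj]
  refine integral_congr_ae (ae_of_all _ fun x => ?_)
  simp only [smul_eq_mul, map_mul, neg_neg]
  rw [← fourier_neg]

theorem refl_coeff (f : 𝕋 → ℝ) : refl (coeff f) = coeff f := by
  rw [coeff, ← fourierCoeff_conj]
  simp

theorem prim_conj (g : 𝕋 → ℂ) :
    prim (fun x => starRingEnd ℂ (g x)) = fun x => starRingEnd ℂ (prim g x) := by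
  funext x
  obtain ⟨y, hy, rfl⟩ := exists_coe_eq x
  rw [prim_coe _ hy, prim_coe _ hy, primReal, primReal, map_sub, map_mul, Complex.conj_ofReal,
    integral_conj, intervalIntegral.integral_of_le hy.1, intervalIntegral.integral_of_le hy.1,
    integral_conj]

theorem sourceFun_conj (N : ℤ) (g : 𝕋 → ℂ) :
    sourceFun N (fun x => starRingEnd ℂ (g x)) = fun x => starRingEnd ℂ (sourceFun N g x) := by
  funext x
  have h := prim_conj fun y => g y * g y
  simp only [map_mul] at h
  simp only [sourceFun, h, prim_conj, integral_conj, map_add, map_mul, map_sub, map_pow,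
    Complex.conj_ofReal, map_ofNat, map_intCast]

theorem tsum_enorm_refl_sq (a : ℤ → ℂ) : ∑' k, ‖refl a k‖ₑ ^ 2 = ∑' k, ‖a k‖ₑ ^ 2 := by
  have : ∀ k, ‖refl a k‖ₑ = ‖a (-k)‖ₑ := fun k => by
    rw [refl, ← ofReal_norm, ← ofReal_norm, RCLike.norm_conj]
  simp_rw [this]
  exact (Equiv.neg ℤ).tsum_eq fun k => ‖a k‖ₑ ^ 2

theorem memℓp_refl {a : ℤ → ℂ} (h : Memℓp a 2) : Memℓp (refl a) 2 := by
  rw [memℓp_two_iff] at h ⊢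
  rwa [tsum_enorm_refl_sq]

/-- The reflection `refl` on `ℓ²`. -/
def reflEll (p : Ell2) : Ell2 := toEll (refl p)

theorem coe_reflEll (p : Ell2) : (reflEll p : ℤ → ℂ) = refl p :=
  coe_toEll (memℓp_refl (lp.memℓp p))

theorem enorm_reflEll (p : Ell2) : ‖reflEll p‖ₑ = ‖p‖ₑ := by
  have : ‖reflEll p‖ₑ ^ 2 = ‖p‖ₑ ^ 2 := by
    rw [← tsum_enorm_sq, ← tsum_enorm_sq, coe_reflEll, tsum_enorm_refl_sq]
  exact le_antisymm ((ENNReal.pow_le_pow_left_iff two_ne_zero).1 this.le)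
    ((ENNReal.pow_le_pow_left_iff two_ne_zero).1 this.ge)

theorem reflEll_toEll (a : ℤ → ℂ) : reflEll (toEll a) = toEll (refl a) := by
  by_cases h : Memℓp a 2
  · rw [reflEll, coe_toEll h]
  · have h' : ¬ Memℓp (refl a) 2 := fun h2 => h (by have := memℓp_refl h2; rwa [refl_refl] at this)
    have h0 : refl ((0 : Ell2) : ℤ → ℂ) = ((0 : Ell2) : ℤ → ℂ) := by
      funext k
      simp [refl]
    rw [toEll, dif_neg h, toEll, dif_neg h', reflEll, h0, toEll_coe]

/-- The nonlinearity is a real operator. -/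
theorem nonlin_app_refl (N : ℤ) (p : Ell2) :
    (nonlin N).app (reflEll p) = reflEll ((nonlin N).app p) := by
  have h1 := nonlin_app N (memLp_synth p) (p := p) (fourierCoeff_synth p).symm
  have h2 := nonlin_app N (memLp_synth p).star (p := reflEll p) (by
    rw [coe_reflEll, ← fourierCoeff_synth p]
    exact (fourierCoeff_conj _).symm)
  refine lp.ext ?_
  rw [coe_reflEll, h1, h2]
  exact (congrArg _ (sourceFun_conj N (synth p))).trans (fourierCoeff_conj _)

theorem duhamel_conj (l : ℝ) (c : ℂ) (f : ℝ → ℂ) (t : ℝ) :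
    duhamel l (starRingEnd ℂ c) (fun s => starRingEnd ℂ (f s)) t =
      starRingEnd ℂ (duhamel l c f t) := by
  have h : ∀ a b : ℝ, ∫ s in a..b, (Real.exp (l * s) : ℂ) * starRingEnd ℂ (f s) =
      starRingEnd ℂ (∫ s in a..b, (Real.exp (l * s) : ℂ) * f s) := fun a b => by
    rw [intervalIntegral, intervalIntegral, map_sub, ← integral_conj, ← integral_conj]
    simp only [map_mul, Complex.conj_ofReal]
  rw [duhamel, duhamel, h, map_mul, map_add, Complex.conj_ofReal]

theorem heat_refl (c : ℤ → ℂ) (f : ℝ → Ell2) (t : ℝ) :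
    heat (refl c) (fun s => reflEll (f s)) t = refl (heat c f t) := by
  funext k
  have e : freq (-k) = freq k := by simp [freq]
  rw [refl, heat, heat, e, ← duhamel_conj]
  simp only [coe_reflEll]
  rfl

theorem grad_refl (a : ℤ → ℂ) : grad (refl a) = refl (grad a) := by
  funext k
  simp only [grad, refl, map_mul, Complex.conj_I, Complex.conj_ofReal, map_ofNat, map_intCast]
  push_cast
  ring

variable {N : ℤ} {c : ℤ → ℂ} {T : ℝ} {p : ℝ → Ell2}

theorem src_refl (N : ℤ) (T : ℝ) (p : ℝ → Ell2) :
    src (nonlin N) T (fun t => reflEll (p t)) = fun t => reflEll (src (nonlin N) T p t) := by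
  funext t
  by_cases ht : t ∈ Ioo 0 T
  · rw [src_apply ht, src_apply ht, nonlin_app_refl]
  · have h0 : reflEll 0 = 0 := by
      rw [← enorm_eq_zero, enorm_reflEll, enorm_zero]
    rw [src, src, indicator_of_notMem ht, indicator_of_notMem ht, h0]

theorem CoeffSolution.refl (hp : CoeffSolution (nonlin N) c (Ioo 0 T) p) :
    CoeffSolution (nonlin N) (refl c) (Ioo 0 T) (fun t => reflEll (p t)) := by
  refine ⟨⟨aestronglyMeasurable_ell2 fun k => ?_, ?_⟩, ?_⟩
  · simp only [coe_reflEll]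
    exact Complex.continuous_conj.comp_aestronglyMeasurable (aestronglyMeasurable_coord hp.memLp.1 _)
  · refine lt_of_eq_of_lt ?_ hp.memLp.2
    exact eLpNorm_congr_enorm_ae (ae_of_all _ fun t => enorm_reflEll _)
  · filter_upwards [hp.eq] with t ht
    rw [ht, flow, reflEll_toEll, ← grad_refl, ← heat_refl]
    exact congrArg (fun f => flow (LimitSystem.refl c) f t) (src_refl N T p).symm

/-- The solution is real if the datum is. -/
theorem CoeffSolution.refl_heat (hc : Summable fun k => freq k * ‖c k‖ ^ 2)
    (hp : CoeffSolution (nonlin N) c (Ioo 0 T) p) (hcr : LimitSystem.refl c = c) {t : ℝ}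
    (ht : 0 ≤ t) :
    LimitSystem.refl (heat c (src (nonlin N) T p) t) = heat c (src (nonlin N) T p) t := by
  have h1 := hp.refl
  rw [hcr] at h1
  have h2 := CoeffSolution.unique hc h1 hp
  rw [Filter.EventuallyEq, ae_restrict_iff' measurableSet_Ioo] at h2
  rw [← heat_refl, hcr, ← src_refl]
  refine heat_congr ht ?_
  filter_upwards [h2] with s hs _
  by_cases hmem : s ∈ Ioo 0 T
  · rw [src_apply hmem, src_apply hmem, hs hmem]
  · rw [src, src, indicator_of_notMem hmem, indicator_of_notMem hmem]

theorem torusSeries_re {a : ℤ → ℂ} (ha : LimitSystem.refl a = a) (x : 𝕋) :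
    ((torusSeries a x).re : ℂ) = torusSeries a x := by
  rw [← Complex.conj_eq_iff_re, torusSeries, Complex.conj_tsum]
  refine (Equiv.neg ℤ).tsum_eq (fun k => a k * (fourier k x : ℂ)) |>.symm.trans ?_ |>.symm
  refine tsum_congr fun k => ?_
  rw [Equiv.neg_apply, map_mul, fourier_neg]
  congr 1
  have := congrFun ha (-k)
  rw [LimitSystem.refl, neg_neg] at this
  exact this.symm

/-! ### Fourier coefficients of test functions -/

/-- Continuity on `ℝ × 𝕋` may be checked on the covering `ℝ × ℝ`. -/
theorem continuous_of_continuous_coe {f : ℝ → 𝕋 → ℝ}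
    (hf : Continuous fun q : ℝ × ℝ => f q.1 (q.2 : 𝕋)) :
    Continuous fun q : ℝ × 𝕋 => f q.1 q.2 := by
  have h1 : IsOpenQuotientMap (Prod.map id ((↑) : ℝ → 𝕋) : ℝ × ℝ → ℝ × 𝕋) :=
    IsOpenQuotientMap.id.prodMap QuotientAddGroup.isOpenQuotientMap_mk
  exact h1.isQuotientMap.continuous_iff.2 hf

/-- The first space derivative of a function on `ℝ × 𝕋`. -/
def dx (φ : ℝ → 𝕋 → ℝ) (t : ℝ) (x : 𝕋) : ℝ :=
  deriv (fun y : ℝ => φ t (x + (y : 𝕋))) 0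

theorem hasDerivAt_snd {Ψ : ℝ × ℝ → ℝ} (hΨ : ContDiff ℝ ∞ Ψ) (t y s : ℝ) :
    HasDerivAt (fun s => Ψ (t, y + s)) (fderiv ℝ Ψ (t, y + s) (0, 1)) s := by
  have h1 : HasDerivAt (fun s : ℝ => (t, y + s)) ((0 : ℝ), (1 : ℝ)) s :=
    (hasDerivAt_const s t).prodMk ((hasDerivAt_id s).const_add y)
  exact ((hΨ.differentiable (by simp)) (t, y + s)).hasFDerivAt.comp_hasDerivAt s h1

theorem contDiff_fderiv_apply {Ψ : ℝ × ℝ → ℝ} (hΨ : ContDiff ℝ ∞ Ψ) (w : ℝ × ℝ) :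
    ContDiff ℝ ∞ fun q => fderiv ℝ Ψ q w :=
  (hΨ.fderiv_right (by simp)).clm_apply contDiff_const

namespace IsTest

variable {T : ℝ} {φ : ℝ → 𝕋 → ℝ}

theorem hasDerivAt_coe (h : IsTest T φ) (t y : ℝ) : HasDerivAt (fun s => φ s (y : 𝕋))
    (fderiv ℝ (fun q : ℝ × ℝ => φ q.1 (q.2 : 𝕋)) (t, y) (1, 0)) t := by
  have h1 : HasDerivAt (fun s : ℝ => (s, y)) ((1 : ℝ), (0 : ℝ)) t :=
    (hasDerivAt_id t).prodMk (hasDerivAt_const t y)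
  exact ((h.smooth.differentiable (by simp)) (t, y)).hasFDerivAt.comp_hasDerivAt t h1

theorem hasDerivAt_time (h : IsTest T φ) (t : ℝ) (x : 𝕋) :
    HasDerivAt (fun s => φ s x) (dt φ t x) t := by
  obtain ⟨y, -, rfl⟩ := exists_coe_eq x
  exact (h.hasDerivAt_coe t y).differentiableAt.hasDerivAt

theorem dx_coe (h : IsTest T φ) (t y : ℝ) :
    dx φ t (y : 𝕋) = fderiv ℝ (fun q : ℝ × ℝ => φ q.1 (q.2 : 𝕋)) (t, y) (0, 1) := by
  have := (hasDerivAt_snd h.smooth t y 0).deriv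
  rw [add_zero] at this
  simpa only [dx, QuotientAddGroup.mk_add, AddCircle.coe_add] using this

theorem dxx_coe (h : IsTest T φ) (t y : ℝ) :
    dxx φ t (y : 𝕋) = fderiv ℝ (fun q => fderiv ℝ (fun q : ℝ × ℝ => φ q.1 (q.2 : 𝕋)) q (0, 1))
      (t, y) (0, 1) := by
  have h1 : deriv (fun s : ℝ => φ t ((y : 𝕋) + (s : 𝕋))) = fun s =>
      fderiv ℝ (fun q : ℝ × ℝ => φ q.1 (q.2 : 𝕋)) (t, y + s) (0, 1) := by
    funext s
    have := (hasDerivAt_snd h.smooth t y s).deriv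
    simpa only [AddCircle.coe_add] using this
  have := (hasDerivAt_snd (contDiff_fderiv_apply h.smooth (0, 1)) t y 0).deriv
  rw [add_zero] at this
  rw [dxx, iteratedDeriv_succ, iteratedDeriv_one, h1, this]

theorem hasDerivAt_space (h : IsTest T φ) (t y : ℝ) :
    HasDerivAt (fun y : ℝ => φ t (y : 𝕋)) (dx φ t y) y := by
  have := hasDerivAt_snd h.smooth t 0 y
  simp only [zero_add] at this
  rwa [h.dx_coe]

theorem hasDerivAt_dx (h : IsTest T φ) (t y : ℝ) :
    HasDerivAt (fun y : ℝ => dx φ t (y : 𝕋)) (dxx φ t y) y := by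
  have := hasDerivAt_snd (contDiff_fderiv_apply h.smooth (0, 1)) t 0 y
  simp only [zero_add] at this
  rw [h.dxx_coe]
  simpa only [h.dx_coe] using this

theorem continuous (h : IsTest T φ) : Continuous fun q : ℝ × 𝕋 => φ q.1 q.2 :=
  continuous_of_continuous_coe h.smooth.continuous

theorem continuous_dt (h : IsTest T φ) : Continuous fun q : ℝ × 𝕋 => dt φ q.1 q.2 := by
  refine continuous_of_continuous_coe ?_
  refine (contDiff_fderiv_apply h.smooth (1, 0)).continuous.congr fun q => ?_
  exact (h.hasDerivAt_coe q.1 q.2).deriv.symm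

theorem continuous_dx (h : IsTest T φ) : Continuous fun q : ℝ × 𝕋 => dx φ q.1 q.2 := by
  refine continuous_of_continuous_coe ?_
  exact (contDiff_fderiv_apply h.smooth (0, 1)).continuous.congr fun q => (h.dx_coe q.1 q.2).symm

theorem continuous_dxx (h : IsTest T φ) : Continuous fun q : ℝ × 𝕋 => dxx φ q.1 q.2 := by
  refine continuous_of_continuous_coe ?_
  exact (contDiff_fderiv_apply (contDiff_fderiv_apply h.smooth (0, 1)) (0, 1)).continuous.congr
    fun q => (h.dxx_coe q.1 q.2).symm

end IsTest

theorem continuous_slice {f : ℝ → 𝕋 → ℝ} (hf : Continuous fun q : ℝ × 𝕋 => f q.1 q.2) (t : ℝ) :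
    Continuous (f t) :=
  hf.comp (Continuous.prodMk_right t)

/-- The Fourier coefficients of the derivative of a function on the circle. -/
theorem coeff_deriv {f f' : 𝕋 → ℝ} (hf' : Continuous f')
    (h : ∀ y : ℝ, HasDerivAt (fun y : ℝ => f (y : 𝕋)) (f' y) y) (k : ℤ) :
    coeff f' k = 2 * Real.pi * Complex.I * k * coeff f k := by
  have hf : Continuous fun y : ℝ => f (y : 𝕋) :=
    continuous_iff_continuousAt.2 fun y => (h y).continuousAt
  have e : ∀ g : 𝕋 → ℝ, coeff g k = ∫ y in (0 : ℝ)..1, (fourier (-k) (y : 𝕋) : ℂ) * (g y : ℂ) :=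
    fun g => by
      rw [coeff_eq_integral, ← intervalIntegral_coe_zero]
  have hd : ∀ y : ℝ, HasDerivAt (fun y : ℝ => (fourier (-k) (y : 𝕋) : ℂ) * (f (y : 𝕋) : ℂ))
      ((fourier (-k) (y : 𝕋) : ℂ) * (f' y : ℂ) -
        2 * Real.pi * Complex.I * k * ((fourier (-k) (y : 𝕋) : ℂ) * (f y : ℂ))) y := fun y => by
    convert! (hasDerivAt_fourier_unit (-k) y).mul (h y).ofReal_comp using 1
    push_cast
    ring
  have hc : Continuous fun y : ℝ => (fourier (-k) (y : 𝕋) : ℂ) := (contDiff_fourier_coe (-k)).continuous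
  have hc1 : Continuous fun y : ℝ => (fourier (-k) (y : 𝕋) : ℂ) * (f' y : ℂ) :=
    hc.mul (Complex.continuous_ofReal.comp (hf'.comp (AddCircle.continuous_mk' 1)))
  have hc2 : Continuous fun y : ℝ => 2 * Real.pi * Complex.I * k *
      ((fourier (-k) (y : 𝕋) : ℂ) * (f y : ℂ)) :=
    continuous_const.mul (hc.mul (Complex.continuous_ofReal.comp hf))
  have h1 := intervalIntegral.integral_eq_sub_of_hasDerivAt (a := 0) (b := 1) (fun y _ => hd y)
    ((hc1.sub hc2).intervalIntegrable _ _)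
  rw [intervalIntegral.integral_sub (hc1.intervalIntegrable _ _) (hc2.intervalIntegrable _ _),
    intervalIntegral.integral_const_mul, ← e, ← e] at h1
  have e1 : ((1 : ℝ) : 𝕋) = ((0 : ℝ) : 𝕋) := by
    rw [AddCircle.coe_period]
    rfl
  rw [e1, sub_self] at h1
  exact sub_eq_zero.1 h1

/-- The Fourier coefficients of a continuous function on the circle, with its sup norm. -/
theorem tsum_enorm_coeff_sq_le {f : 𝕋 → ℝ} (hf : Continuous f) {C : ℝ≥0} (hC : ∀ x, ‖f x‖ ≤ C) :
    ∑' k, ‖coeff f k‖ₑ ^ 2 ≤ (C : ℝ≥0∞) ^ 2 := by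
  have hm : MemLp (fun x => (f x : ℂ)) 2 μ𝕋 :=
    memLp_of_continuous (Complex.continuous_ofReal.comp hf) 2
  have h1 := tsum_enorm_sq (fourierEquiv (hm.toLp _))
  rw [coe_fourierEquiv_toLp] at h1
  refine h1.le.trans ?_
  gcongr
  rw [LinearIsometryEquiv.enorm_map]
  rw [Lp.enorm_toLp]
  refine (eLpNorm_le_of_ae_bound (C := C) (ae_of_all _ fun x => by simpa using hC x)).trans ?_
  simp

theorem hasDerivAt_coeff {φ φ' : ℝ → 𝕋 → ℝ} (hφ : Continuous fun q : ℝ × 𝕋 => φ q.1 q.2)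
    (hφ' : Continuous fun q : ℝ × 𝕋 => φ' q.1 q.2)
    (h : ∀ t x, HasDerivAt (fun s => φ s x) (φ' t x) t) (k : ℤ) (t : ℝ) :
    HasDerivAt (fun s => coeff (φ s) k) (coeff (φ' t) k) t := by
  obtain ⟨C, hC⟩ := ((isCompact_closedBall t 1).prod (isCompact_univ (X := 𝕋)))
    |>.exists_bound_of_continuousOn hφ'.continuousOn
  have hF : ∀ s, Continuous fun x => (fourier (-k) x : ℂ) * (φ s x : ℂ) := fun s =>
    (by fun_prop : Continuous fun x : 𝕋 => (fourier (-k) x : ℂ)).mul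
      (Complex.continuous_ofReal.comp (continuous_slice hφ s))
  have hF' : Continuous fun x => (fourier (-k) x : ℂ) * (φ' t x : ℂ) :=
    (by fun_prop : Continuous fun x : 𝕋 => (fourier (-k) x : ℂ)).mul
      (Complex.continuous_ofReal.comp (continuous_slice hφ' t))
  exact (hasDerivAt_integral_of_dominated_loc_of_deriv_le (μ := μ𝕋) (bound := fun _ => C)
    (F := fun s x => (fourier (-k) x : ℂ) * (φ s x : ℂ))
    (F' := fun s x => (fourier (-k) x : ℂ) * (φ' s x : ℂ))
    (Metric.ball_mem_nhds t one_pos) (Filter.Eventually.of_forall fun s => (hF s).aestronglyMeasurable)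
    ((memLp_of_continuous (hF t) 1).integrable le_rfl) hF'.aestronglyMeasurable
    (ae_of_all _ fun x s hs => by
      rw [norm_mul, norm_fourier, one_mul, Complex.norm_real]
      exact hC (s, x) ⟨Metric.ball_subset_closedBall hs, mem_univ _⟩)
    (integrable_const _)
    (ae_of_all _ fun x s _ => ((h s x).ofReal_comp).const_mul _)).2

theorem continuous_coeff {φ : ℝ → 𝕋 → ℝ} (hφ : Continuous fun q : ℝ × 𝕋 => φ q.1 q.2) (k : ℤ) :
    Continuous fun t => coeff (φ t) k := by
  have h : Continuous (Function.uncurry fun (t : ℝ) (x : 𝕋) => (fourier (-k) x : ℂ) * (φ t x : ℂ)) :=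
    (by fun_prop : Continuous fun q : ℝ × 𝕋 => (fourier (-k) q.2 : ℂ)).mul
      (Complex.continuous_ofReal.comp hφ)
  have := continuous_parametric_integral_of_continuous (μ := μ𝕋) h isCompact_univ
  simp_rw [Measure.restrict_univ] at this
  exact this

namespace IsTest

variable {T : ℝ} {φ : ℝ → 𝕋 → ℝ}

theorem coeff_dxx (h : IsTest T φ) (t : ℝ) (k : ℤ) :
    coeff (dxx φ t) k = -(freq k ^ 2 : ℝ) * coeff (φ t) k := by
  rw [coeff_deriv (continuous_slice h.continuous_dxx t) (h.hasDerivAt_dx t),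
    coeff_deriv (continuous_slice h.continuous_dx t) (h.hasDerivAt_space t), freq_sq]
  push_cast
  linear_combination ((2 * Real.pi) ^ 2 * (k : ℂ) ^ 2 * coeff (φ t) k) * Complex.I_sq

theorem exists_bound (h : IsTest T φ) : ∃ C : ℝ≥0, ∀ t ∈ Icc 0 T, ∀ x,
    ‖φ t x‖ ≤ C ∧ ‖dt φ t x + dxx φ t x‖ ≤ C := by
  have hK := isCompact_Icc (a := 0) (b := T) |>.prod (isCompact_univ (X := 𝕋))
  obtain ⟨C₁, h₁⟩ := hK.exists_bound_of_continuousOn h.continuous.continuousOn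
  obtain ⟨C₂, h₂⟩ := hK.exists_bound_of_continuousOn
    (h.continuous_dt.add h.continuous_dxx).continuousOn
  refine ⟨(max C₁ C₂).toNNReal, fun t ht x => ⟨?_, ?_⟩⟩
  · exact (h₁ (t, x) ⟨ht, mem_univ _⟩).trans ((le_max_left _ _).trans (Real.le_coe_toNNReal _))
  · exact (h₂ (t, x) ⟨ht, mem_univ _⟩).trans ((le_max_right _ _).trans (Real.le_coe_toNNReal _))

end IsTest

/-! ### The weak formulation from Duhamel's formula -/

/-- The Cauchy-Schwarz inequality for series in `[0, ∞]`. -/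
theorem tsum_enorm_mul_le {a b : ℤ → ℂ} {X Y : ℝ≥0∞} (ha : ∑' k, ‖a k‖ₑ ^ 2 ≤ X ^ 2)
    (hb : ∑' k, ‖b k‖ₑ ^ 2 ≤ Y ^ 2) : ∑' k, ‖a k * b k‖ₑ ≤ X * Y := by
  rw [ENNReal.tsum_eq_iSup_sum]
  refine iSup_le fun s => ?_
  have h := ENNReal.inner_le_Lp_mul_Lq s (fun k => ‖a k‖ₑ) (fun k => ‖b k‖ₑ)
    (p := 2) (q := 2) Real.HolderConjugate.two_two
  simp_rw [enorm_mul]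
  refine h.trans ?_
  have key : ∀ {c : ℤ → ℂ} {Z : ℝ≥0∞}, ∑' k, ‖c k‖ₑ ^ 2 ≤ Z ^ 2 →
      (∑ k ∈ s, ‖c k‖ₑ ^ (2 : ℝ)) ^ (1 / 2 : ℝ) ≤ Z := fun {c Z} hc => by
    simp_rw [ENNReal.rpow_two]
    calc (∑ k ∈ s, ‖c k‖ₑ ^ 2) ^ (1 / 2 : ℝ) ≤ (Z ^ 2) ^ (1 / 2 : ℝ) :=
          ENNReal.rpow_le_rpow ((ENNReal.sum_le_tsum s).trans hc) (by norm_num)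
      _ = Z := by
          rw [← ENNReal.rpow_natCast, ← ENNReal.rpow_mul]
          norm_num
  exact mul_le_mul' (key ha) (key hb)

/-- Parseval's identity for real functions. -/
theorem hasSum_coeff_mul_coeff_neg {f h : 𝕋 → ℝ} (hf : MemLp f 2 μ𝕋) (hh : Continuous h) :
    HasSum (fun k => coeff f k * coeff h (-k)) ((∫ x, f x * h x ∂μ𝕋 : ℝ) : ℂ) := by
  have h1 := hasSum_fourierCoeff_mul (memLp_ofReal hf)
    (memLp_of_continuous (Complex.continuous_ofReal.comp hh) 2) 0
  simp only [zero_sub] at h1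
  rw [fourierCoeff_zero_eq] at h1
  convert! h1 using 1
  refine (integral_ofReal (𝕜 := ℂ)).symm.trans (integral_congr_ae (ae_of_all _ fun x => ?_))
  simp

theorem tsum_enorm_coeff_neg_sq (f : 𝕋 → ℝ) :
    ∑' k, ‖coeff f (-k)‖ₑ ^ 2 = ∑' k, ‖coeff f k‖ₑ ^ 2 :=
  (Equiv.neg ℤ).tsum_eq fun k => ‖coeff f k‖ₑ ^ 2

theorem freq_neg (k : ℤ) : freq (-k) = freq k := by simp [freq]

/-- The weak formulation for a single Fourier mode. -/
theorem integral_heat_mul {T : ℝ} (hT : 0 < T) {φ : ℝ → 𝕋 → ℝ} (hφ : IsTest T φ) {c : ℤ → ℂ}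
    {f : ℝ → Ell2} (hf : LocallyIntegrable f volume) (k : ℤ) :
    ∫ t in Ioo 0 T, (heat c f t k * coeff (fun x => dt φ t x + dxx φ t x) (-k) +
      f t k * coeff (φ t) (-k)) = -(c k * coeff (φ 0) (-k)) := by
  have h1 := duhamel_mul_sub (l := freq k ^ 2) (c := c k) (locallyIntegrable_coord hf k) hT.le
    (hasDerivAt_coeff hφ.continuous hφ.continuous_dt hφ.hasDerivAt_time (-k))
    (continuous_coeff hφ.continuous_dt (-k))
  obtain ⟨T', hT', hs⟩ := hφ.support
  have h2 : coeff (φ T) (-k) = 0 := by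
    have : φ T = fun _ => 0 := funext (hs T hT')
    simp [coeff, this, fourierCoeff]
  rw [h2, mul_zero, duhamel_zero, zero_sub, intervalIntegral.integral_of_le hT.le,
    integral_Ioc_eq_integral_Ioo] at h1
  rw [h1]
  refine integral_congr_ae (ae_of_all _ fun t => ?_)
  have e : coeff (fun x => dt φ t x + dxx φ t x) (-k) = coeff (dt φ t) (-k) + coeff (dxx φ t) (-k) := by
    have hi : ∀ {g : 𝕋 → ℝ}, Continuous g → Integrable (fun x => (g x : ℂ)) μ𝕋 := fun hg =>
      (memLp_of_continuous (Complex.continuous_ofReal.comp hg) 1).integrable le_rfl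
    rw [coeff, coeff, coeff, fourierCoeff, fourierCoeff, fourierCoeff, ← integral_add
      ((hi (continuous_slice hφ.continuous_dt t)).fourier_smul _)
      ((hi (continuous_slice hφ.continuous_dxx t)).fourier_smul _)]
    refine integral_congr_ae (ae_of_all _ fun x => ?_)
    simp only [smul_eq_mul]
    push_cast
    ring
  simp only [e, hφ.coeff_dxx, freq_neg, heat]
  push_cast
  ring

/-- A function whose Fourier coefficients are given by Duhamel's formula is a distributional
solution of the heat equation. -/
theorem weak_form {T : ℝ} (hT : 0 < T) {φ : ℝ → 𝕋 → ℝ} (hφ : IsTest T φ) {ζ₀ : 𝕋 → ℝ}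
    (hζ₀ : MemLp ζ₀ 2 μ𝕋) {f : ℝ → Ell2} (hf : LocallyIntegrable f volume) {z s : ℝ → 𝕋 → ℝ}
    (hz : ∀ᵐ t ∂volume.restrict (Ioo 0 T), MemLp (z t) 2 μ𝕋 ∧ coeff (z t) = heat (coeff ζ₀) f t)
    (hs : ∀ᵐ t ∂volume.restrict (Ioo 0 T), MemLp (s t) 2 μ𝕋 ∧ coeff (s t) = f t)
    {X : ℝ → ℝ≥0∞} (hX : ∀ t, ∑' k, ‖heat (coeff ζ₀) f t k‖ₑ ^ 2 ≤ X t ^ 2)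
    (hXi : ∫⁻ t in Ioo 0 T, X t < ⊤) :
    (∫ t in Ioo 0 T, ∫ x, (z t x * (dt φ t x + dxx φ t x) + s t x * φ t x) ∂μ𝕋)
      + ∫ x, ζ₀ x * φ 0 x ∂μ𝕋 = 0 := by
  set η : ℝ → 𝕋 → ℝ := fun t x => dt φ t x + dxx φ t x with hη
  have hηc : Continuous fun q : ℝ × 𝕋 => η q.1 q.2 := hφ.continuous_dt.add hφ.continuous_dxx
  set G : ℤ → ℝ → ℂ := fun k t =>
    heat (coeff ζ₀) f t k * coeff (η t) (-k) + f t k * coeff (φ t) (-k) with hG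
  have hGm : ∀ k, AEStronglyMeasurable (G k) (volume.restrict (Ioo 0 T)) := fun k =>
    ((continuous_heat hf k).mul (continuous_coeff hηc (-k))).aestronglyMeasurable.add
      ((locallyIntegrable_coord hf k).aestronglyMeasurable.restrict.mul
        (continuous_coeff hφ.continuous (-k)).aestronglyMeasurable)
  obtain ⟨C, hC⟩ := hφ.exists_bound
  have hsum : ∀ t ∈ Ioo 0 T, ∑' k, ‖G k t‖ₑ ≤ C * (X t + ‖f t‖ₑ) := fun t ht => by
    have htI := Ioo_subset_Icc_self ht
    have h1 := tsum_enorm_mul_le (hX t) ((tsum_enorm_coeff_neg_sq (η t)).le.trans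
      (tsum_enorm_coeff_sq_le (continuous_slice hηc t) fun x => (hC t htI x).2))
    have h2 := tsum_enorm_mul_le (tsum_enorm_sq (f t)).le ((tsum_enorm_coeff_neg_sq (φ t)).le.trans
      (tsum_enorm_coeff_sq_le (continuous_slice hφ.continuous t) fun x => (hC t htI x).1))
    calc ∑' k, ‖G k t‖ₑ ≤ ∑' k, (‖heat (coeff ζ₀) f t k * coeff (η t) (-k)‖ₑ +
          ‖f t k * coeff (φ t) (-k)‖ₑ) := ENNReal.tsum_le_tsum fun k => enorm_add_le _ _
      _ ≤ X t * C + ‖f t‖ₑ * C := by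
          rw [ENNReal.tsum_add]
          exact add_le_add h1 h2
      _ = _ := by ring
  -- this allows to exchange the sum over the modes and the integral over time
  have hfin : ∑' k, ∫⁻ t in Ioo 0 T, ‖G k t‖ₑ ≠ ⊤ := by
    rw [← lintegral_tsum fun k => (hGm k).enorm]
    refine ne_of_lt ((setLIntegral_mono' measurableSet_Ioo hsum).trans_lt ?_)
    have hfi : IntegrableOn f (Ioo 0 T) :=
      (hf.integrableOn_isCompact isCompact_Icc).mono_set Ioo_subset_Icc_self
    rw [lintegral_const_mul' _ _ ENNReal.coe_ne_top, lintegral_add_right' _ hfi.1.enorm]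
    exact ENNReal.mul_lt_top ENNReal.coe_lt_top (ENNReal.add_lt_top.2 ⟨hXi, hfi.2⟩)
  have h1 : ((∫ t in Ioo 0 T, ∫ x, (z t x * η t x + s t x * φ t x) ∂μ𝕋 : ℝ) : ℂ) =
      ∑' k, -(coeff ζ₀ k * coeff (φ 0) (-k)) := by
    rw [← tsum_congr fun k => integral_heat_mul hT hφ hf k, ← integral_tsum hGm hfin]
    refine (integral_ofReal (𝕜 := ℂ)).symm.trans (integral_congr_ae ?_)
    filter_upwards [hz, hs] with t hz hs
    have hzη := hasSum_coeff_mul_coeff_neg hz.1 (continuous_slice hηc t)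
    have hsφ := hasSum_coeff_mul_coeff_neg hs.1 (continuous_slice hφ.continuous t)
    have hmul : ∀ {w g : 𝕋 → ℝ}, MemLp w 2 μ𝕋 → Continuous g →
        Integrable (fun x => w x * g x) μ𝕋 := fun {w g} hw hg => by
      have hg' := memLp_of_continuous (Complex.continuous_ofReal.comp hg) 2
      have h := (integrable_mul_of_memLp (memLp_ofReal hw) hg').re
      refine h.congr (ae_of_all _ fun x => ?_)
      simp
    rw [integral_add (hmul hz.1 (continuous_slice hηc t))
      (hmul hs.1 (continuous_slice hφ.continuous t))]
    refine (Complex.ofReal_add _ _).trans ?_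
    rw [← hzη.tsum_eq, ← hsφ.tsum_eq, ← hzη.summable.tsum_add hsφ.summable]
    refine tsum_congr fun k => ?_
    rw [hz.2, hs.2]
  have h2 := (hasSum_coeff_mul_coeff_neg hζ₀ (continuous_slice hφ.continuous 0)).tsum_eq
  rw [tsum_neg, h2] at h1
  have h3 : (∫ t in Ioo 0 T, ∫ x, (z t x * η t x + s t x * φ t x) ∂μ𝕋) =
      -∫ x, ζ₀ x * φ 0 x ∂μ𝕋 := by exact_mod_cast h1
  rw [h3, neg_add_cancel]

/-! ### Existence of weak solutions -/

theorem continuous_re_torusSeries {a : ℤ → ℂ} (ha : Summable a) :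
    Continuous fun x => (torusSeries a x).re :=
  Complex.continuous_re.comp (continuous_torusSeries ha)

theorem coeff_re_torusSeries {a : ℤ → ℂ} (ha : Summable a) (har : refl a = a) :
    coeff (fun x => (torusSeries a x).re) = a := by
  rw [coeff, funext (torusSeries_re har), fourierCoeff_torusSeries ha]

theorem memLp_of_continuous_real {f : 𝕋 → ℝ} (hf : Continuous f) (q : ℝ≥0∞) : MemLp f q μ𝕋 := by
  have h := (memLp_of_continuous (Complex.continuous_ofReal.comp hf) q).re
  exact h.congr_norm hf.aestronglyMeasurable (ae_of_all _ fun x => by simp)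

/-- The velocity associated with a derivative `p`. -/
def velocity (p : 𝕋 → ℝ) (x : 𝕋) : ℝ := -(prim (fun y => ((p y ^ 2 : ℝ) : ℂ)) x).re

theorem isVelocity_velocity {p : 𝕋 → ℝ} (hp : Continuous p) : IsVelocity p (velocity p) := by
  have hpc : Continuous fun y => ((p y ^ 2 : ℝ) : ℂ) := Complex.continuous_ofReal.comp (hp.pow 2)
  have hpi : Integrable (fun y => ((p y ^ 2 : ℝ) : ℂ)) μ𝕋 :=
    (memLp_of_continuous hpc 1).integrable le_rfl
  have hpr : Integrable (fun y => p y ^ 2) μ𝕋 :=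
    (memLp_of_continuous_real (hp.pow 2) 1).integrable le_rfl
  have hc : Continuous (velocity p) := (Complex.continuous_re.comp (continuous_prim hpi)).neg
  refine ⟨hc, by simp [velocity, prim_zero], (memLp_of_continuous_real hc 1).integrable le_rfl,
    hpr.neg.add (integrable_const _), fun k => ?_⟩
  have e : (fun x => ((-(p x) ^ 2 + ∫ y, (p y) ^ 2 ∂μ𝕋 : ℝ) : ℂ)) = fun x =>
      ((∫ y, (p y) ^ 2 ∂μ𝕋 : ℝ) : ℂ) - ((p x ^ 2 : ℝ) : ℂ) := by
    funext x; push_cast; ring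
  rw [coeff, e, fourierCoeff_sub (integrable_const _) hpi]
  rcases eq_or_ne k 0 with rfl | hk
  · rw [fourierCoeff_zero_eq, fourierCoeff_zero_eq]
    have : ∫ x, ((p x ^ 2 : ℝ) : ℂ) ∂μ𝕋 = ((∫ x, p x ^ 2 ∂μ𝕋 : ℝ) : ℂ) := integral_ofReal
    rw [this]
    simp
  · have e2 : (fun x => (velocity p x : ℂ)) = fun x =>
        -1 * prim (fun y => ((p y ^ 2 : ℝ) : ℂ)) x := by
      funext x
      rw [velocity, Complex.ofReal_neg, prim_ofReal fun y => p y ^ 2]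
      ring
    rw [fourierCoeff_const _ hk, coeff, e2, fourierCoeff.const_mul, fourierCoeff_prim hpi hk]
    have h3 := two_pi_I_mul_ne_zero hk
    field_simp
    ring

/-- The `H¹` norm is controlled by the mean and the derivative, because `1 + k² ≤ (2πk)²` for `k ≠ 0`. -/
theorem hsNorm_one_sq_le (a : ℤ → ℂ) :
    hsNorm 1 a ^ 2 ≤ ‖a 0‖ₑ ^ 2 + ∑' k, ‖grad a k‖ₑ ^ 2 := by
  have h0 : ∑' k : ℤ, (if k = 0 then ‖a 0‖ₑ ^ 2 else 0) = ‖a 0‖ₑ ^ 2 := tsum_ite_eq 0 _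
  rw [hsNorm_sq, ← h0, ← ENNReal.tsum_add]
  refine ENNReal.tsum_le_tsum fun k => ?_
  rw [Real.rpow_one]
  split_ifs with hk
  · rw [hk]
    simp
  · rw [zero_add, ← ofReal_norm (grad a k), norm_grad, ENNReal.ofReal_mul (freq_nonneg k), mul_pow,
      ofReal_norm, ← ENNReal.ofReal_pow (freq_nonneg k)]
    gcongr
    have h1 : (1 : ℝ) ≤ (k : ℝ) ^ 2 := by
      have : (1 : ℤ) ≤ k ^ 2 := by
        have := sq_pos_of_ne_zero hk
        lia
      exact_mod_cast this
    have h2 : (2 : ℝ) ≤ (2 * Real.pi) ^ 2 := by nlinarith [Real.pi_gt_three]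
    rw [freq_sq]
    nlinarith

theorem hsNorm_one_pow_four_le (a : ℤ → ℂ) :
    hsNorm 1 a ^ 4 ≤ 4 * (‖a 0‖ₑ ^ 4 + (∑' k, ‖grad a k‖ₑ ^ 2) ^ 2) := by
  have h := pow_le_pow_left' (hsNorm_one_sq_le a) 2
  rw [← pow_mul] at h
  have key : ∀ x y : ℝ≥0∞, x ≤ y → (x + y) ^ 2 ≤ 4 * y ^ 2 := fun x y hxy => by
    calc (x + y) ^ 2 ≤ (y + y) ^ 2 := by gcongr
      _ = 4 * y ^ 2 := by ring
  have e : ‖a 0‖ₑ ^ 4 = (‖a 0‖ₑ ^ 2) ^ 2 := by ring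
  refine h.trans ?_
  rw [e]
  rcases le_total (‖a 0‖ₑ ^ 2) (∑' k, ‖grad a k‖ₑ ^ 2) with hle | hle
  · refine (key _ _ hle).trans ?_
    gcongr
    exact le_add_self
  · rw [add_comm (‖a 0‖ₑ ^ 2)]
    refine (key _ _ hle).trans ?_
    gcongr
    exact le_self_add

variable {N : ℤ} {ζ₀ : 𝕋 → ℝ} {T : ℝ} {p : ℝ → Ell2}

theorem CoeffSolution.lintegral_hsNorm_lt_top {c : ℤ → ℂ} (hc : Summable fun k => freq k * ‖c k‖ ^ 2)
    (hp : CoeffSolution (nonlin N) c (Ioo 0 T) p) :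
    ∫⁻ t in Ioo 0 T, hsNorm 1 (heat c (src (nonlin N) T p) t) ^ 4 < ⊤ := by
  obtain ⟨M, hM⟩ := isCompact_Icc (a := 0) (b := T) |>.exists_bound_of_continuousOn
    (continuous_heat (c := c) hp.locallyIntegrable_src 0).continuousOn
  have h1 : ∀ᵐ t ∂volume.restrict (Ioo 0 T), hsNorm 1 (heat c (src (nonlin N) T p) t) ^ 4 ≤
      4 * (ENNReal.ofReal M ^ 4 + ‖p t‖ₑ ^ 4) := by
    rw [ae_restrict_iff' measurableSet_Ioo]
    filter_upwards [hp.ae_coe_eq hc] with t h1 ht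
    refine (hsNorm_one_pow_four_le _).trans ?_
    rw [← h1 ht, tsum_enorm_sq, ← pow_mul]
    gcongr
    rw [← ofReal_norm]
    exact ENNReal.ofReal_le_ofReal (hM t (Ioo_subset_Icc_self ht))
  refine (lintegral_mono_ae h1).trans_lt ?_
  rw [lintegral_const_mul' _ _ (by simp), lintegral_add_left measurable_const]
  refine ENNReal.mul_lt_top (by simp) (ENNReal.add_lt_top.2 ⟨?_, ?_⟩)
  · rw [lintegral_const]
    exact ENNReal.mul_lt_top (by simp) (measure_lt_top _ _)
  · have h2 := hp.memLp.2
    rw [eLpNorm_lt_top_iff_lintegral_rpow_enorm_lt_top (by norm_num) (by norm_num)] at h2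
    refine lt_of_eq_of_lt (lintegral_congr fun t => ?_) h2
    rw [ENNReal.toReal_ofNat]
    norm_cast

/-- The function with the Fourier coefficients given by Duhamel's formula is a weak solution. -/
theorem CoeffSolution.isSolution (hT : 0 < T) (hζ₀ : MemHs (1 / 2) ζ₀)
    (hp : CoeffSolution (nonlin N) (coeff ζ₀) (Ioo 0 T) p) {ζ : ℝ → 𝕋 → ℝ}
    (hζ : ∀ t ∈ Ioo 0 T, ζ t = fun x =>
      (torusSeries (heat (coeff ζ₀) (src (nonlin N) T p) t) x).re) :
    IsSolution N ζ₀ T ζ := by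
  have hc := summable_of_hsNorm hζ₀.2
  set A := heat (coeff ζ₀) (src (nonlin N) T p) with hA
  have hr : Rapid T A := hp.rapid hc
  have hrg : Rapid T fun t => grad (A t) := hp.rapid_grad hc
  have hrefl : ∀ t ∈ Ioo 0 T, LimitSystem.refl (A t) = A t := fun t ht => hp.refl_heat hc (refl_coeff _) ht.1.le
  set P : ℝ → 𝕋 → ℝ := fun t x => (torusSeries (grad (A t)) x).re with hP
  have hζc : ∀ t ∈ Ioo 0 T, Continuous (ζ t) := fun t ht => by
    rw [hζ t ht]
    exact continuous_re_torusSeries (hr.summable ht)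
  have hPc : ∀ t ∈ Ioo 0 T, Continuous (P t) := fun t ht =>
    continuous_re_torusSeries (hrg.summable ht)
  have hcζ : ∀ t ∈ Ioo 0 T, coeff (ζ t) = A t := fun t ht => by
    rw [hζ t ht]
    exact coeff_re_torusSeries (hr.summable ht) (hrefl t ht)
  have hcP : ∀ t ∈ Ioo 0 T, coeff (P t) = grad (A t) := fun t ht =>
    coeff_re_torusSeries (hrg.summable ht) (by rw [← grad_refl, hrefl t ht])
  have h4 := hp.lintegral_hsNorm_lt_top hc
  have hmem : ∀ᵐ t ∂volume.restrict (Ioo 0 T), hsNorm 1 (A t) < ⊤ := by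
    rw [ae_restrict_iff' measurableSet_Ioo]
    filter_upwards [hp.ae_coe_eq hc] with t h1 ht
    have h2 := hsNorm_one_sq_le (A t)
    rw [hA, ← h1 ht, tsum_enorm_sq] at h2
    by_contra hcon
    rw [not_lt, top_le_iff] at hcon
    rw [← hA, hcon, ENNReal.top_pow two_ne_zero, top_le_iff] at h2
    simp at h2
  have hwd : ∀ t ∈ Ioo 0 T, HasWeakDeriv (ζ t) (P t) := fun t ht =>
    ⟨(memLp_of_continuous_real (hζc t ht) 1).integrable le_rfl,
      (memLp_of_continuous_real (hPc t ht) 1).integrable le_rfl, fun k => by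
      rw [hcP t ht, hcζ t ht, grad]⟩
  have hvel : ∀ t ∈ Ioo 0 T, IsVelocity (P t) (velocity (P t)) := fun t ht =>
    isVelocity_velocity (hPc t ht)
  refine ⟨⟨?_, ?_, ?_⟩, P, fun t => velocity (P t), ?_, ?_, fun φ hφ => ?_⟩
  · refine aestronglyMeasurable_spaceTime ?_
    refine (Complex.continuous_re.comp_continuousOn hr.continuousOn_torusSeries).congr ?_
    rintro ⟨t, x⟩ hq
    exact congrFun (hζ t hq.1) x
  · filter_upwards [hmem, ae_restrict_mem measurableSet_Ioo] with t h1 ht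
    exact ⟨memLp_of_continuous_real (hζc t ht) 2, by rwa [hcζ t ht]⟩
  · refine lt_of_eq_of_lt (setLIntegral_congr_fun measurableSet_Ioo fun t ht => ?_) h4
    simp only [hcζ t ht, hA]
  · exact aestronglyMeasurable_spaceTime
      (Complex.continuous_re.comp_continuousOn hrg.continuousOn_torusSeries)
  · filter_upwards [ae_restrict_mem measurableSet_Ioo] with t ht using ⟨hwd t ht, hvel t ht⟩
  · refine weak_form hT hφ hζ₀.1 hp.locallyIntegrable_src ?_ ?_ (X := fun t => hsNorm 1 (A t))
      (fun t => ?_) ?_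
    · filter_upwards [ae_restrict_mem measurableSet_Ioo] with t ht using
        ⟨memLp_of_continuous_real (hζc t ht) 2, hcζ t ht⟩
    · have h1 := hp.ae_coe_eq hc
      rw [← ae_restrict_iff' measurableSet_Ioo] at h1
      filter_upwards [hmem, h1, ae_restrict_mem measurableSet_Ioo] with t h1 h2 ht
      have hz : hsNorm 1 (coeff (ζ t)) < ⊤ := by rwa [hcζ t ht]
      refine ⟨?_, ?_⟩
      · have h := (memLp_source_slice N hz (hwd t ht) (hvel t ht))
        exact h.re.congr_norm (by
          have := h.re.1
          simpa using this) (ae_of_all _ fun x => by simp)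
      · rw [coeff_source N hz (hwd t ht) (hvel t ht), hcζ t ht, src_apply ht, hA, ← h2, toEll_coe]
    · rw [hsNorm_sq]
      refine ENNReal.tsum_le_tsum fun k => le_mul_of_one_le_left' ?_
      rw [ENNReal.one_le_ofReal, Real.rpow_one]
      linarith [sq_nonneg (k : ℝ)]
    · refine (lintegral_mono (g := fun t => 1 + hsNorm 1 (A t) ^ 4) fun t => ?_).trans_lt ?_
      · rcases le_total (hsNorm 1 (A t)) 1 with h | h
        · exact h.trans le_self_add
        · exact (le_self_pow h (by norm_num)).trans le_add_self
      · rw [lintegral_add_left measurable_const, lintegral_const]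
        exact ENNReal.add_lt_top.2 ⟨ENNReal.mul_lt_top (by simp) (measure_lt_top _ _), h4⟩

theorem exists_isSolution (N : ℤ) (hζ₀ : MemHs (1 / 2) ζ₀) :
    ∃ T : ℝ, 0 < T ∧ ∃ ζ : ℝ → 𝕋 → ℝ, IsSolution N ζ₀ T ζ := by
  obtain ⟨T, hT, p, hp⟩ := exists_coeffSolution_local (nonlin N) (summable_of_hsNorm hζ₀.2)
  exact ⟨T, hT, _, hp.isSolution hT hζ₀ fun t _ => rfl⟩

/-- Global solutions for `N = 0` and small data. The square of the `H^{1/2}` norm controls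
`∑ |2πk| |c k|²` up to the factor `7`, whence the radius `η / 7`. -/
theorem exists_isSolution_global : ∃ η₀ : ℝ, 0 < η₀ ∧ ∀ ζ₀ : 𝕋 → ℝ, MemHs (1 / 2) ζ₀ →
    hsNorm (1 / 2) (coeff ζ₀) ≤ ENNReal.ofReal η₀ →
      ∃ ζ : ℝ → 𝕋 → ℝ, ∀ T : ℝ, 0 < T → IsSolution 0 ζ₀ T ζ := by
  obtain ⟨η, hη, h⟩ := exists_coeffSolution_global (nonlin 0) nonlin_zero_α
  refine ⟨η / 7, by positivity, fun ζ₀ hζ₀ hle => ?_⟩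
  obtain ⟨p, hp⟩ := h (coeff ζ₀) (summable_of_hsNorm hζ₀.2) <| by
    refine (tsum_freq_le hle (by positivity)).trans ?_
    nlinarith [sq_nonneg η]
  refine ⟨fun t x => (torusSeries (heat (coeff ζ₀) ((Ioi 0).indicator ((nonlin 0).app ∘ p)) t) x).re,
    fun T hT => ?_⟩
  refine (hp.restrict fun t ht => ht.1).isSolution hT hζ₀ fun t ht => ?_
  have e : heat (coeff ζ₀) ((Ioi 0).indicator ((nonlin 0).app ∘ p)) t =
      heat (coeff ζ₀) (src (nonlin 0) T p) t := by
    refine heat_congr ht.1.le (ae_of_all _ fun s hs => ?_)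
    rw [src_apply ⟨hs.1, hs.2.trans_lt ht.2⟩, indicator_of_mem (show s ∈ Ioi 0 from hs.1)]
    rfl
  simp only [e]

end LimitSystem

end

theorem theorem5p1 :
    (∀ (N : ℤ) (ζ₀ : UnitAddCircle → ℝ), LimitSystem.MemHs (1 / 2) ζ₀ →
      -- local existence
      (∃ T : ℝ, 0 < T ∧ ∃ ζ : ℝ → UnitAddCircle → ℝ, LimitSystem.IsSolution N ζ₀ T ζ) ∧
      -- uniqueness
      (∀ T : ℝ, 0 < T → ∀ ζ ζ' : ℝ → UnitAddCircle → ℝ,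
        LimitSystem.IsSolution N ζ₀ T ζ → LimitSystem.IsSolution N ζ₀ T ζ' →
          ∀ᵐ q ∂LimitSystem.spaceTime T, ζ q.1 q.2 = ζ' q.1 q.2) ∧
      -- regularity in time and smoothness
      (∀ T : ℝ, 0 < T → ∀ ζ : ℝ → UnitAddCircle → ℝ, LimitSystem.IsSolution N ζ₀ T ζ →
        LimitSystem.HolderHNegOne ζ₀ T ζ ∧ LimitSystem.IsSmooth T ζ)) ∧
    -- global solutions for small data when `N = 0`
    (∃ η₀ : ℝ, 0 < η₀ ∧ ∀ ζ₀ : UnitAddCircle → ℝ, LimitSystem.MemHs (1 / 2) ζ₀ →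
      LimitSystem.hsNorm (1 / 2) (LimitSystem.coeff ζ₀) ≤ ENNReal.ofReal η₀ →
      ∃ ζ : ℝ → UnitAddCircle → ℝ, ∀ T : ℝ, 0 < T → LimitSystem.IsSolution 0 ζ₀ T ζ) := by
  refine ⟨fun N ζ₀ hζ₀ => ⟨LimitSystem.exists_isSolution N hζ₀,
    fun T hT ζ ζ' h h' => h.unique hT hζ₀ h', fun T hT ζ h => ⟨h.holder hT hζ₀, h.isSmooth hT hζ₀⟩⟩,
    LimitSystem.exists_isSolution_global⟩
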